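/- Let the extended Selberg class $\mathcal S^\sharp$ be the class of not identically vanishing functions $F$ such that (i) $F(s)=\sum_{n\ge1}a(n)n^{-s}$ converges absolutely for $\Re s>1$; (ii) $(s-1)^mF(s)$ extends to an entire function of finite order for some integer $m\ge0$; (iii) $F$ satisfies a functional equation $$Q^s\prod_{j=1}^r\Gamma(\lambda_js+\mu_j)F(s)=\omega\,Q^{1-s}\prod_{j=1}^r\Gamma(\lambda_j(1-s)+\overline{\mu_j})\,\overline{F(1-\overline s)}$$ with $r\ge 0$, $Q>0$, $\lambda_j>0$, $\Re\mu_j\ge0$, $|\omega|=1$. The degree of $F$ is $2\sum_j\lambda_j$, $\sigma_a(F)$ is the abscissa of absolute convergence of the Dirichlet series of $F$, and for an integer $k\ge1$ the $k$-lift of $F$ is $F_k(s)=F(ks+\frac{1-k}{2})$. (1) If $F\in\mathcal S^\sharp$ has degree $d\ge1$, $k\ge1$ is an integer and $F_k\in\mathcal S^\sharp$, then $$\frac12+\frac1{2kd}\le\sigma_a(F_k)\le\frac12+\frac1{2k}.$$ (2) Let $f=\sum_{n\ge1}a(n)e^{2\pi inz}$ be a holomorphic cuspidal eigenform of level $N\geq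 1$, integral weight $K\ge1$ and character $\chi$ mod $N$, that is, a nonzero element of $S_K(\Gamma_0(N),\chi)$ which is an eigenfunction of all Hecke operators $T_n$ ($n\ge1$) of level $N$ and of their adjoints. Let $F$ be its normalized $L$-function, the entire continuation of $\sum_{n\ge1} a(n)n^{-(K-1)/2}n^{-s}$. Then $F\in\mathcal S^\sharp$, $F$ has degree $2$, and $F_k\in\mathcal S^\sharp$ for every integer $1\le k\le K$. (3) For every $\varepsilon>0$ and every $M$ there are an eigenform as in (2) of weight $K\ge M$, with normalized $L$-function $F$, and an integer $1\le k\le K$ such that $F_k\in\mathcal S^\sharp$ and $$\frac12<\sigma_a(F_k)<\frac12+\varepsilon.$$ In particular, $\mathcal S^\sharp$ contains functions with $\sigma_a$ arbitrarily close to $\frac12$. -/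

import Mathlib

open Filter Asymptotics

noncomputable section

/-- `F` is given, in some right half-plane, by the absolutely convergent Dirichlet series
`∑ a(n) n^{-s}`, `n ≥ 1`. (A Dirichlet series that converges somewhere converges absolutely in
some right half-plane.) -/
def HasDirichletSeries (F : ℂ → ℂ) (a : ℕ → ℂ) : Prop :=
  ∃ c : ℝ, ∀ s : ℂ, c < s.re → LSeriesSummable a s ∧ F s = LSeries a s

/-- The abscissa of absolute convergence `σ_a(F)` of the Dirichlet series of `F`. The coefficients
of that series are unique, so that the infimum is over a single value, see
`sigmaA_eq_abscissaOfAbsConv`; it is `⊤` when `F` has no Dirichlet series. -/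
def sigmaA (F : ℂ → ℂ) : EReal :=
  ⨅ (a : ℕ → ℂ) (_ : HasDirichletSeries F a), LSeries.abscissaOfAbsConv a

theorem abscissa_eq_of_hasDirichletSeries {F : ℂ → ℂ} {a b : ℕ → ℂ}
    (ha : HasDirichletSeries F a) (hb : HasDirichletSeries F b) :
    LSeries.abscissaOfAbsConv a = LSeries.abscissaOfAbsConv b := by
  obtain ⟨c, hc⟩ := ha
  obtain ⟨e, he⟩ := hb
  have lt_top : ∀ {u : ℕ → ℂ} {x : ℝ}, (∀ s : ℂ, x < s.re → LSeriesSummable u s) →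
      LSeries.abscissaOfAbsConv u < ⊤ := by
    intro u x h
    have hx : LSeriesSummable u ((x + 1 : ℝ) : ℂ) := h _ (by simp)
    exact lt_of_le_of_lt hx.abscissaOfAbsConv_le (EReal.coe_lt_top _)
  have h1 := lt_top (fun s hs => (hc s hs).1)
  have h2 := lt_top (fun s hs => (he s hs).1)
  have key : (fun x : ℝ => LSeries a x) =ᶠ[atTop] fun x : ℝ => LSeries b x := by
    filter_upwards [eventually_gt_atTop c, eventually_gt_atTop e] with x hx1 hx2
    rw [← (hc (x : ℂ) (by simpa using hx1)).2, ← (he (x : ℂ) (by simpa using hx2)).2]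
  have hab : ∀ n : ℕ, n ≠ 0 → a n = b n :=
    (fun n hn => LSeries.eq_of_LSeries_eventually_eq h1 h2 key hn)
  exact LSeries.abscissaOfAbsConv_congr (fun {n} hn => hab n hn)

theorem sigmaA_eq_abscissaOfAbsConv {F : ℂ → ℂ} {a : ℕ → ℂ} (ha : HasDirichletSeries F a) :
    sigmaA F = LSeries.abscissaOfAbsConv a :=
  le_antisymm (iInf₂_le a ha)
    (le_iInf₂ fun _ hb => (abscissa_eq_of_hasDirichletSeries ha hb).le)

/-- The functional equation
`Q^s ∏ Γ(λ_j s + μ_j) F(s) = ω Q^{1-s} ∏ Γ(λ_j (1-s) + conj μ_j) conj (F(1 - conj s))`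
with `Q > 0`, `λ_j > 0`, `Re μ_j ≥ 0` and `|ω| = 1`, as an identity of meromorphic functions:
it is required at all `s` where no factor on either side can have a pole. -/
structure SatisfiesFunctionalEquation (F : ℂ → ℂ) (r : ℕ) (Q : ℝ) (lam : Fin r → ℝ)
    (mu : Fin r → ℂ) (omega : ℂ) : Prop where
  Q_pos : 0 < Q
  lam_pos : ∀ j, 0 < lam j
  mu_re_nonneg : ∀ j, 0 ≤ (mu j).re
  norm_omega : ‖omega‖ = 1
  eqn : ∀ s : ℂ, s ≠ 0 → s ≠ 1 →
    (∀ (j : Fin r) (n : ℕ), (lam j : ℂ) * s + mu j ≠ -(n : ℂ)) →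
    (∀ (j : Fin r) (n : ℕ), (lam j : ℂ) * (1 - s) + star (mu j) ≠ -(n : ℂ)) →
    (Q : ℂ) ^ s * (∏ j, Complex.Gamma ((lam j : ℂ) * s + mu j)) * F s =
      omega * (Q : ℂ) ^ (1 - s) *
        (∏ j, Complex.Gamma ((lam j : ℂ) * (1 - s) + star (mu j))) * star (F (1 - star s))

/-- The extended Selberg class. A member is a function `ℂ → ℂ`, which is holomorphic outside `1`
and at `1` is holomorphic or has a pole; its value at a pole is immaterial. -/
structure InExtendedSelbergClass (F : ℂ → ℂ) : Prop where
  ne_zero : F ≠ 0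
  dirichlet : ∃ a : ℕ → ℂ, ∀ s : ℂ, 1 < s.re → LSeriesSummable a s ∧ F s = LSeries a s
  /-- `m` is the order of the pole at `1`, and `(s-1)^m F(s)` is an entire function `G` of
  finite order. -/
  continuation : ∃ (m : ℕ) (G : ℂ → ℂ), Differentiable ℂ G ∧
    (∃ A : ℝ, G =O[Bornology.cobounded ℂ] fun s : ℂ => Real.exp (‖s‖ ^ A)) ∧
    (∀ s : ℂ, s ≠ 1 ∨ m = 0 → (s - 1) ^ m * F s = G s) ∧ (m = 0 ∨ G 1 ≠ 0)
  functional_equation : ∃ (r : ℕ) (Q : ℝ) (lam : Fin r → ℝ) (mu : Fin r → ℂ) (omega : ℂ),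
    SatisfiesFunctionalEquation F r Q lam mu omega

/-- `F` has degree `d`: it satisfies a functional equation with `2 ∑ λ_j = d`. (The degree is an
invariant of nonzero members of the class.) -/
def HasDegree (F : ℂ → ℂ) (d : ℝ) : Prop :=
  ∃ (r : ℕ) (Q : ℝ) (lam : Fin r → ℝ) (mu : Fin r → ℂ) (omega : ℂ),
    SatisfiesFunctionalEquation F r Q lam mu omega ∧ 2 * ∑ j, lam j = d

/-- The `k`-lift `F_k(s) = F(ks + (1-k)/2)`. -/
def kLift (k : ℕ) (F : ℂ → ℂ) : ℂ → ℂ :=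
  fun s => F ((k : ℂ) * s + (1 - (k : ℂ)) / 2)

/-- Cusp forms of weight `K` for `Γ₁(N)`. -/
abbrev CuspFormGamma1 (N : ℕ) (K : ℤ) : Type :=
  CuspForm ((CongruenceSubgroup.Gamma1 N).map (Matrix.SpecialLinearGroup.mapGL ℝ)) K

/-- The Hecke operator `T_n` in weight `K`, level `N` and character `χ`:
`(T_n f)(z) = n^{K-1} ∑_{ad = n} χ(a) d^{-K} ∑_{0 ≤ b < d} f((az+b)/d)`.
For primes `p ∣ N` this is the operator often written `U_p`. -/
def heckeT {N : ℕ} (χ : DirichletCharacter ℂ N) (K : ℤ) (n : ℕ) (f : UpperHalfPlane → ℂ) :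
    UpperHalfPlane → ℂ := fun z =>
  (n : ℂ) ^ (K - 1) * ∑ p ∈ n.divisorsAntidiagonal, χ (p.1 : ZMod N) * (p.2 : ℂ) ^ (-K) *
    ∑ b ∈ Finset.range p.2,
      f (UpperHalfPlane.ofComplex (((p.1 : ℂ) * (z : ℂ) + (b : ℂ)) / (p.2 : ℂ)))

/-- The Fricke involution `(f|W_N)(z) = N^{-K/2} z^{-K} f(-1/(Nz))`; it is the identity on forms
of level one. -/
def fricke (N : ℕ) (K : ℤ) (f : UpperHalfPlane → ℂ) : UpperHalfPlane → ℂ := fun z =>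
  (N : ℂ) ^ (-(K : ℂ) / 2) * (z : ℂ) ^ (-K) *
    f (UpperHalfPlane.ofComplex (-1 / ((N : ℂ) * (z : ℂ))))

/-- `f` is a (holomorphic, cuspidal) eigenform of level `N`, weight `K` and character `χ`: a
nonzero element of `S_K(Γ₀(N), χ)` which is an eigenfunction of all Hecke operators `T_n` of
level `N`, and of their adjoints `W_N⁻¹ T_n W_N` (equivalently: `f|W_N`, which has character
`χ⁻¹`, is an eigenfunction of all `T_n`). These are the scalar multiples of the newforms of
level `N`; for `N = 1` they are the usual Hecke eigenforms. -/
structure IsEigenform {N : ℕ} {K : ℤ} (χ : DirichletCharacter ℂ N) (f : CuspFormGamma1 N K) :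
    Prop where
  ne_zero : f ≠ 0
  character : ∀ γ ∈ CongruenceSubgroup.Gamma0 N, ∀ z : UpperHalfPlane,
    f (γ • z) = χ ((γ 1 1 : ℤ) : ZMod N) *
      (((γ 1 0 : ℤ) : ℂ) * (z : ℂ) + ((γ 1 1 : ℤ) : ℂ)) ^ K * f z
  eigen : ∀ n : ℕ, 1 ≤ n → ∃ c : ℂ, ∀ z : UpperHalfPlane, heckeT χ K n f z = c * f z
  eigen_adjoint : ∀ n : ℕ, 1 ≤ n → ∃ c : ℂ, ∀ z : UpperHalfPlane,
    heckeT χ⁻¹ K n (fricke N K f) z = c * fricke N K f z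

/-- The normalized `L`-function of a cusp form `f = ∑ a(n) e(nz)` of weight `K` for `Γ₁(N)`: the
entire continuation of `∑ a(n) n^{-(K-1)/2} n^{-s}`, i.e. the shift `L(f, s + (K-1)/2)` of
the classical `L`-function, whose functional equation relates `s` with `K - s`. -/
def normalizedL {N : ℕ} [NeZero N] {K : ℤ} (hK : 0 < K) (f : CuspFormGamma1 N K) : ℂ → ℂ :=
  fun s => ModularForm.L hK f (s + ((K : ℂ) - 1) / 2)

end

/-! Bounds for lifts. In the critical strip the functional equation reads `E(s) F(s) = ω conj (F(1 -
conj s))`, where `E = exp (logGammaQuotient ..)` satisfies `|E(σ + it)| ≪ t^(d (σ - 1/2) (1 + η))`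
for every `η > 0`. Suppose that the Dirichlet series converges absolutely at some `σ` with `1/2 < σ
< 1`, let `a(m) ≠ 0`, and integrate `E(s) F(s) m^(-s)` around the rectangle with vertical sides `Re
s = 1 - σ` and `Re s = σ` between the heights `T` and `2T`. On the left side the functional equation
turns the integrand into the conjugate of `F(σ + it) m^(it)` up to a constant factor, and the term
`n = m` contributes a nonzero multiple of `T`. On the right side the series is integrated term by
term: the phase of `E` has second derivative of order `1/t`, so van der Corput's test bounds every
term by `√T |E(σ + 2iT)|`, uniformly in the frequency `log n`. The horizontal sides are smaller by
Phragmén–Lindelöf. Hence `T ≪ T^(1/2 + d (σ - 1/2) (1 + η))`, which forces `σ ≥ 1/2 + 1/(2d)`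
(`SatisfiesFunctionalEquation.half_le_of_LSeriesSummable`,
`InExtendedSelbergClass.le_of_LSeriesSummable`). A lift transports abscissae by `σ ↦ (σ + (k - 1)/2)
/ k`; this bound and the convergence for `Re s > 1` give both inequalities (`sigmaA_kLift_bounds`).
The gamma function enters only through Euler's product and the series for its logarithmic
derivative.

Eigenforms. Unfolding the Petersson product against a partition of unity shows that the eigenvalues
of `T_n` on `f` and on `f|W_N` are complex conjugates (`heckeT_eigenvalue_eq_conj`). By multiplicity
one for Fourier coefficients, those of `f|W_N` are proportional to the conjugates of those of `f`,
so the Mellin transform of `f` on the imaginary axis has a functional equation of Selberg type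
(`IsEigenform.exists_Lambda_eq`). Absolute convergence for `Re s > 1` needs only the mean square of
the coefficients. After a `k`-lift the gamma factor is `Γ(ks + (K - k)/2)`, and the condition `Re μ
≥ 0` is exactly `k ≤ K` (`IsEigenform.kLift_mem`).

Approach to `1/2`. In level one and weight `12(j + 1)` there are nonzero cusp forms, and the
commuting Hecke operators have a common eigenvector (`exists_isEigenform`). Lifting with `k = K` and
using degree `2` places the abscissa between `1/2 + 1/(4K)` and `1/2 + 1/(2K)`. -/

/-! ### Derivative tests for oscillatory integrals -/

theorem hasDerivAt_norm_of_logDeriv {g : ℝ → ℂ} {t : ℝ} {D : ℂ} (hg : HasDerivAt g (D * g t) t)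
    (h0 : g t ≠ 0) : HasDerivAt (fun t => ‖g t‖) (D.re * ‖g t‖) t := by
  have h1 := hg.norm_sq
  have h2 : ‖g t‖ ^ 2 ≠ 0 := by simpa using h0
  have h3 := h1.sqrt h2
  have e : (fun y => √(‖g y‖ ^ 2)) = fun y => ‖g y‖ := by
    ext y; exact Real.sqrt_sq (norm_nonneg _)
  rw [e] at h3
  convert h3 using 1
  have h4 : inner ℝ (g t) (D * g t) = D.re * ‖g t‖ ^ 2 := by
    rw [Complex.inner, mul_assoc, Complex.mul_conj, Complex.normSq_eq_norm_sq, Complex.re_mul_ofReal]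
  have h5 : ‖g t‖ ≠ 0 := by simpa using h0
  rw [h4, Real.sqrt_sq (norm_nonneg _)]
  field_simp

/-- The first derivative test, in terms of the logarithmic derivative `D` of the integrand. -/
theorem norm_integral_le_of_le_abs_logDeriv_im {g D D' : ℝ → ℂ} {a b δ : ℝ} (hab : a ≤ b)
    (hδ : 0 < δ) (hg : ∀ t ∈ Set.Icc a b, HasDerivAt g (D t * g t) t)
    (h0 : ∀ t ∈ Set.Icc a b, g t ≠ 0) (hD : ∀ t ∈ Set.Icc a b, HasDerivAt D (D' t) t)
    (hD'c : ContinuousOn D' (Set.Icc a b)) (hre : ∀ t ∈ Set.Icc a b, 0 ≤ (D t).re)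
    (him : ∀ t ∈ Set.Icc a b, 0 ≤ (D' t).im)
    (hβ : (∀ t ∈ Set.Icc a b, δ ≤ (D t).im) ∨ ∀ t ∈ Set.Icc a b, (D t).im ≤ -δ) :
    ‖∫ t in a..b, g t‖ ≤ 3 * ‖g b‖ / δ := by
  have hu : Set.uIcc a b = Set.Icc a b := Set.uIcc_of_le hab
  have ma : a ∈ Set.Icc a b := Set.left_mem_Icc.2 hab
  have mb : b ∈ Set.Icc a b := Set.right_mem_Icc.2 hab
  have hgc : ContinuousOn g (Set.Icc a b) := fun t ht => (hg t ht).continuousAt.continuousWithinAt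
  have hDc : ContinuousOn D (Set.Icc a b) := fun t ht => (hD t ht).continuousAt.continuousWithinAt
  have hβc : ContinuousOn (fun t => (D t).im) (Set.Icc a b) := Complex.continuous_im.comp_continuousOn hDc
  have hβ'c : ContinuousOn (fun t => (D' t).im) (Set.Icc a b) :=
    Complex.continuous_im.comp_continuousOn hD'c
  have hαc : ContinuousOn (fun t => (D t).re) (Set.Icc a b) := Complex.continuous_re.comp_continuousOn hDc
  have hβabs : ∀ t ∈ Set.Icc a b, δ ≤ |(D t).im| := fun t ht => by
    rcases hβ with h | h
    · exact (h t ht).trans (le_abs_self _)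
    · exact (by linarith [h t ht] : δ ≤ -(D t).im).trans (neg_le_abs _)
  have hβ0 : ∀ t ∈ Set.Icc a b, (D t).im ≠ 0 := fun t ht h => by
    have := hβabs t ht
    rw [h, abs_zero] at this
    linarith
  have hN : ∀ t ∈ Set.Icc a b, HasDerivAt (fun t => ‖g t‖) ((D t).re * ‖g t‖) t :=
    fun t ht => hasDerivAt_norm_of_logDeriv (hg t ht) (h0 t ht)
  have hmono : MonotoneOn (fun t => ‖g t‖) (Set.Icc a b) := by
    refine monotoneOn_of_deriv_nonneg (convex_Icc a b) hgc.norm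
      (fun t ht => (hN t (interior_subset ht)).differentiableAt.differentiableWithinAt) fun t ht => ?_
    rw [(hN t (interior_subset ht)).deriv]
    exact mul_nonneg (hre t (interior_subset ht)) (norm_nonneg _)
  have hDim : ∀ t ∈ Set.Icc a b, HasDerivAt (fun t => (D t).im) ((D' t).im) t := fun t ht => by
    simpa using! (Complex.imCLM.hasFDerivAt.comp_hasDerivAt t (hD t ht))
  -- Integration by parts: with `D = α + iβ` the derivative of `g / (iβ)` is `g` plus an error `e`,
  -- which comes from the growth `α` of the modulus and from the variation `β'` of the frequency.
  set h : ℝ → ℂ := fun t => g t / (Complex.I * ((D t).im : ℂ)) with hh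
  have hder : ∀ t ∈ Set.Icc a b, HasDerivAt h
      (g t + ((D t).re / (Complex.I * (D t).im) * g t -
        g t * (D' t).im / (Complex.I * ((D t).im : ℂ) ^ 2))) t := fun t ht => by
    have hne : (((D t).im : ℝ) : ℂ) ≠ 0 := by exact_mod_cast hβ0 t ht
    have h1 := (hg t ht).div (((hDim t ht).ofReal_comp).const_mul Complex.I)
      (mul_ne_zero Complex.I_ne_zero hne)
    refine h1.congr_deriv ?_
    have hDt : D t = (D t).re + (D t).im * Complex.I := (Complex.re_add_im _).symm
    set α := (D t).re
    set β := (D t).im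
    rw [hDt]
    have := Complex.I_ne_zero
    field_simp
    ring
  set e : ℝ → ℂ := fun t => (D t).re / (Complex.I * (D t).im) * g t -
        g t * (D' t).im / (Complex.I * ((D t).im : ℂ) ^ 2) with he
  have hec : ContinuousOn e (Set.Icc a b) := by
    have c1 : ContinuousOn (fun t => ((D t).im : ℂ)) (Set.Icc a b) :=
      Complex.continuous_ofReal.comp_continuousOn hβc
    have c2 : ContinuousOn (fun t => ((D t).re : ℂ)) (Set.Icc a b) :=
      Complex.continuous_ofReal.comp_continuousOn hαc
    have c3 : ContinuousOn (fun t => ((D' t).im : ℂ)) (Set.Icc a b) :=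
      Complex.continuous_ofReal.comp_continuousOn hβ'c
    have hne : ∀ t ∈ Set.Icc a b, (((D t).im : ℝ) : ℂ) ≠ 0 := fun t ht => by
      exact_mod_cast hβ0 t ht
    refine ((c2.div (continuousOn_const.mul c1) fun t ht =>
      mul_ne_zero Complex.I_ne_zero (hne t ht)).mul hgc).sub ((hgc.mul c3).div
        (continuousOn_const.mul (c1.pow 2)) fun t ht =>
          mul_ne_zero Complex.I_ne_zero (pow_ne_zero _ (hne t ht)))
  have i1 : IntervalIntegrable g MeasureTheory.volume a b := (hu ▸ hgc).intervalIntegrable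
  have i2 : IntervalIntegrable e MeasureTheory.volume a b := (hu ▸ hec).intervalIntegrable
  have key : (∫ t in a..b, g t) = h b - h a - ∫ t in a..b, e t := by
    have := intervalIntegral.integral_eq_sub_of_hasDerivAt (f := h) (f' := fun t => g t + e t)
      (fun t ht => hder t (hu ▸ ht)) (i1.add i2)
    rw [intervalIntegral.integral_add i1 i2] at this
    rw [← this]; ring
  -- `|e|` is at most the derivative of `‖g‖ / δ - ‖g b‖ / β`, because `α ‖g‖` is the derivative of
  -- `‖g‖` and `β' / β²` is that of `-1/β`. Its total increment cancels the boundary term `‖g a‖ /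
  -- δ`.
  have hBder : ∀ t ∈ Set.Icc a b, HasDerivAt (fun t => ‖g t‖ / δ - ‖g b‖ * ((D t).im)⁻¹)
      ((D t).re * ‖g t‖ / δ - ‖g b‖ * (-(D' t).im / (D t).im ^ 2)) t := fun t ht =>
    ((hN t ht).div_const δ).sub (((hDim t ht).inv (hβ0 t ht)).const_mul _)
  have hB'c : ContinuousOn (fun t => (D t).re * ‖g t‖ / δ - ‖g b‖ * (-(D' t).im / (D t).im ^ 2))
      (Set.Icc a b) :=
    ((hαc.mul hgc.norm).div_const _).sub (continuousOn_const.mul ((hβ'c.neg).div (hβc.pow 2)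
      fun t ht => pow_ne_zero _ (hβ0 t ht)))
  have i3 := (hu ▸ hB'c : ContinuousOn _ (Set.uIcc a b)).intervalIntegrable (μ := MeasureTheory.volume)
  have hbound : ‖∫ t in a..b, e t‖ ≤
      (‖g b‖ / δ - ‖g b‖ * ((D b).im)⁻¹) - (‖g a‖ / δ - ‖g b‖ * ((D a).im)⁻¹) := by
    rw [← intervalIntegral.integral_eq_sub_of_hasDerivAt (fun t ht => hBder t (hu ▸ ht)) i3]
    refine intervalIntegral.norm_integral_le_of_norm_le hab (Eventually.of_forall fun t ht => ?_) i3
    have ht' : t ∈ Set.Icc a b := Set.Ioc_subset_Icc_self ht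
    refine (norm_sub_le _ _).trans ?_
    rw [sub_eq_add_neg, ← mul_neg, neg_div, neg_neg]
    refine add_le_add ?_ ?_
    · rw [norm_mul, norm_div, norm_mul, Complex.norm_I, one_mul, Complex.norm_real, Complex.norm_real,
        Real.norm_of_nonneg (hre t ht'), div_mul_eq_mul_div]
      exact div_le_div_of_nonneg_left (mul_nonneg (hre t ht') (norm_nonneg _)) hδ (hβabs t ht')
    · rw [norm_div, norm_mul, norm_mul, Complex.norm_I, one_mul, norm_pow, Complex.norm_real,
        Complex.norm_real, Real.norm_of_nonneg (him t ht'), mul_div_assoc, Real.norm_eq_abs, sq_abs]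
      exact mul_le_mul_of_nonneg_right (hmono ht' mb ht'.2)
        (div_nonneg (him t ht') (sq_nonneg _))
  have hhn : ∀ t ∈ Set.Icc a b, ‖h t‖ ≤ ‖g t‖ / δ := fun t ht => by
    rw [hh]
    simp only [norm_div, norm_mul, Complex.norm_I, one_mul, Complex.norm_real, Real.norm_eq_abs]
    exact div_le_div_of_nonneg_left (norm_nonneg _) hδ (hβabs t ht)
  -- As `β` keeps its sign, one of the two reciprocals can be dropped; estimating them separately
  -- would cost a factor 2.
  have hinv : ((D a).im)⁻¹ - ((D b).im)⁻¹ ≤ 1 / δ := by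
    rcases hβ with hp | hp
    · have h1 : ((D a).im)⁻¹ ≤ δ⁻¹ := inv_anti₀ hδ (hp a ma)
      have h2 : 0 ≤ ((D b).im)⁻¹ := inv_nonneg.2 (hδ.le.trans (hp b mb))
      rw [one_div]; linarith
    · have h1 : (-(D b).im)⁻¹ ≤ δ⁻¹ := inv_anti₀ hδ (by linarith [hp b mb])
      have h2 : 0 ≤ (-(D a).im)⁻¹ := inv_nonneg.2 (by linarith [hp a ma])
      rw [inv_neg] at h1 h2
      rw [one_div]; linarith
  rw [key]
  calc ‖h b - h a - ∫ t in a..b, e t‖ ≤ ‖h b‖ + ‖h a‖ + ‖∫ t in a..b, e t‖ :=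
        (norm_sub_le _ _).trans (add_le_add_left (norm_sub_le _ _) _)
    _ ≤ ‖g b‖ / δ + ‖g a‖ / δ +
        ((‖g b‖ / δ - ‖g b‖ * ((D b).im)⁻¹) - (‖g a‖ / δ - ‖g b‖ * ((D a).im)⁻¹)) :=
        add_le_add (add_le_add (hhn b mb) (hhn a ma)) hbound
    _ = 2 * ‖g b‖ / δ + ‖g b‖ * (((D a).im)⁻¹ - ((D b).im)⁻¹) := by ring
    _ ≤ 2 * ‖g b‖ / δ + ‖g b‖ * (1 / δ) := by gcongr
    _ = 3 * ‖g b‖ / δ := by ring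

/-- The alternatives `c = a` and `c = b` cover a level that is not attained; the corresponding piece
of the interval is then a point. -/
theorem exists_threshold_of_monotoneOn {β : ℝ → ℝ} {a b : ℝ} (hab : a ≤ b)
    (hm : MonotoneOn β (Set.Icc a b)) (hc : ContinuousOn β (Set.Icc a b)) (l : ℝ) :
    ∃ c ∈ Set.Icc a b, (c = a ∨ ∀ t ∈ Set.Icc a c, β t ≤ l) ∧
      (c = b ∨ ∀ t ∈ Set.Icc c b, l ≤ β t) := by
  rcases le_total l (β a) with h | h
  · exact ⟨a, ⟨le_rfl, hab⟩, Or.inl rfl, Or.inr fun t ht =>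
      h.trans (hm ⟨le_rfl, hab⟩ ht ht.1)⟩
  rcases le_total (β b) l with h' | h'
  · exact ⟨b, ⟨hab, le_rfl⟩, Or.inr fun t ht => (hm ht ⟨hab, le_rfl⟩ ht.2).trans h', Or.inl rfl⟩
  obtain ⟨c, hcm, rfl⟩ := intermediate_value_Icc hab hc ⟨h, h'⟩
  exact ⟨c, hcm, Or.inr fun t ht => hm ⟨ht.1, ht.2.trans hcm.2⟩ hcm ht.2,
    Or.inr fun t ht => hm hcm ⟨hcm.1.trans ht.1, ht.2⟩ ht.1⟩

/-- Van der Corput's second derivative test, in terms of the logarithmic derivative `D` of the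
integrand. -/
theorem norm_integral_le_of_le_deriv_logDeriv_im {g D D' : ℝ → ℂ} {a b r : ℝ} (hab : a ≤ b)
    (hr : 0 < r) (hg : ∀ t ∈ Set.Icc a b, HasDerivAt g (D t * g t) t)
    (h0 : ∀ t ∈ Set.Icc a b, g t ≠ 0) (hD : ∀ t ∈ Set.Icc a b, HasDerivAt D (D' t) t)
    (hD'c : ContinuousOn D' (Set.Icc a b)) (hre : ∀ t ∈ Set.Icc a b, 0 ≤ (D t).re)
    (him : ∀ t ∈ Set.Icc a b, r ≤ (D' t).im) :
    ‖∫ t in a..b, g t‖ ≤ 8 * ‖g b‖ / √r := by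
  have mb : b ∈ Set.Icc a b := Set.right_mem_Icc.2 hab
  have hgc : ContinuousOn g (Set.Icc a b) := fun t ht => (hg t ht).continuousAt.continuousWithinAt
  have hDim : ∀ t ∈ Set.Icc a b, HasDerivAt (fun t => (D t).im) ((D' t).im) t := fun t ht => by
    simpa using! (Complex.imCLM.hasFDerivAt.comp_hasDerivAt t (hD t ht))
  have hβc : ContinuousOn (fun t => (D t).im) (Set.Icc a b) := fun t ht =>
    (hDim t ht).continuousAt.continuousWithinAt
  have hN : ∀ t ∈ Set.Icc a b, HasDerivAt (fun t => ‖g t‖) ((D t).re * ‖g t‖) t :=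
    fun t ht => hasDerivAt_norm_of_logDeriv (hg t ht) (h0 t ht)
  have hmono : MonotoneOn (fun t => ‖g t‖) (Set.Icc a b) := by
    refine monotoneOn_of_deriv_nonneg (convex_Icc a b) hgc.norm
      (fun t ht => (hN t (interior_subset ht)).differentiableAt.differentiableWithinAt) fun t ht => ?_
    rw [(hN t (interior_subset ht)).deriv]
    exact mul_nonneg (hre t (interior_subset ht)) (norm_nonneg _)
  have hβm : MonotoneOn (fun t => (D t).im) (Set.Icc a b) := by
    refine monotoneOn_of_deriv_nonneg (convex_Icc a b) hβc
      (fun t ht => (hDim t (interior_subset ht)).differentiableAt.differentiableWithinAt) fun t ht => ?_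
    rw [(hDim t (interior_subset ht)).deriv]
    exact hr.le.trans (him t (interior_subset ht))
  -- The interval is cut where the frequency crosses `-δ` and `δ`. The outer pieces cost `3/δ` each
  -- by the first derivative test, the middle one has length at most `2δ/r`; `δ = √r` balances these
  -- to `(3 + 2 + 3)/√r`.
  set δ := √r with hδ
  have hδ0 : 0 < δ := Real.sqrt_pos.2 hr
  obtain ⟨c, hc, hc1, hc2⟩ := exists_threshold_of_monotoneOn hab hβm hβc (-δ)
  have hcb : Set.Icc c b ⊆ Set.Icc a b := Set.Icc_subset_Icc_left hc.1
  obtain ⟨e, he, he1, he2⟩ := exists_threshold_of_monotoneOn hc.2 (hβm.mono hcb) (hβc.mono hcb) δ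
  have hac : Set.Icc a c ⊆ Set.Icc a b := Set.Icc_subset_Icc_right hc.2
  have heb : Set.Icc e b ⊆ Set.Icc a b := Set.Icc_subset_Icc_left (hc.1.trans he.1)
  have hce : Set.Icc c e ⊆ Set.Icc a b := Set.Icc_subset_Icc hc.1 he.2
  have int : ∀ x ∈ Set.Icc a b, ∀ y ∈ Set.Icc a b, IntervalIntegrable g MeasureTheory.volume x y :=
    fun x hx y hy => (hgc.mono (Set.uIcc_subset_Icc hx hy)).intervalIntegrable
  have me : e ∈ Set.Icc a b := hcb he
  have ma : a ∈ Set.Icc a b := Set.left_mem_Icc.2 hab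
  have split : (∫ t in a..b, g t) = (∫ t in a..c, g t) + (∫ t in c..e, g t) + ∫ t in e..b, g t := by
    rw [intervalIntegral.integral_add_adjacent_intervals (int a ma c hc) (int c hc e me),
      intervalIntegral.integral_add_adjacent_intervals (int a ma e me) (int e me b mb)]
  have b1 : ‖∫ t in a..c, g t‖ ≤ 3 * ‖g b‖ / δ := by
    rcases hc1 with rfl | h
    · simp only [intervalIntegral.integral_same, norm_zero]; positivity
    refine (norm_integral_le_of_le_abs_logDeriv_im hc.1 hδ0 (fun t ht => hg t (hac ht))
      (fun t ht => h0 t (hac ht)) (fun t ht => hD t (hac ht)) (hD'c.mono hac)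
      (fun t ht => hre t (hac ht)) (fun t ht => hr.le.trans (him t (hac ht))) (Or.inr h)).trans ?_
    have := hmono hc mb hc.2
    gcongr
  have b3 : ‖∫ t in e..b, g t‖ ≤ 3 * ‖g b‖ / δ := by
    rcases he2 with rfl | h
    · simp only [intervalIntegral.integral_same, norm_zero]; positivity
    exact norm_integral_le_of_le_abs_logDeriv_im he.2 hδ0 (fun t ht => hg t (heb ht))
      (fun t ht => h0 t (heb ht)) (fun t ht => hD t (heb ht)) (hD'c.mono heb)
      (fun t ht => hre t (heb ht)) (fun t ht => hr.le.trans (him t (heb ht))) (Or.inl h)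
  have b2 : ‖∫ t in c..e, g t‖ ≤ 2 * ‖g b‖ / δ := by
    have hlen : r * (e - c) ≤ 2 * δ := by
      rcases eq_or_lt_of_le he.1 with h | h
      · rw [← h]; simp [hδ0.le]
      have l1 : -δ ≤ (D c).im := by
        rcases hc2 with h' | h'
        · exact absurd (h'.symm ▸ he.2) (not_le.2 h)
        · exact h' c ⟨le_rfl, hc.2⟩
      have l2 : (D e).im ≤ δ := by
        rcases he1 with h' | h'
        · exact absurd h'.symm h.ne
        · exact h' e ⟨he.1, le_rfl⟩
      have := (convex_Icc c e).mul_sub_le_image_sub_of_le_deriv (hβc.mono hce)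
        (fun t ht => (hDim t (hce (interior_subset ht))).differentiableAt.differentiableWithinAt)
        (C := r) (fun t ht => by
          rw [(hDim t (hce (interior_subset ht))).deriv]
          exact him t (hce (interior_subset ht))) c ⟨le_rfl, he.1⟩ e ⟨he.1, le_rfl⟩ he.1
      linarith
    have := intervalIntegral.norm_integral_le_of_norm_le_const (a := c) (b := e) (f := g)
      (C := ‖g b‖) fun t ht => by
        rw [Set.uIoc_of_le he.1] at ht
        have ht' := hce (Set.Ioc_subset_Icc_self ht)
        exact hmono ht' mb ht'.2
    refine this.trans ?_
    rw [abs_of_nonneg (sub_nonneg.2 he.1)]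
    have h2 : (e - c) ≤ 2 / δ := by
      rw [le_div_iff₀ hδ0]
      have : r = δ * δ := (Real.mul_self_sqrt hr.le).symm
      rw [this] at hlen
      nlinarith
    calc ‖g b‖ * (e - c) ≤ ‖g b‖ * (2 / δ) := by gcongr
      _ = 2 * ‖g b‖ / δ := by ring
  rw [split]
  calc _ ≤ ‖∫ t in a..c, g t‖ + ‖∫ t in c..e, g t‖ + ‖∫ t in e..b, g t‖ := norm_add₃_le
    _ ≤ 3 * ‖g b‖ / δ + 2 * ‖g b‖ / δ + 3 * ‖g b‖ / δ := add_le_add (add_le_add b1 b2) b3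
    _ = _ := by ring

/-! ### Log-gamma, digamma and trigamma series on the right half-plane -/

noncomputable section

/-- The terms of Euler's series for `log Γ`. -/
def logGammaTerm (m : ℕ) (z : ℂ) : ℂ :=
  z * (Real.log (1 + 1 / ((m : ℝ) + 1)) : ℂ) - Complex.log (1 + z / ((m : ℂ) + 1))

/-- The holomorphic logarithm of `Γ` on the right half-plane. -/
def logGammaSeries (z : ℂ) : ℂ := -Complex.log z + ∑' m, logGammaTerm m z

/-- The series of the logarithmic derivative of `Γ`. -/
def digammaSeries (z : ℂ) : ℂ :=
  -z⁻¹ + ∑' m : ℕ, ((Real.log (1 + 1 / ((m : ℝ) + 1)) : ℂ) - (z + ((m : ℂ) + 1))⁻¹)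

/-- The series `∑ (z + n)⁻²`. -/
def trigammaSeries (z : ℂ) : ℂ := ∑' n : ℕ, ((z + n) ^ 2)⁻¹

end

theorem add_natCast_ne_zero_of_re_pos {z : ℂ} (hz : 0 < z.re) (n : ℕ) : z + n ≠ 0 := fun h => by
  have := congrArg Complex.re h
  simp only [Complex.add_re, Complex.natCast_re, Complex.zero_re] at this
  have : (0 : ℝ) ≤ n := n.cast_nonneg
  linarith

theorem norm_log_one_add_sub_inv_le (m : ℕ) :
    ‖(Real.log (1 + 1 / ((m : ℝ) + 1)) : ℂ) - ((m : ℂ) + 1)⁻¹‖ ≤ (((m : ℝ) + 1) ^ 2)⁻¹ := by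
  have hm : (0 : ℝ) < (m : ℝ) + 1 := by positivity
  have h0 : (0 : ℝ) < 1 + 1 / ((m : ℝ) + 1) := by positivity
  have h1 := Real.log_le_sub_one_of_pos h0
  have h2 := Real.one_sub_inv_le_log_of_pos h0
  have : ((Real.log (1 + 1 / ((m : ℝ) + 1)) : ℂ) - ((m : ℂ) + 1)⁻¹) =
      ((Real.log (1 + 1 / ((m : ℝ) + 1)) - ((m : ℝ) + 1)⁻¹ : ℝ) : ℂ) := by push_cast; rfl
  rw [this, Complex.norm_real, Real.norm_eq_abs, abs_le]
  have h3 : 1 - (1 + 1 / ((m : ℝ) + 1))⁻¹ = ((m : ℝ) + 2)⁻¹ := by field_simp; ring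
  have h4 : ((m : ℝ) + 1)⁻¹ - ((m : ℝ) + 2)⁻¹ ≤ (((m : ℝ) + 1) ^ 2)⁻¹ := by
    rw [inv_sub_inv (by positivity) (by positivity), inv_eq_one_div, div_le_div_iff₀ (by positivity) (by positivity)]
    nlinarith
  have h5 : 1 / ((m : ℝ) + 1) = ((m : ℝ) + 1)⁻¹ := one_div _
  have h6 : 0 ≤ (((m : ℝ) + 1) ^ 2)⁻¹ := by positivity
  constructor <;> linarith

theorem summable_inv_natCast_add_one_sq : Summable fun m : ℕ => (((m : ℝ) + 1) ^ 2)⁻¹ := by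
  have := (summable_nat_add_iff 1).2 (Real.summable_nat_pow_inv (p := 2) |>.2 (by norm_num))
  simpa using this

theorem norm_natCast_add_one_le {z : ℂ} (hz : 0 < z.re) (m : ℕ) :
    (m : ℝ) + 1 ≤ ‖z + ((m : ℂ) + 1)‖ := by
  refine le_trans ?_ (Complex.re_le_norm _)
  simp; linarith

theorem hasDerivAt_logGammaTerm {z : ℂ} (hz : 0 < z.re) (m : ℕ) :
    HasDerivAt (logGammaTerm m)
      ((Real.log (1 + 1 / ((m : ℝ) + 1)) : ℂ) - (z + ((m : ℂ) + 1))⁻¹) z := by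
  have hm : ((m : ℂ) + 1) ≠ 0 := Nat.cast_add_one_ne_zero m
  have hs : 1 + z / ((m : ℂ) + 1) ∈ Complex.slitPlane := by
    refine Or.inl ?_
    have : z / ((m : ℂ) + 1) = ((((m : ℝ) + 1)⁻¹ : ℝ) : ℂ) * z := by
      push_cast; rw [div_eq_inv_mul]
    rw [this, Complex.add_re, Complex.re_ofReal_mul, Complex.one_re]
    positivity
  have h1 : HasDerivAt (fun z : ℂ => 1 + z / ((m : ℂ) + 1)) (1 / ((m : ℂ) + 1)) z :=
    ((hasDerivAt_id z).div_const _).const_add _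
  have h2 := ((hasDerivAt_id z).mul_const (Real.log (1 + 1 / ((m : ℝ) + 1)) : ℂ)).sub (h1.clog hs)
  refine h2.congr_deriv ?_
  have hne : z + ((m : ℂ) + 1) ≠ 0 := by
    have := add_natCast_ne_zero_of_re_pos hz (m + 1)
    simpa using this
  have hne' := Complex.slitPlane_ne_zero hs
  have : 1 + z / ((m : ℂ) + 1) = (z + ((m : ℂ) + 1)) / ((m : ℂ) + 1) := by field_simp; ring
  rw [one_mul, this]
  field_simp

/-- Both parts of the term are `1/(m+1)` up to `O((m+1)⁻²)`, locally uniformly in `w`. This is the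
majorant that permits termwise differentiation. -/
theorem norm_logGammaTerm_deriv_le {w : ℂ} {R : ℝ} (hw : 0 < w.re) (hwR : ‖w‖ ≤ R) (m : ℕ) :
    ‖(Real.log (1 + 1 / ((m : ℝ) + 1)) : ℂ) - (w + ((m : ℂ) + 1))⁻¹‖ ≤
      (1 + R) * (((m : ℝ) + 1) ^ 2)⁻¹ := by
  have hm : ((m : ℂ) + 1) ≠ 0 := Nat.cast_add_one_ne_zero m
  have hm' : (0 : ℝ) < (m : ℝ) + 1 := by positivity
  have hne : w + ((m : ℂ) + 1) ≠ 0 := by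
    simpa using add_natCast_ne_zero_of_re_pos hw (m + 1)
  have e : (Real.log (1 + 1 / ((m : ℝ) + 1)) : ℂ) - (w + ((m : ℂ) + 1))⁻¹ =
      ((Real.log (1 + 1 / ((m : ℝ) + 1)) : ℂ) - ((m : ℂ) + 1)⁻¹) +
        w / (((m : ℂ) + 1) * (w + ((m : ℂ) + 1))) := by
    have : ((m : ℂ) + 1)⁻¹ - (w + ((m : ℂ) + 1))⁻¹ = w / (((m : ℂ) + 1) * (w + ((m : ℂ) + 1))) := by
      rw [inv_sub_inv hm hne]; ring
    rw [← this]; ring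
  have hmn : ‖(m : ℂ) + 1‖ = (m : ℝ) + 1 := by
    rw [show (m : ℂ) + 1 = (((m : ℝ) + 1 : ℝ) : ℂ) by push_cast; rfl, Complex.norm_real,
      Real.norm_of_nonneg hm'.le]
  have hb : ‖w / (((m : ℂ) + 1) * (w + ((m : ℂ) + 1)))‖ ≤ R * (((m : ℝ) + 1) ^ 2)⁻¹ := by
    rw [norm_div, norm_mul, hmn, ← div_eq_mul_inv, pow_two]
    have := norm_natCast_add_one_le hw m
    have : 0 ≤ R := (norm_nonneg _).trans hwR
    gcongr
  rw [e]
  exact ((norm_add_le _ _).trans (add_le_add (norm_log_one_add_sub_inv_le m) hb)).trans_eq (by ring)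

theorem logGammaTerm_one (m : ℕ) : logGammaTerm m 1 = 0 := by
  simp only [logGammaTerm, one_mul]
  rw [Complex.ofReal_log (by positivity)]
  push_cast
  exact sub_self _

theorem summable_logGammaTerm_one : Summable fun m => logGammaTerm m 1 := by
  simp [logGammaTerm_one]

theorem hasDerivAt_logGammaSeries {z : ℂ} (hz : 0 < z.re) :
    HasDerivAt logGammaSeries (digammaSeries z) z := by
  have h1 : HasDerivAt (fun z => -Complex.log z) (-z⁻¹) z :=
    (Complex.hasDerivAt_log (Or.inl hz)).neg
  -- The ball has to contain `z` and also the base point `1`, where every term vanishes and the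
  -- series trivially converges.
  set R := ‖z‖ + 2
  set t : Set ℂ := {w | 0 < w.re} ∩ Metric.ball 0 R
  have ht : IsOpen t := (isOpen_lt continuous_const Complex.continuous_re).inter Metric.isOpen_ball
  have hconv : Convex ℝ t := (convex_halfSpace_re_gt 0).inter (convex_ball _ _)
  have hu : Summable fun m : ℕ => (1 + R) * (((m : ℝ) + 1) ^ 2)⁻¹ :=
    summable_inv_natCast_add_one_sq.mul_left _
  have := hasDerivAt_tsum_of_isPreconnected (𝕜 := ℂ) (g := logGammaTerm) (y₀ := 1) (y := z) hu ht
    hconv.isPreconnected (fun m w hw => hasDerivAt_logGammaTerm hw.1 m) ?_ ?_ ?_ ?_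
  · exact h1.add this
  · exact fun m w hw => norm_logGammaTerm_deriv_le hw.1 (by simpa using (Metric.mem_ball.1 hw.2).le) m
  · exact ⟨by simp, by simp [R]; linarith [norm_nonneg z]⟩
  · exact summable_logGammaTerm_one
  · exact ⟨hz, by simp [R]⟩

theorem hasDerivAt_digammaSeries {z : ℂ} (hz : 0 < z.re) :
    HasDerivAt digammaSeries (trigammaSeries z) z := by
  have hz0 : z ≠ 0 := by simpa using add_natCast_ne_zero_of_re_pos hz 0
  have h1 : HasDerivAt (fun z : ℂ => -z⁻¹) ((z ^ 2)⁻¹) z := by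
    simpa using! (hasDerivAt_inv hz0).neg
  set t : Set ℂ := {w | 0 < w.re}
  have ht : IsOpen t := isOpen_lt continuous_const Complex.continuous_re
  have hconv : Convex ℝ t := convex_halfSpace_re_gt 0
  have hbd : ∀ (m : ℕ) (w : ℂ), w ∈ t →
      ‖((w + ((m : ℂ) + 1)) ^ 2)⁻¹‖ ≤ (((m : ℝ) + 1) ^ 2)⁻¹ := fun m w hw => by
    rw [norm_inv, norm_pow]
    have := norm_natCast_add_one_le hw m
    gcongr
  have hz' := hasDerivAt_tsum_of_isPreconnected (𝕜 := ℂ)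
    (g := fun (m : ℕ) (z : ℂ) => (Real.log (1 + 1 / ((m : ℝ) + 1)) : ℂ) - (z + ((m : ℂ) + 1))⁻¹)
    (g' := fun m z => ((z + ((m : ℂ) + 1)) ^ 2)⁻¹)
    (y₀ := 1) (y := z) summable_inv_natCast_add_one_sq ht hconv.isPreconnected ?_ hbd ?_ ?_ hz
  · refine (h1.add hz').congr_deriv ?_
    have hs : Summable fun n : ℕ => ((z + n) ^ 2)⁻¹ := by
      rw [← summable_nat_add_iff 1]
      refine Summable.of_norm_bounded summable_inv_natCast_add_one_sq fun m => ?_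
      simpa using hbd m z hz
    rw [trigammaSeries, hs.tsum_eq_zero_add]
    simp
  · intro m w hw
    have hne : w + ((m : ℂ) + 1) ≠ 0 := by
      simpa using add_natCast_ne_zero_of_re_pos hw (m + 1)
    have := (((hasDerivAt_id w).add_const ((m : ℂ) + 1)).inv hne).const_sub
      (Real.log (1 + 1 / ((m : ℝ) + 1)) : ℂ)
    refine this.congr_deriv ?_
    simp only [id]
    field_simp
  · simp [t]
  · exact Summable.of_norm_bounded (summable_inv_natCast_add_one_sq.mul_left (1 + 1)) fun m =>
      norm_logGammaTerm_deriv_le (by simp) (by simp) m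

theorem summable_logGammaTerm {z : ℂ} (hz : 0 < z.re) : Summable fun m => logGammaTerm m z := by
  set R := ‖z‖ + 2
  set t : Set ℂ := {w | 0 < w.re} ∩ Metric.ball 0 R
  have ht : IsOpen t := (isOpen_lt continuous_const Complex.continuous_re).inter Metric.isOpen_ball
  have hconv : Convex ℝ t := (convex_halfSpace_re_gt 0).inter (convex_ball _ _)
  exact summable_of_summable_hasDerivAt_of_isPreconnected (𝕜 := ℂ)
    (summable_inv_natCast_add_one_sq.mul_left (1 + R)) ht hconv.isPreconnected
    (fun m w hw => hasDerivAt_logGammaTerm hw.1 m)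
    (fun m w hw => norm_logGammaTerm_deriv_le hw.1 (by simpa using (Metric.mem_ball.1 hw.2).le) m)
    (y₀ := 1) ⟨by simp, by simp [R]; linarith [norm_nonneg z]⟩ summable_logGammaTerm_one
    ⟨hz, by simp [R]⟩

/-- Exponentiated partial sums are Gauss's products `(M+1)^z M! / ∏ (z+j)`. They differ from
`Complex.GammaSeq` only by `(M+1)^z / M^z`, which tends to 1. -/
theorem exp_logGammaSeries {z : ℂ} (hz : 0 < z.re) :
    Complex.exp (logGammaSeries z) = Complex.Gamma z := by
  have hz0 : z ≠ 0 := by simpa using add_natCast_ne_zero_of_re_pos hz 0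
  have hpart : ∀ M : ℕ, Complex.exp (-Complex.log z + ∑ m ∈ Finset.range M, logGammaTerm m z) =
      Complex.exp (z * Real.log ((M : ℝ) + 1)) * M.factorial /
        ∏ j ∈ Finset.range (M + 1), (z + j) := by
    intro M
    induction M with
    | zero => simp [Complex.exp_neg, Complex.exp_log hz0]
    | succ M ih =>
      rw [Finset.sum_range_succ, ← add_assoc, Complex.exp_add, ih, Finset.prod_range_succ _ (M + 1),
        logGammaTerm, Complex.exp_sub]
      have hm : ((M : ℂ) + 1) ≠ 0 := Nat.cast_add_one_ne_zero M
      have hne : z + ((M : ℂ) + 1) ≠ 0 := by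
        simpa using add_natCast_ne_zero_of_re_pos hz (M + 1)
      have e : 1 + z / ((M : ℂ) + 1) = (z + ((M : ℂ) + 1)) / ((M : ℂ) + 1) := by field_simp; ring
      have hP : ∏ j ∈ Finset.range (M + 1), (z + (j : ℂ)) ≠ 0 :=
        Finset.prod_ne_zero_iff.2 fun j _ => add_natCast_ne_zero_of_re_pos hz j
      rw [e, Complex.exp_log (div_ne_zero hne hm), Nat.factorial_succ]
      have h2 : Real.log (((M + 1 : ℕ) : ℝ) + 1) =
          Real.log ((M : ℝ) + 1) + Real.log (1 + 1 / ((M : ℝ) + 1)) := by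
        rw [← Real.log_mul (by positivity) (by positivity)]
        congr 1; push_cast; field_simp
      rw [h2]
      push_cast
      rw [mul_add, Complex.exp_add]
      field_simp
  have h1 : Tendsto (fun M : ℕ => Complex.exp (-Complex.log z +
      ∑ m ∈ Finset.range M, logGammaTerm m z)) atTop (nhds (Complex.exp (logGammaSeries z))) :=
    (Complex.continuous_exp.tendsto _).comp
      ((summable_logGammaTerm hz).hasSum.tendsto_sum_nat.const_add _)
  have h2 : Tendsto (fun M : ℕ => Complex.GammaSeq z M *
      Complex.exp (z * ((Real.log ((M : ℝ) + 1) - Real.log M : ℝ) : ℂ))) atTop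
      (nhds (Complex.Gamma z)) := by
    have h3 : Tendsto (fun M : ℕ => Complex.exp (z * ((Real.log ((M : ℝ) + 1) - Real.log M : ℝ) : ℂ)))
        atTop (nhds 1) := by
      have := (Complex.continuous_exp.tendsto _).comp ((((Complex.continuous_ofReal.tendsto _).comp
        (Real.tendsto_log_nat_add_one_sub_log)).const_mul z))
      simpa using! this
    simpa using (Complex.GammaSeq_tendsto_Gamma z).mul h3
  refine tendsto_nhds_unique h1 (h2.congr' ?_)
  filter_upwards [eventually_ne_atTop 0] with M hM
  rw [hpart, Complex.GammaSeq, Complex.cpow_def_of_ne_zero (by exact_mod_cast hM),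
    ← Complex.natCast_log]
  push_cast
  rw [mul_sub, Complex.exp_sub, mul_comm (Complex.log (M : ℂ)) z]
  have := Complex.exp_ne_zero (z * Complex.log (M : ℂ))
  field_simp

theorem tendsto_sum_inv_sub_inv_succ {z : ℂ} (hz : 0 < z.re) :
    Tendsto (fun N => ∑ n ∈ Finset.range N, ((z + n)⁻¹ - (z + (n + 1 : ℕ))⁻¹)) atTop (nhds z⁻¹) := by
  have h : Tendsto (fun N : ℕ => (z + (N : ℂ))⁻¹) atTop (nhds 0) := by
    refine squeeze_zero_norm' ?_ (tendsto_natCast_atTop_atTop (R := ℝ)).inv_tendsto_atTop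
    filter_upwards [eventually_gt_atTop 0] with N hN
    have hN' : (0 : ℝ) < N := by exact_mod_cast hN
    rw [norm_inv]
    refine inv_anti₀ hN' (le_trans ?_ (Complex.re_le_norm _))
    simp only [Complex.add_re, Complex.natCast_re]
    linarith
  have h2 := h.const_sub (z + ((0 : ℕ) : ℂ))⁻¹
  simp only [Nat.cast_zero, add_zero, sub_zero] at h2
  refine h2.congr fun N => ?_
  rw [Finset.sum_range_sub' (fun n : ℕ => (z + (n : ℂ))⁻¹)]
  simp

/-- `∑ (z + n)⁻² = 1 / z + O(|z|^(-3/2))` on `Re z ≥ a > 0`. -/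
theorem exists_norm_trigammaSeries_sub_inv_le {a : ℝ} (ha : 0 < a) :
    ∃ C, 0 ≤ C ∧ ∀ z : ℂ, a ≤ z.re → ‖trigammaSeries z - z⁻¹‖ ≤ C * ‖z‖ ^ (-(3 / 2) : ℝ) := by
  set b := min a 1 with hb
  have hb0 : 0 < b := lt_min ha one_pos
  have hsum : Summable fun n : ℕ => (b * ((n : ℝ) + 1)) ^ (-(3 / 2) : ℝ) := by
    have h1 : Summable fun n : ℕ => ((n : ℝ) + 1) ^ (-(3 / 2) : ℝ) := by
      have := (summable_nat_add_iff 1).2 ((Real.summable_nat_rpow (p := -(3 / 2))).2 (by norm_num))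
      simpa using this
    refine (h1.mul_left (b ^ (-(3 / 2) : ℝ))).congr fun n => ?_
    rw [Real.mul_rpow hb0.le (by positivity)]
  refine ⟨∑' n : ℕ, (b * ((n : ℝ) + 1)) ^ (-(3 / 2) : ℝ), tsum_nonneg fun n => by positivity, ?_⟩
  intro z hz
  have hz0 : 0 < z.re := ha.trans_le hz
  have hzn : ∀ n : ℕ, z + n ≠ 0 := add_natCast_ne_zero_of_re_pos hz0
  have hzpos : 0 < ‖z‖ := norm_pos_iff.2 (by simpa using hzn 0)
  have hmono : ∀ n : ℕ, ‖z‖ ≤ ‖z + n‖ := fun n => by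
    rw [Complex.norm_def, Complex.norm_def]
    refine Real.sqrt_le_sqrt ?_
    simp only [Complex.normSq_apply, Complex.add_re, Complex.natCast_re, Complex.add_im,
      Complex.natCast_im, add_zero]
    have : (0 : ℝ) ≤ n := n.cast_nonneg
    nlinarith
  have hlow : ∀ n : ℕ, b * ((n : ℝ) + 1) ≤ ‖z + n‖ := fun n => by
    refine le_trans ?_ (Complex.re_le_norm _)
    simp only [Complex.add_re, Complex.natCast_re]
    have h1 : b ≤ a := min_le_left _ _
    have h2 : b ≤ 1 := min_le_right _ _
    have : (0 : ℝ) ≤ n := n.cast_nonneg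
    nlinarith
  have hsucc : ∀ n : ℕ, ‖z + n‖ ≤ ‖z + (n + 1 : ℕ)‖ := fun n => by
    rw [Complex.norm_def, Complex.norm_def]
    refine Real.sqrt_le_sqrt ?_
    simp only [Complex.normSq_apply, Complex.add_re, Complex.natCast_re, Complex.add_im,
      Complex.natCast_im, add_zero]
    push_cast
    have : (0 : ℝ) ≤ n := n.cast_nonneg
    nlinarith
  -- Comparison with the telescoping series for `1/z`: the difference of the terms is `1 / ((z+n)²
  -- (z+n+1))`, of size `|z+n|⁻³`. Half of this exponent is spent on the decay in `z`, the other
  -- half on summability in `n`.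
  set T : ℕ → ℂ := fun n => ((z + n) ^ 2)⁻¹ - ((z + n)⁻¹ - (z + (n + 1 : ℕ))⁻¹) with hT
  have hTn : ∀ n, ‖T n‖ ≤ (b * ((n : ℝ) + 1)) ^ (-(3 / 2) : ℝ) * ‖z‖ ^ (-(3 / 2) : ℝ) := fun n => by
    have e : T n = ((z + n) ^ 2 * (z + (n + 1 : ℕ)))⁻¹ := by
      have h1 := hzn n
      have h2 := hzn (n + 1)
      simp only [hT]
      have : z + ((n + 1 : ℕ) : ℂ) = z + n + 1 := by push_cast; ring
      rw [this] at h2 ⊢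
      field_simp
      ring
    have hp : 0 < ‖z + n‖ := norm_pos_iff.2 (hzn n)
    rw [e, norm_inv, norm_mul, norm_pow]
    calc (‖z + n‖ ^ 2 * ‖z + (n + 1 : ℕ)‖)⁻¹ ≤ (‖z + n‖ ^ 2 * ‖z + n‖)⁻¹ := by
          have := hsucc n
          gcongr
      _ = ‖z + n‖ ^ (-(3 / 2) : ℝ) * ‖z + n‖ ^ (-(3 / 2) : ℝ) := by
          rw [← Real.rpow_add hp, show (-(3 / 2) + -(3 / 2) : ℝ) = -((3 : ℕ) : ℝ) by norm_num,
            Real.rpow_neg hp.le, Real.rpow_natCast]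
          ring
      _ ≤ _ := by
          have h1 := Real.rpow_le_rpow_of_nonpos (by positivity) (hlow n) (z := -(3 / 2)) (by norm_num)
          have h2 := Real.rpow_le_rpow_of_nonpos hzpos (hmono n) (z := -(3 / 2)) (by norm_num)
          gcongr
  have hTs : Summable T := Summable.of_norm_bounded (hsum.mul_right _) hTn
  have hS : Summable fun n : ℕ => ((z + n) ^ 2)⁻¹ := by
    rw [← summable_nat_add_iff 1]
    refine Summable.of_norm_bounded summable_inv_natCast_add_one_sq fun m => ?_
    rw [norm_inv, norm_pow]
    have := norm_natCast_add_one_le hz0 m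
    push_cast
    gcongr
  have heq : trigammaSeries z - z⁻¹ = ∑' n, T n := by
    refine tendsto_nhds_unique ?_ hTs.hasSum.tendsto_sum_nat
    refine (hS.hasSum.tendsto_sum_nat.sub (tendsto_sum_inv_sub_inv_succ hz0)).congr fun N => ?_
    rw [← Finset.sum_sub_distrib]
  rw [heq]
  refine (tsum_of_norm_bounded (hsum.mul_right _).hasSum hTn).trans_eq ?_
  rw [tsum_mul_right]

theorem exists_norm_trigammaSeries_le {a : ℝ} (ha : 0 < a) :
    ∃ C, 0 ≤ C ∧ ∀ z : ℂ, a ≤ z.re → ‖trigammaSeries z‖ ≤ C := by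
  obtain ⟨C, hC, h⟩ := exists_norm_trigammaSeries_sub_inv_le ha
  refine ⟨C * a ^ (-(3 / 2) : ℝ) + a⁻¹, by positivity, fun z hz => ?_⟩
  have hn : a ≤ ‖z‖ := hz.trans (Complex.re_le_norm z)
  have h1 := Real.rpow_le_rpow_of_nonpos ha hn (z := -(3 / 2)) (by norm_num)
  calc ‖trigammaSeries z‖ = ‖(trigammaSeries z - z⁻¹) + z⁻¹‖ := by rw [sub_add_cancel]
    _ ≤ C * ‖z‖ ^ (-(3 / 2) : ℝ) + ‖z⁻¹‖ := (norm_add_le _ _).trans (add_le_add_left (h z hz) _)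
    _ ≤ _ := by rw [norm_inv]; gcongr

/-- For large `y` and `x` in a compact subset of `(0, ∞)`, `-Im (∑ (z + n)⁻²)` is close to `1 / y`. -/
theorem exists_trigammaSeries_im_bounds {a b η : ℝ} (ha : 0 < a) (hη : 0 < η) :
    ∃ Y, 1 ≤ Y ∧ ∀ x y : ℝ, a ≤ x → x ≤ b → Y ≤ y →
      1 / (2 * y) ≤ -(trigammaSeries (x + y * Complex.I)).im ∧
        -(trigammaSeries (x + y * Complex.I)).im ≤ (1 + η) / y := by
  obtain ⟨C, hC, h⟩ := exists_norm_trigammaSeries_sub_inv_le ha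
  -- The main term `y / (x² + y²)` lies between `3/(4y)` and `1/y` as soon as `y ≥ 2b`, so an error
  -- of `ε/y` with `ε ≤ 1/4` leaves `1/(2y)` below, and `ε ≤ η` leaves `(1+η)/y` above.
  set ε := min η (1 / 4) with hε
  have hε0 : 0 < ε := lt_min hη (by norm_num)
  have hsmall : ∀ᶠ y : ℝ in atTop, C * y ^ (-(1 / 2) : ℝ) < ε := by
    have := (tendsto_rpow_neg_atTop (y := 1 / 2) (by norm_num)).const_mul C
    rw [mul_zero] at this
    exact this.eventually (gt_mem_nhds hε0)
  obtain ⟨Y0, hY0⟩ := eventually_atTop.1 hsmall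
  refine ⟨max 1 (max Y0 (2 * b)), le_max_left _ _, fun x y hax hxb hy => ?_⟩
  have hy1 : 1 ≤ y := (le_max_left _ _).trans hy
  have hyY : Y0 ≤ y := (le_max_left _ _).trans ((le_max_right _ _).trans hy)
  have hyb : 2 * b ≤ y := (le_max_right _ _).trans ((le_max_right _ _).trans hy)
  have hy0 : 0 < y := by linarith
  set z : ℂ := x + y * Complex.I with hz
  have hzre : z.re = x := by simp [hz]
  have hzim : z.im = y := by simp [hz]
  have h1 := h z (by rw [hzre]; exact hax)
  have hn : y ≤ ‖z‖ := by simpa [hzim, abs_of_pos hy0] using Complex.abs_im_le_norm z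
  have h2 : |(trigammaSeries z - z⁻¹).im| ≤ ε / y := by
    refine (Complex.abs_im_le_norm _).trans (h1.trans ?_)
    have h3 := Real.rpow_le_rpow_of_nonpos hy0 hn (z := -(3 / 2)) (by norm_num)
    calc C * ‖z‖ ^ (-(3 / 2) : ℝ) ≤ C * y ^ (-(3 / 2) : ℝ) := by gcongr
      _ = C * y ^ (-(1 / 2) : ℝ) / y := by
        rw [show (-(3 / 2) : ℝ) = -(1 / 2) - 1 by norm_num, Real.rpow_sub_one hy0.ne']; ring
      _ ≤ ε / y := by gcongr; exact (hY0 y hyY).le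
  have hinv : (z⁻¹).im = -(y / (x ^ 2 + y ^ 2)) := by
    rw [Complex.inv_im, Complex.normSq_apply, hzre, hzim]; ring
  rw [Complex.sub_im, hinv, abs_le] at h2
  have hup : y / (x ^ 2 + y ^ 2) ≤ 1 / y := by
    rw [div_le_div_iff₀ (by positivity) hy0]; nlinarith [sq_nonneg x]
  have hlo : 3 / 4 / y ≤ y / (x ^ 2 + y ^ 2) := by
    rw [div_le_div_iff₀ hy0 (by positivity)]
    nlinarith
  have hε1 : ε / y ≤ 1 / 4 / y := by gcongr; exact min_le_right _ _
  have hε2 : ε / y ≤ η / y := by gcongr; exact min_le_left _ _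
  have e1 : 1 / (2 * y) = 3 / 4 / y - 1 / 4 / y := by field_simp; norm_num
  have e2 : (1 + η) / y = 1 / y + η / y := add_div _ _ _
  constructor
  · rw [e1]; linarith [h2.2]
  · rw [e2]; linarith [h2.1]

/-- Two applications of the mean value inequality to the bounded trigamma series. The bound is
crude, but suffices for the a priori growth conditions in Phragmén–Lindelöf and for finite order. -/
theorem exists_norm_logGammaSeries_le {a : ℝ} (ha : 0 < a) :
    ∃ C, 0 ≤ C ∧ ∀ z : ℂ, a ≤ z.re → ‖logGammaSeries z‖ ≤ C * (1 + ‖z‖) ^ 2 := by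
  obtain ⟨C, hC, h⟩ := exists_norm_trigammaSeries_le ha
  have hconv : Convex ℝ {z : ℂ | a ≤ z.re} := convex_halfSpace_re_ge a
  have haa : (a : ℂ) ∈ {z : ℂ | a ≤ z.re} := by simp
  have hdist : ∀ z : ℂ, ‖z - a‖ ≤ (1 + a) * (1 + ‖z‖) := fun z => by
    refine (norm_sub_le _ _).trans ?_
    rw [Complex.norm_real, Real.norm_of_nonneg ha.le]
    nlinarith [norm_nonneg z]
  set C1 := ‖digammaSeries a‖ + C * (1 + a) with hC1
  have hC1n : 0 ≤ C1 := by positivity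
  have hψ : ∀ z : ℂ, a ≤ z.re → ‖digammaSeries z‖ ≤ C1 * (1 + ‖z‖) := fun z hz => by
    have := hconv.norm_image_sub_le_of_norm_hasDerivWithin_le (C := C) (f := digammaSeries) (f' := trigammaSeries)
      (fun w (hw : a ≤ w.re) => (hasDerivAt_digammaSeries (ha.trans_le hw)).hasDerivWithinAt)
      (fun w hw => h w hw) haa hz
    calc ‖digammaSeries z‖ = ‖(digammaSeries z - digammaSeries a) + digammaSeries a‖ := by
          rw [sub_add_cancel]
      _ ≤ C * ((1 + a) * (1 + ‖z‖)) + ‖digammaSeries a‖ := by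
          refine (norm_add_le _ _).trans (add_le_add_left (this.trans ?_) _)
          gcongr; exact hdist z
      _ ≤ _ := by rw [hC1]; nlinarith [norm_nonneg z, norm_nonneg (digammaSeries a)]
  refine ⟨‖logGammaSeries a‖ + C1 * (1 + a) * (1 + a), by positivity, fun z hz => ?_⟩
  have hconv2 : Convex ℝ ({z : ℂ | a ≤ z.re} ∩ Metric.closedBall 0 (‖z‖ + a)) :=
    hconv.inter (convex_closedBall _ _)
  have := hconv2.norm_image_sub_le_of_norm_hasDerivWithin_le (C := C1 * (1 + (‖z‖ + a)))
    (fun w hw => (hasDerivAt_logGammaSeries (ha.trans_le hw.1)).hasDerivWithinAt)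
    (fun w hw => (hψ w hw.1).trans (by
      have := mem_closedBall_zero_iff.1 hw.2
      gcongr))
    (x := (a : ℂ)) (y := z) ⟨haa, by simp [abs_of_pos ha]⟩ ⟨hz, by simp [ha.le]⟩
  calc ‖logGammaSeries z‖ = ‖(logGammaSeries z - logGammaSeries a) + logGammaSeries a‖ := by
        rw [sub_add_cancel]
    _ ≤ C1 * (1 + (‖z‖ + a)) * ((1 + a) * (1 + ‖z‖)) + ‖logGammaSeries a‖ := by
        refine (norm_add_le _ _).trans (add_le_add_left (this.trans ?_) _)
        gcongr; exact hdist z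
    _ ≤ C1 * ((1 + a) * (1 + ‖z‖)) * ((1 + a) * (1 + ‖z‖)) + ‖logGammaSeries a‖ * (1 + ‖z‖) ^ 2 := by
        have h1 : 1 + (‖z‖ + a) ≤ (1 + a) * (1 + ‖z‖) := by nlinarith [norm_nonneg z]
        have h2 : (1 : ℝ) ≤ (1 + ‖z‖) ^ 2 := one_le_pow₀ (by linarith [norm_nonneg z])
        have h3 := le_mul_of_one_le_right (norm_nonneg (logGammaSeries a)) h2
        gcongr
    _ = _ := by ring

theorem digammaSeries_star (z : ℂ) : digammaSeries (star z) = star (digammaSeries z) := by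
  simp only [digammaSeries, Complex.star_def, map_add, map_neg, map_inv₀, Complex.conj_tsum, map_sub,
    Complex.conj_ofReal, map_natCast, map_one]

theorem trigammaSeries_star (z : ℂ) : trigammaSeries (star z) = star (trigammaSeries z) := by
  simp only [trigammaSeries, Complex.star_def, map_add, map_inv₀, Complex.conj_tsum, map_pow,
    map_natCast]

/-- Integration of the trigamma bounds over the horizontal segment from `x₂ + iy` to `x₁ + iy`. -/
theorem exists_digammaSeries_im_sub_bounds {x₁ x₂ η : ℝ} (hx₂ : 0 < x₂) (hx : x₂ ≤ x₁) (hη : 0 < η) :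
    ∃ Y, 1 ≤ Y ∧ ∀ y : ℝ, Y ≤ y →
      0 ≤ (digammaSeries (x₂ + y * Complex.I)).im - (digammaSeries (x₁ + y * Complex.I)).im ∧
      (digammaSeries (x₂ + y * Complex.I)).im - (digammaSeries (x₁ + y * Complex.I)).im ≤
        (x₁ - x₂) * (1 + η) / y := by
  obtain ⟨Y, hY1, hY⟩ := exists_trigammaSeries_im_bounds (b := x₁) hx₂ hη
  refine ⟨Y, hY1, fun y hy => ?_⟩
  have hy0 : 0 < y := by linarith
  have hder : ∀ x ∈ Set.Icc x₂ x₁, HasDerivAt (fun x : ℝ => -(digammaSeries (x + y * Complex.I)).im)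
      (-(trigammaSeries (x + y * Complex.I)).im) x := fun x hx' => by
    have h1 : HasDerivAt (fun x : ℝ => (x : ℂ) + y * Complex.I) 1 x :=
      (Complex.ofRealCLM.hasDerivAt (x := x)).add_const _ |>.congr_deriv (by simp)
    have h2 := (hasDerivAt_digammaSeries (z := x + y * Complex.I)
      (by simpa using hx₂.trans_le hx'.1)).comp x h1
    have h3 := Complex.imCLM.hasFDerivAt.comp_hasDerivAt x h2
    simpa using! h3.neg
  have hc : ContinuousOn (fun x : ℝ => -(digammaSeries (x + y * Complex.I)).im) (Set.Icc x₂ x₁) :=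
    fun x hx' => (hder x hx').continuousAt.continuousWithinAt
  have hd : DifferentiableOn ℝ (fun x : ℝ => -(digammaSeries (x + y * Complex.I)).im)
      (interior (Set.Icc x₂ x₁)) :=
    fun x hx' => (hder x (interior_subset hx')).differentiableAt.differentiableWithinAt
  have up := (convex_Icc x₂ x₁).image_sub_le_mul_sub_of_deriv_le hc hd (C := (1 + η) / y)
    (fun x hx' => by
      rw [(hder x (interior_subset hx')).deriv]
      have := interior_subset hx'
      exact (hY x y this.1 this.2 hy).2) x₂ ⟨le_rfl, hx⟩ x₁ ⟨hx, le_rfl⟩ hx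
  have lo := (convex_Icc x₂ x₁).mul_sub_le_image_sub_of_le_deriv hc hd (C := 0)
    (fun x hx' => by
      rw [(hder x (interior_subset hx')).deriv]
      have := interior_subset hx'
      exact le_trans (by positivity) (hY x y this.1 this.2 hy).1) x₂ ⟨le_rfl, hx⟩ x₁ ⟨hx, le_rfl⟩ hx
  constructor
  · linarith
  · calc _ ≤ (1 + η) / y * (x₁ - x₂) := by linarith
      _ = _ := by ring

theorem norm_Gamma_add_neg_mul_I (x y : ℝ) :
    ‖Complex.Gamma (x + (-y : ℝ) * Complex.I)‖ = ‖Complex.Gamma (x + y * Complex.I)‖ := by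
  rw [← Complex.norm_conj, ← Complex.Gamma_conj]
  simp

/-- This replaces Stirling's formula. Since `d/dy log |Γ(x + iy)| = -Im ψ(x + iy)`, the logarithm of
the ratio has derivative at most `θ/y` for large `y`, hence grows at most like `θ log y`. Negative
`y` follow by conjugation. -/
theorem exists_norm_Gamma_le_rpow_mul {x₁ x₂ η : ℝ} (hx₂ : 0 < x₂) (hx : x₂ ≤ x₁) (hη : 0 < η) :
    ∃ C, 0 < C ∧ ∀ y : ℝ, ‖Complex.Gamma (x₁ + y * Complex.I)‖ ≤
      C * (1 + |y|) ^ ((x₁ - x₂) * (1 + η)) * ‖Complex.Gamma (x₂ + y * Complex.I)‖ := by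
  obtain ⟨Y, hY1, hY⟩ := exists_digammaSeries_im_sub_bounds hx₂ hx hη
  have hx₁ : 0 < x₁ := hx₂.trans_le hx
  have hΓ : ∀ {x : ℝ}, 0 < x → ∀ y : ℝ, ‖Complex.Gamma (x + y * Complex.I)‖ =
      Real.exp (logGammaSeries (x + y * Complex.I)).re := fun {x} hx y => by
    rw [← exp_logGammaSeries (by simpa using hx), Complex.norm_exp]
  have hder : ∀ {x : ℝ}, 0 < x → ∀ y : ℝ,
      HasDerivAt (fun y : ℝ => (logGammaSeries (x + y * Complex.I)).re)
      (-(digammaSeries (x + y * Complex.I)).im) y := fun {x} hx y => by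
    have h1 : HasDerivAt (fun y : ℝ => (x : ℂ) + y * Complex.I) Complex.I y :=
      ((Complex.ofRealCLM.hasDerivAt (x := y)).mul_const Complex.I).const_add _ |>.congr_deriv (by simp)
    have h2 := (hasDerivAt_logGammaSeries (z := x + y * Complex.I) (by simpa using hx)).comp y h1
    have h3 := Complex.reCLM.hasFDerivAt.comp_hasDerivAt y h2
    simpa using! h3
  set θ := (x₁ - x₂) * (1 + η) with hθ
  have hθ0 : 0 ≤ θ := mul_nonneg (sub_nonneg.2 hx) (by linarith)
  set φ : ℝ → ℝ := fun y => (logGammaSeries (x₁ + y * Complex.I)).re -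
    (logGammaSeries (x₂ + y * Complex.I)).re with hφ
  have hφd : ∀ y : ℝ, HasDerivAt φ (-(digammaSeries (x₁ + y * Complex.I)).im -
    -(digammaSeries (x₂ + y * Complex.I)).im) y := fun y => (hder hx₁ y).sub (hder hx₂ y)
  have hφc : Continuous φ := continuous_iff_continuousAt.2 fun y => (hφd y).continuousAt
  obtain ⟨M, hM⟩ := (isCompact_Icc (a := (0 : ℝ)) (b := Y)).bddAbove_image hφc.continuousOn
  have hlarge : ∀ y : ℝ, Y ≤ y → φ y ≤ φ Y + θ * Real.log y := fun y hy => by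
    have hd : ∀ t ∈ Set.Icc Y y, HasDerivAt (fun t => φ t - θ * Real.log t)
        ((-(digammaSeries (x₁ + t * Complex.I)).im -
          -(digammaSeries (x₂ + t * Complex.I)).im) - θ * t⁻¹) t := fun t ht =>
      (hφd t).sub ((Real.hasDerivAt_log (by linarith [ht.1] : (0:ℝ) < t).ne').const_mul θ)
    have hant := antitoneOn_of_deriv_nonpos (convex_Icc Y y)
      (fun t ht => (hd t ht).continuousAt.continuousWithinAt)
      (fun t ht => (hd t (interior_subset ht)).differentiableAt.differentiableWithinAt)
      (fun t ht => by
        rw [(hd t (interior_subset ht)).deriv]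
        have := (hY t (interior_subset ht).1).2
        rw [← div_eq_mul_inv]
        linarith) (Set.left_mem_Icc.2 hy) (Set.right_mem_Icc.2 hy) hy
    simp only at hant
    have : 0 ≤ θ * Real.log Y := mul_nonneg hθ0 (Real.log_nonneg hY1)
    linarith
  have hall : ∀ y : ℝ, 0 ≤ y → φ y ≤ M + θ * Real.log (1 + y) := fun y hy => by
    rcases le_total y Y with h | h
    · have := hM ⟨y, ⟨hy, h⟩, rfl⟩
      have : 0 ≤ θ * Real.log (1 + y) := mul_nonneg hθ0 (Real.log_nonneg (by linarith))
      linarith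
    · have h1 := hM ⟨Y, ⟨by linarith, le_rfl⟩, rfl⟩
      have h2 := Real.log_le_log (by linarith) (by linarith : y ≤ 1 + y)
      have := mul_le_mul_of_nonneg_left h2 hθ0
      linarith [hlarge y h]
  have hpos : ∀ y : ℝ, 0 ≤ y → ‖Complex.Gamma (x₁ + y * Complex.I)‖ ≤
      Real.exp M * (1 + y) ^ θ * ‖Complex.Gamma (x₂ + y * Complex.I)‖ := fun y hy => by
    rw [hΓ hx₁, hΓ hx₂, Real.rpow_def_of_pos (by linarith), ← Real.exp_add, ← Real.exp_add]
    have := hall y hy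
    simp only [hφ] at this
    exact Real.exp_le_exp.2 (by linarith)
  refine ⟨Real.exp M, Real.exp_pos _, fun y => ?_⟩
  rcases le_total 0 y with h | h
  · rw [abs_of_nonneg h]; exact hpos y h
  · have := hpos (-y) (by linarith)
    rwa [norm_Gamma_add_neg_mul_I, norm_Gamma_add_neg_mul_I, ← abs_of_nonpos h] at this

/-! ### The gamma quotient of a functional equation -/

noncomputable section

/-- A logarithm of `Q^(2s-1) ∏ Γ(λ_j s + μ_j) / Γ(λ_j (1-s) + conj μ_j)` in the critical strip. -/
def logGammaQuotient {r : ℕ} (Q : ℝ) (lam : Fin r → ℝ) (mu : Fin r → ℂ) (s : ℂ) : ℂ :=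
  (2 * s - 1) * Real.log Q + ∑ j, (logGammaSeries (lam j * s + mu j) -
    logGammaSeries (lam j * (1 - s) + star (mu j)))

end

section

variable {r : ℕ} {Q : ℝ} {lam : Fin r → ℝ} {mu : Fin r → ℂ}

theorem re_gammaArg_pos (hlam : ∀ j, 0 < lam j) (hmu : ∀ j, 0 ≤ (mu j).re) {s : ℂ} (hs : 0 < s.re)
    (j : Fin r) : 0 < ((lam j : ℂ) * s + mu j).re := by
  rw [Complex.add_re, Complex.re_ofReal_mul]
  have := mul_pos (hlam j) hs
  linarith [hmu j]

theorem re_gammaArg_dual_pos (hlam : ∀ j, 0 < lam j) (hmu : ∀ j, 0 ≤ (mu j).re) {s : ℂ}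
    (hs : s.re < 1) (j : Fin r) : 0 < ((lam j : ℂ) * (1 - s) + star (mu j)).re :=
  re_gammaArg_pos (mu := fun j => star (mu j)) hlam (by simpa using hmu)
    (by simpa using hs) j

theorem hasDerivAt_logGammaQuotient (hlam : ∀ j, 0 < lam j) (hmu : ∀ j, 0 ≤ (mu j).re) {s : ℂ}
    (hs : 0 < s.re) (hs' : s.re < 1) :
    HasDerivAt (logGammaQuotient Q lam mu) (2 * Real.log Q + ∑ j, lam j *
      (digammaSeries (lam j * s + mu j) + digammaSeries (lam j * (1 - s) + star (mu j)))) s := by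
  have h0 : HasDerivAt (fun s : ℂ => (2 * s - 1) * (Real.log Q : ℂ)) (2 * Real.log Q) s :=
    (((hasDerivAt_id s).const_mul 2).sub_const 1).mul_const _ |>.congr_deriv (by simp)
  refine h0.add (HasDerivAt.fun_sum fun j _ => ?_)
  have h1 : HasDerivAt (fun s : ℂ => (lam j : ℂ) * s + mu j) (lam j) s :=
    ((hasDerivAt_id s).const_mul _).add_const _ |>.congr_deriv (by simp)
  have h2 : HasDerivAt (fun s : ℂ => (lam j : ℂ) * (1 - s) + star (mu j)) (-lam j) s :=
    (((hasDerivAt_id s).const_sub 1).const_mul _).add_const _ |>.congr_deriv (by simp)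
  refine (((hasDerivAt_logGammaSeries (re_gammaArg_pos hlam hmu hs j)).comp s h1).sub
    ((hasDerivAt_logGammaSeries (re_gammaArg_dual_pos hlam hmu hs' j)).comp s h2)).congr_deriv ?_
  ring

theorem exp_logGammaQuotient (hQ : 0 < Q) (hlam : ∀ j, 0 < lam j) (hmu : ∀ j, 0 ≤ (mu j).re) {s : ℂ}
    (hs : 0 < s.re) (hs' : s.re < 1) :
    Complex.exp (logGammaQuotient Q lam mu s) = (Q : ℂ) ^ (2 * s - 1) *
      ((∏ j, Complex.Gamma (lam j * s + mu j)) /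
        ∏ j, Complex.Gamma (lam j * (1 - s) + star (mu j))) := by
  rw [logGammaQuotient, Complex.exp_add, Complex.exp_sum, ← Finset.prod_div_distrib,
    Complex.cpow_def_of_ne_zero (by exact_mod_cast hQ.ne'), ← Complex.ofReal_log hQ.le, mul_comm (2 * s - 1)]
  congr 1
  refine Finset.prod_congr rfl fun j _ => ?_
  rw [Complex.exp_sub, exp_logGammaSeries (re_gammaArg_pos hlam hmu hs j),
    exp_logGammaSeries (re_gammaArg_dual_pos hlam hmu hs' j)]

/-- For each factor the arguments `λ s + μ` and `λ (1 - s) + conj μ` have imaginary parts of equal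
size, and real parts that differ by `λ (2σ - 1)`. The exponents add up over the factors. -/
theorem exists_norm_exp_logGammaQuotient_le (hQ : 0 < Q) (hlam : ∀ j, 0 < lam j)
    (hmu : ∀ j, 0 ≤ (mu j).re) {σ η : ℝ} (hσ : 1 / 2 ≤ σ) (hσ1 : σ < 1) (hη : 0 < η) :
    ∃ C, 0 < C ∧ ∀ t : ℝ, ‖Complex.exp (logGammaQuotient Q lam mu (σ + t * Complex.I))‖ ≤
      C * (1 + |t|) ^ ((∑ j, lam j) * (2 * σ - 1) * (1 + η)) := by
  have hj : ∀ j, ∃ C, 0 < C ∧ ∀ t : ℝ,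
      ‖Complex.Gamma (lam j * (σ + t * Complex.I) + mu j) /
        Complex.Gamma (lam j * (1 - (σ + t * Complex.I)) + star (mu j))‖ ≤
      C * (1 + |t|) ^ (lam j * ((2 * σ - 1) * (1 + η))) := by
    intro j
    have hx₂ : 0 < lam j * (1 - σ) + (mu j).re := by
      have := mul_pos (hlam j) (sub_pos.2 hσ1)
      linarith [hmu j]
    have hx : lam j * (1 - σ) + (mu j).re ≤ lam j * σ + (mu j).re := by nlinarith [hlam j]
    obtain ⟨C, hC, h⟩ := exists_norm_Gamma_le_rpow_mul hx₂ hx hη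
    set b := |(mu j).im| with hb
    have hb0 : 0 ≤ b := abs_nonneg _
    set e := lam j * ((2 * σ - 1) * (1 + η)) with he
    have he0 : 0 ≤ e := mul_nonneg (hlam j).le (mul_nonneg (by linarith) (by linarith))
    refine ⟨C * (1 + lam j + b) ^ e, by have := hlam j; positivity, fun t => ?_⟩
    set y := lam j * t + (mu j).im with hy
    have h1 : (lam j : ℂ) * (σ + t * Complex.I) + mu j =
        ((lam j * σ + (mu j).re : ℝ) : ℂ) + (y : ℝ) * Complex.I := by
      apply Complex.ext <;> simp [hy]
    have h2 : ‖Complex.Gamma (lam j * (1 - (σ + t * Complex.I)) + star (mu j))‖ =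
        ‖Complex.Gamma (((lam j * (1 - σ) + (mu j).re : ℝ) : ℂ) + (y : ℝ) * Complex.I)‖ := by
      rw [← Complex.norm_conj, ← Complex.Gamma_conj]
      congr 2
      apply Complex.ext <;> simp [hy]
    have h3 : 0 < ‖Complex.Gamma (((lam j * (1 - σ) + (mu j).re : ℝ) : ℂ) + (y : ℝ) * Complex.I)‖ :=
      norm_pos_iff.2 (Complex.Gamma_ne_zero_of_re_pos (by simpa using hx₂))
    rw [norm_div, h2, h1, div_le_iff₀ h3]
    refine (h y).trans (mul_le_mul_of_nonneg_right ?_ h3.le)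
    have h4 : lam j * σ + (mu j).re - (lam j * (1 - σ) + (mu j).re) = lam j * (2 * σ - 1) := by ring
    rw [h4, mul_assoc C, mul_assoc (lam j), ← he]
    refine mul_le_mul_of_nonneg_left ?_ hC.le
    have := hlam j
    rw [← Real.mul_rpow (by positivity) (by positivity)]
    refine Real.rpow_le_rpow (by positivity) ?_ he0
    have : |y| ≤ lam j * |t| + b := by
      refine (abs_add_le _ _).trans ?_
      rw [abs_mul, abs_of_pos (hlam j)]
    nlinarith [abs_nonneg t]
  choose C hC h using hj
  refine ⟨Q ^ (2 * σ - 1) * ∏ j, C j, mul_pos (Real.rpow_pos_of_pos hQ _)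
    (Finset.prod_pos fun j _ => hC j), fun t => ?_⟩
  rw [exp_logGammaQuotient hQ hlam hmu (by simp; linarith) (by simpa using hσ1), norm_mul,
    Complex.norm_cpow_eq_rpow_re_of_pos hQ, ← Finset.prod_div_distrib, norm_prod, mul_assoc (Q ^ _)]
  have e1 : (2 * ((σ : ℂ) + t * Complex.I) - 1).re = 2 * σ - 1 := by simp
  rw [e1]
  refine mul_le_mul_of_nonneg_left ?_ (by positivity)
  refine (Finset.prod_le_prod (fun j _ => norm_nonneg _) fun j _ => h j t).trans_eq ?_
  rw [Finset.prod_mul_distrib, ← Real.rpow_sum_of_pos (by positivity), ← Finset.sum_mul, mul_assoc]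

theorem exists_norm_logGammaQuotient_le (hlam : ∀ j, 0 < lam j)
    (hmu : ∀ j, 0 ≤ (mu j).re) {σ : ℝ} (hσ1 : σ < 1) :
    ∃ C, 0 ≤ C ∧ ∀ s : ℂ, 1 - σ ≤ s.re → s.re ≤ σ →
      ‖logGammaQuotient Q lam mu s‖ ≤ C * (1 + ‖s‖) ^ 2 := by
  have hj : ∀ j, ∃ C, 0 ≤ C ∧ ∀ s : ℂ, 1 - σ ≤ s.re → s.re ≤ σ →
      ‖logGammaSeries (lam j * s + mu j) - logGammaSeries (lam j * (1 - s) + star (mu j))‖ ≤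
        C * (1 + ‖s‖) ^ 2 := by
    intro j
    have ha : 0 < lam j * (1 - σ) := mul_pos (hlam j) (sub_pos.2 hσ1)
    obtain ⟨C, hC, h⟩ := exists_norm_logGammaSeries_le ha
    have hl := (hlam j).le
    set B := 1 + 2 * lam j + ‖mu j‖ with hB
    refine ⟨2 * C * B ^ 2, by positivity, fun s h1 h2 => ?_⟩
    have g1 := h (lam j * s + mu j) (by
      rw [Complex.add_re, Complex.re_ofReal_mul]; nlinarith [hmu j])
    have g2 := h (lam j * (1 - s) + star (mu j)) (by
      rw [Complex.add_re, Complex.re_ofReal_mul, Complex.star_def, Complex.conj_re, Complex.sub_re,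
        Complex.one_re]
      nlinarith [hmu j])
    have n1 : 1 + ‖(lam j : ℂ) * s + mu j‖ ≤ B * (1 + ‖s‖) := by
      have := norm_add_le ((lam j : ℂ) * s) (mu j)
      rw [norm_mul, Complex.norm_real, Real.norm_of_nonneg hl] at this
      nlinarith [norm_nonneg s, norm_nonneg (mu j), mul_nonneg hl (norm_nonneg s),
        mul_nonneg (norm_nonneg (mu j)) (norm_nonneg s)]
    have n2 : 1 + ‖(lam j : ℂ) * (1 - s) + star (mu j)‖ ≤ B * (1 + ‖s‖) := by
      have := norm_add_le ((lam j : ℂ) * (1 - s)) (star (mu j))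
      rw [norm_mul, Complex.norm_real, Real.norm_of_nonneg hl, norm_star] at this
      have h3 : ‖1 - s‖ ≤ 1 + ‖s‖ := (norm_sub_le _ _).trans (by simp)
      have := mul_le_mul_of_nonneg_left h3 hl
      nlinarith [norm_nonneg s, norm_nonneg (mu j), mul_nonneg hl (norm_nonneg s),
        mul_nonneg (norm_nonneg (mu j)) (norm_nonneg s)]
    refine (norm_sub_le _ _).trans ((add_le_add g1 g2).trans ?_)
    calc _ ≤ C * (B * (1 + ‖s‖)) ^ 2 + C * (B * (1 + ‖s‖)) ^ 2 := by gcongr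
      _ = _ := by ring
  choose C hC h using hj
  refine ⟨2 * |Real.log Q| + ∑ j, C j, add_nonneg (by positivity) (Finset.sum_nonneg fun j _ => hC j),
    fun s h1 h2 => ?_⟩
  rw [logGammaQuotient, add_mul]
  refine (norm_add_le _ _).trans (add_le_add ?_ ?_)
  · rw [norm_mul, Complex.norm_real, Real.norm_eq_abs]
    have : ‖2 * s - 1‖ ≤ 2 * (1 + ‖s‖) ^ 2 := by
      refine (norm_sub_le _ _).trans ?_
      rw [norm_mul, norm_one, Complex.norm_two]
      nlinarith [norm_nonneg s]
    calc _ ≤ 2 * (1 + ‖s‖) ^ 2 * |Real.log Q| := by gcongr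
      _ = _ := by ring
  · rw [Finset.sum_mul]
    exact (norm_sum_le _ _).trans (Finset.sum_le_sum fun j _ => h j s h1 h2)

end

/-- The dual argument is the conjugate of a point at the same height `y = l t + Im μ` with smaller
real part. Conjugation turns the sum of digammas into a difference, whose sign is known, and the
difference of trigammas into a sum, each part contributing at least `1/(2y)`. -/
theorem eventually_gammaArg_bounds {l σ : ℝ} {μ : ℂ} (hl : 0 < l) (hμ : 0 ≤ μ.re)
    (hσ : 1 / 2 ≤ σ) (hσ1 : σ < 1) : ∀ᶠ t : ℝ in atTop,
      (digammaSeries (l * (σ + t * Complex.I) + μ) +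
        digammaSeries (l * (1 - (σ + t * Complex.I)) + star μ)).im ≤ 0 ∧
      1 / ((l + |μ.im|) * t) ≤ -(trigammaSeries (l * (σ + t * Complex.I) + μ) -
        trigammaSeries (l * (1 - (σ + t * Complex.I)) + star μ)).im := by
  have hx₂ : 0 < l * (1 - σ) + μ.re := by
    have := mul_pos hl (sub_pos.2 hσ1)
    linarith
  have hx : l * (1 - σ) + μ.re ≤ l * σ + μ.re := by nlinarith
  obtain ⟨Y, hY1, hY⟩ := exists_digammaSeries_im_sub_bounds hx₂ hx one_pos
  obtain ⟨Y', hY1', hY'⟩ := exists_trigammaSeries_im_bounds (b := l * σ + μ.re) hx₂ one_pos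
  have htend : Tendsto (fun t : ℝ => l * t + μ.im) atTop atTop :=
    tendsto_atTop_add_const_right _ _ (tendsto_id.const_mul_atTop hl)
  filter_upwards [htend.eventually_ge_atTop Y, htend.eventually_ge_atTop Y', eventually_ge_atTop 1]
    with t h1 h2 ht
  have e1 : (l : ℂ) * (σ + t * Complex.I) + μ =
      ((l * σ + μ.re : ℝ) : ℂ) + ((l * t + μ.im : ℝ) : ℂ) * Complex.I := by
    apply Complex.ext <;> simp
  have e2 : (l : ℂ) * (1 - (σ + t * Complex.I)) + star μ =
      star (((l * (1 - σ) + μ.re : ℝ) : ℂ) + ((l * t + μ.im : ℝ) : ℂ) * Complex.I) := by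
    apply Complex.ext
    · simp
    · simp; ring
  rw [e1, e2, digammaSeries_star, trigammaSeries_star]
  simp only [Complex.add_im, Complex.sub_im, Complex.star_def, Complex.conj_im]
  refine ⟨by linarith [(hY _ h1).1], ?_⟩
  have b1 := (hY' _ _ hx le_rfl h2).1
  have b2 := (hY' _ _ le_rfl hx h2).1
  have hy0 : 0 < l * t + μ.im := by linarith
  have b3 : 1 / ((l + |μ.im|) * t) ≤ 1 / (l * t + μ.im) := by
    refine one_div_le_one_div_of_le hy0 ?_
    nlinarith [le_abs_self μ.im, abs_nonneg μ.im]
  have b4 : 1 / (l * t + μ.im) = 1 / (2 * (l * t + μ.im)) + 1 / (2 * (l * t + μ.im)) := by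
    field_simp; norm_num
  linarith

section

variable {r : ℕ} {Q : ℝ} {lam : Fin r → ℝ} {mu : Fin r → ℂ}

/-- Cancellation in oscillatory integrals of the gamma factor on a vertical line. -/
theorem exists_norm_integral_exp_logGammaQuotient_le (hr : 0 < r) (hlam : ∀ j, 0 < lam j)
    (hmu : ∀ j, 0 ≤ (mu j).re) {σ : ℝ} (hσ : 1 / 2 ≤ σ) (hσ1 : σ < 1) :
    ∃ C, 0 ≤ C ∧ ∀ᶠ T : ℝ in atTop, ∀ x : ℝ,
      ‖∫ t in T..(2 * T), Complex.exp (logGammaQuotient Q lam mu (σ + t * Complex.I) -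
        t * x * Complex.I)‖ ≤
        C * √T * ‖Complex.exp (logGammaQuotient Q lam mu (σ + (2 * T : ℝ) * Complex.I))‖ := by
  have hne : Nonempty (Fin r) := ⟨⟨0, hr⟩⟩
  set c := ∑ j, lam j ^ 2 / (lam j + |(mu j).im|) with hc
  have hc0 : 0 < c := Finset.sum_pos (fun j _ => by have := hlam j; positivity) Finset.univ_nonempty
  have hev : ∀ᶠ t : ℝ in atTop, ∀ j, _ :=
    eventually_all.2 fun j => eventually_gammaArg_bounds (hlam j) (hmu j) hσ hσ1
  obtain ⟨T0, hT0⟩ := eventually_atTop.1 hev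
  refine ⟨8 * √(2 / c), by positivity, ?_⟩
  filter_upwards [eventually_ge_atTop T0, eventually_ge_atTop 1] with T hT hT1 x
  have hT0' : 0 < T := by linarith
  set s : ℝ → ℂ := fun t => σ + t * Complex.I with hs
  have hsd : ∀ t, HasDerivAt s Complex.I t := fun t =>
    ((Complex.ofRealCLM.hasDerivAt (x := t)).mul_const Complex.I).const_add _ |>.congr_deriv (by simp)
  have hsre : ∀ t, (s t).re = σ := fun t => by simp [hs]
  have hs0 : ∀ t, 0 < (s t).re := fun t => by rw [hsre]; linarith
  have hs1 : ∀ t, (s t).re < 1 := fun t => by rw [hsre]; exact hσ1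
  -- The frequency `x` enters `D` only through the constant `-x i`; neither `Re D` nor `D'` depends
  -- on it, so the estimate is uniform in `x`.
  set g : ℝ → ℂ := fun t => Complex.exp (logGammaQuotient Q lam mu (s t) - t * x * Complex.I) with hg
  set D : ℝ → ℂ := fun t => (2 * Real.log Q + ∑ j, lam j *
      (digammaSeries (lam j * s t + mu j) + digammaSeries (lam j * (1 - s t) + star (mu j)))) *
      Complex.I - x * Complex.I with hD
  set D' : ℝ → ℂ := fun t => -∑ j, (lam j : ℂ) ^ 2 *
      (trigammaSeries (lam j * s t + mu j) - trigammaSeries (lam j * (1 - s t) + star (mu j))) with hD'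
  have hz1 : ∀ t j, HasDerivAt (fun t => (lam j : ℂ) * s t + mu j) (lam j * Complex.I) t := fun t j =>
    ((hsd t).const_mul _).add_const _
  have hz2 : ∀ t j, HasDerivAt (fun t => (lam j : ℂ) * (1 - s t) + star (mu j))
      (lam j * -Complex.I) t := fun t j =>
    (((hsd t).const_sub 1).const_mul _).add_const _
  have p1 := fun t j => re_gammaArg_pos hlam hmu (hs0 t) j
  have p2 := fun t j => re_gammaArg_dual_pos hlam hmu (hs1 t) j
  have hgd : ∀ t, HasDerivAt g (D t * g t) t := fun t => by
    have h1 := (hasDerivAt_logGammaQuotient (Q := Q) hlam hmu (hs0 t) (hs1 t)).comp t (hsd t)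
    have h2 : HasDerivAt (fun t : ℝ => (t : ℂ) * x * Complex.I) (x * Complex.I) t :=
      (((Complex.ofRealCLM.hasDerivAt (x := t)).mul_const (x : ℂ)).mul_const Complex.I).congr_deriv
        (by simp)
    exact ((h1.sub h2).cexp).congr_deriv (mul_comm _ _)
  have hDd : ∀ t, HasDerivAt D (D' t) t := fun t => by
    have h1 : HasDerivAt (fun t => 2 * (Real.log Q : ℂ) + ∑ j, lam j *
      (digammaSeries (lam j * s t + mu j) + digammaSeries (lam j * (1 - s t) + star (mu j))))
      (∑ j, lam j * (trigammaSeries (lam j * s t + mu j) * (lam j * Complex.I) +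
        trigammaSeries (lam j * (1 - s t) + star (mu j)) * (lam j * -Complex.I))) t := by
      refine (HasDerivAt.fun_sum fun j _ => HasDerivAt.const_mul _ ?_).const_add _
      exact ((hasDerivAt_digammaSeries (p1 t j)).comp t (hz1 t j)).add
        ((hasDerivAt_digammaSeries (p2 t j)).comp t (hz2 t j))
    refine ((h1.mul_const Complex.I).sub_const _).congr_deriv ?_
    simp only [hD', ← Finset.sum_neg_distrib, Finset.sum_mul]
    refine Finset.sum_congr rfl fun j _ => ?_
    linear_combination (lam j : ℂ) ^ 2 * (trigammaSeries (lam j * s t + mu j) -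
      trigammaSeries (lam j * (1 - s t) + star (mu j))) * Complex.I_mul_I
  have hSc : ∀ z : ℂ, 0 < z.re → ContinuousAt trigammaSeries z := fun z hz => by
    have hopen : IsOpen {z : ℂ | 0 < z.re} := isOpen_lt continuous_const Complex.continuous_re
    have hdiff : DifferentiableOn ℂ digammaSeries {z : ℂ | 0 < z.re} := fun w hw =>
      (hasDerivAt_digammaSeries hw).differentiableAt.differentiableWithinAt
    refine ((hdiff.deriv hopen).continuousOn.continuousAt (hopen.mem_nhds hz)).congr ?_
    filter_upwards [hopen.mem_nhds hz] with w hw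
    exact (hasDerivAt_digammaSeries hw).deriv
  have hD'c : Continuous D' := continuous_iff_continuousAt.2 fun t => by
    refine (tendsto_finsetSum _ fun j _ => ?_).neg
    have c1 := ContinuousAt.comp (f := fun t => (lam j : ℂ) * s t + mu j) (hSc _ (p1 t j))
      (hz1 t j).continuousAt
    have c2 := ContinuousAt.comp (f := fun t => (lam j : ℂ) * (1 - s t) + star (mu j))
      (hSc _ (p2 t j)) (hz2 t j).continuousAt
    exact ((c1.sub c2).const_mul _ : Tendsto _ _ _)
  -- The `j`-th summand of `Im D'` is at least `λ_j² / ((λ_j + |Im μ_j|) t)`, so on `[T, 2T]` the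
  -- total is at least `c/(2T)`.
  have key := norm_integral_le_of_le_deriv_logDeriv_im (g := g) (D := D) (D' := D') (a := T)
    (b := 2 * T) (r := c / (2 * T)) (by linarith) (by positivity) (fun t _ => hgd t)
    (fun t _ => Complex.exp_ne_zero _) (fun t _ => hDd t) hD'c.continuousOn ?_ ?_
  · refine key.trans_eq ?_
    have hn : ‖g (2 * T)‖ =
        ‖Complex.exp (logGammaQuotient Q lam mu (σ + (2 * T : ℝ) * Complex.I))‖ := by
      simp only [hg, hs, Complex.norm_exp]
      congr 1
      simp
    rw [hn, Real.sqrt_div hc0.le, Real.sqrt_div zero_le_two, Real.sqrt_mul zero_le_two]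
    have := Real.sqrt_ne_zero'.2 hc0
    field_simp
  · intro t ht
    have : (D t).re = -∑ j, lam j * (digammaSeries (lam j * s t + mu j) +
        digammaSeries (lam j * (1 - s t) + star (mu j))).im := by
      simp only [hD, Complex.sub_re, Complex.mul_I_re, Complex.add_im, Complex.im_sum,
        Complex.im_ofReal_mul, Complex.ofReal_im]
      simp
    rw [this, ← Finset.sum_neg_distrib]
    refine Finset.sum_nonneg fun j _ => ?_
    have := (hT0 t (hT.trans ht.1) j).1
    have := mul_nonneg (hlam j).le (neg_nonneg.2 this)
    simp only [hs]
    linarith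
  · intro t ht
    have : (D' t).im = ∑ j, lam j ^ 2 * -(trigammaSeries (lam j * s t + mu j) -
        trigammaSeries (lam j * (1 - s t) + star (mu j))).im := by
      simp only [hD', Complex.neg_im, Complex.im_sum, ← Complex.ofReal_pow,
        Complex.im_ofReal_mul, ← Finset.sum_neg_distrib, mul_neg]
    rw [this, hc, Finset.sum_div]
    refine Finset.sum_le_sum fun j _ => ?_
    have h2 := (hT0 t (hT.trans ht.1) j).2
    have hl := hlam j
    have ht0 : 0 < t := hT0'.trans_le ht.1
    calc lam j ^ 2 / (lam j + |(mu j).im|) / (2 * T) ≤ lam j ^ 2 / (lam j + |(mu j).im|) / t := by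
          have := ht.2
          gcongr
      _ = lam j ^ 2 * (1 / ((lam j + |(mu j).im|) * t)) := by field_simp
      _ ≤ _ := by gcongr

end

/-! ### Termwise integration of Dirichlet series on vertical lines -/

theorem LSeries_term_add_mul_I (a : ℕ → ℂ) (σ t : ℝ) (n : ℕ) :
    LSeries.term a (σ + t * Complex.I) n =
      LSeries.term a σ n * Complex.exp (-(t * Real.log n) * Complex.I) := by
  rcases eq_or_ne n 0 with rfl | hn
  · simp
  have hn' : (n : ℂ) ≠ 0 := by exact_mod_cast hn
  rw [LSeries.term_of_ne_zero hn, LSeries.term_of_ne_zero hn, Complex.cpow_add _ _ hn', ← div_div,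
    div_eq_mul_inv _ ((n : ℂ) ^ ((t : ℂ) * Complex.I)), ← Complex.cpow_neg,
    Complex.cpow_def_of_ne_zero hn' (-((t : ℂ) * Complex.I)), ← Complex.natCast_log]
  congr 2
  ring

theorem norm_exp_ofReal_mul_I' (x : ℝ) : ‖Complex.exp (-(x : ℂ) * Complex.I)‖ = 1 := by
  rw [← Complex.ofReal_neg, Complex.norm_exp_ofReal_mul_I]

theorem hasSum_integral_LSeries_mul {a : ℕ → ℂ} {σ : ℝ} (ha : LSeriesSummable a σ) {k : ℝ → ℂ}
    (hk : Continuous k) (A B : ℝ) :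
    HasSum (fun n => LSeries.term a σ n *
        ∫ t in A..B, Complex.exp (-(t * Real.log n) * Complex.I) * k t)
      (∫ t in A..B, LSeries a (σ + t * Complex.I) * k t) := by
  have hcont : ∀ n : ℕ, Continuous fun t : ℝ => Complex.exp (-(t * Real.log n) * Complex.I) := by
    intro n; fun_prop
  have hnorm : ∀ (n : ℕ) (t : ℝ), ‖Complex.exp (-(t * Real.log n) * Complex.I)‖ = 1 := fun n t => by
    rw [← Complex.ofReal_mul, norm_exp_ofReal_mul_I']
  have := intervalIntegral.hasSum_integral_of_dominated_convergence (μ := MeasureTheory.volume)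
    (a := A) (b := B)
    (F := fun n t => LSeries.term a σ n * (Complex.exp (-(t * Real.log n) * Complex.I) * k t))
    (f := fun t => LSeries a (σ + t * Complex.I) * k t)
    (fun n t => ‖LSeries.term a σ n‖ * ‖k t‖)
    (fun n => (continuous_const.mul ((hcont n).mul hk)).aestronglyMeasurable)
    (fun n => Eventually.of_forall fun t _ => by rw [norm_mul, norm_mul, hnorm, one_mul])
    (Eventually.of_forall fun t _ => ha.norm.mul_right _) ?_ ?_
  · simpa only [intervalIntegral.integral_const_mul] using this
  · simp_rw [tsum_mul_right]
    exact (continuous_const.mul hk.norm).intervalIntegrable _ _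
  · refine Eventually.of_forall fun t _ => ?_
    have hs : LSeriesSummable a (σ + t * Complex.I) :=
      (LSeriesSummable_iff_of_re_eq_re (by simp)).1 ha
    have := hs.LSeriesHasSum.mul_right (k t)
    simpa only [LSeries_term_add_mul_I, mul_assoc] using this

theorem norm_integral_LSeries_mul_le {a : ℕ → ℂ} {σ : ℝ} (ha : LSeriesSummable a σ) {k : ℝ → ℂ}
    (hk : Continuous k) (A B : ℝ) {M : ℝ}
    (hM : ∀ n : ℕ, ‖∫ t in A..B, Complex.exp (-(t * Real.log n) * Complex.I) * k t‖ ≤ M) :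
    ‖∫ t in A..B, LSeries a (σ + t * Complex.I) * k t‖ ≤ (∑' n, ‖LSeries.term a σ n‖) * M := by
  rw [← (hasSum_integral_LSeries_mul ha hk A B).tsum_eq, ← tsum_mul_right]
  refine tsum_of_norm_bounded (ha.norm.mul_right M).hasSum fun n => ?_
  rw [norm_mul]
  gcongr
  exact hM n

theorem inv_le_abs_log_sub_log {m n : ℕ} (hm : m ≠ 0) (hn : n ≠ 0) (hmn : n ≠ m) :
    ((m : ℝ) + 1)⁻¹ ≤ |Real.log m - Real.log n| := by
  have hm' : (0 : ℝ) < m := by positivity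
  have hn' : (0 : ℝ) < n := by positivity
  rcases lt_or_gt_of_ne hmn with h | h
  · have h' : (n : ℝ) + 1 ≤ m := by exact_mod_cast h
    refine le_trans ?_ (le_abs_self _)
    rw [← Real.log_div hm'.ne' hn'.ne']
    refine le_trans ?_ (Real.one_sub_inv_le_log_of_pos (by positivity))
    rw [inv_div, one_sub_div hm'.ne', inv_eq_one_div, div_le_div_iff₀ (by positivity) hm']
    nlinarith
  · have h' : (m : ℝ) + 1 ≤ n := by exact_mod_cast h
    refine le_trans ?_ (neg_le_abs _)
    rw [neg_sub, ← Real.log_div hn'.ne' hm'.ne']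
    refine le_trans ?_ (Real.one_sub_inv_le_log_of_pos (by positivity))
    rw [inv_div, one_sub_div hn'.ne', inv_eq_one_div, div_le_div_iff₀ (by positivity) hn']
    nlinarith

/-- Multiplication by `m^(it)` makes the term `n = m` constant. All other frequencies `log m - log
n` are at least `1/(m+1)` in size, so their integrals are bounded uniformly in `n` and in the
interval. -/
theorem exists_norm_integral_LSeries_mul_exp_sub_le {a : ℕ → ℂ} {σ : ℝ} (ha : LSeriesSummable a σ)
    {m : ℕ} (hm : m ≠ 0) :
    ∃ C, ∀ A B : ℝ, ‖(∫ t in A..B, LSeries a (σ + t * Complex.I) *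
      Complex.exp ((t * Real.log m) * Complex.I)) - LSeries.term a σ m * (B - A : ℝ)‖ ≤ C := by
  refine ⟨∑' n, ‖LSeries.term a σ n‖ * (2 * ((m : ℝ) + 1)), fun A B => ?_⟩
  have hk : Continuous fun t : ℝ => Complex.exp ((t * Real.log m) * Complex.I) := by fun_prop
  have h1 := hasSum_integral_LSeries_mul ha hk A B
  have h2 := hasSum_ite_eq m (LSeries.term a σ m * (B - A : ℝ))
  have h3 := h1.sub h2
  rw [← h3.tsum_eq]
  refine tsum_of_norm_bounded (ha.norm.mul_right _).hasSum fun n => ?_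
  have hint : ∀ t : ℝ, Complex.exp (-(t * Real.log n) * Complex.I) *
      Complex.exp ((t * Real.log m) * Complex.I) =
      Complex.exp (((Real.log m - Real.log n : ℝ) * Complex.I) * t) := fun t => by
    rw [← Complex.exp_add]; congr 1; push_cast; ring
  simp_rw [hint]
  split_ifs with h
  · subst h
    simp only [sub_self, Complex.ofReal_zero, zero_mul, Complex.exp_zero,
      intervalIntegral.integral_const, Complex.real_smul, mul_one, norm_zero]
    positivity
  rcases eq_or_ne n 0 with rfl | hn
  · simp
  have hx := inv_le_abs_log_sub_log hm hn h
  set x := Real.log m - Real.log n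
  have hx0 : 0 < |x| := lt_of_lt_of_le (by positivity) hx
  have hc : (x : ℂ) * Complex.I ≠ 0 := by
    simpa using abs_pos.1 hx0
  rw [sub_zero, norm_mul, integral_exp_mul_complex hc]
  gcongr
  rw [norm_div, norm_mul, Complex.norm_I, mul_one, Complex.norm_real, Real.norm_eq_abs,
    div_le_iff₀ hx0]
  have e : ∀ y : ℝ, ‖Complex.exp ((x : ℂ) * Complex.I * y)‖ = 1 := fun y => by
    rw [show (x : ℂ) * Complex.I * y = ((x * y : ℝ) : ℂ) * Complex.I by push_cast; ring,
      Complex.norm_exp_ofReal_mul_I]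
  refine (norm_sub_le _ _).trans ?_
  rw [e, e]
  have := mul_le_mul_of_nonneg_left hx (by positivity : 0 ≤ 2 * ((m : ℝ) + 1))
  rw [mul_assoc, mul_inv_cancel₀ (by positivity)] at this
  linarith

/-! ### Phragmén–Lindelöf and the contour argument -/

/-- Converts the exponent of a bound of finite order into the doubly exponential form that
Phragmén–Lindelöf in a strip admits. -/
theorem exists_mul_rpow_add_le_exp (C p q : ℝ) :
    ∃ B Y : ℝ, ∀ y : ℝ, Y ≤ y → C * (2 + y) ^ p + (2 + y) ^ q ≤ B * Real.exp y := by
  have ht : Tendsto (fun y : ℝ => 2 + y) atTop atTop := tendsto_atTop_add_const_left _ _ tendsto_id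
  have h1 := ((isLittleO_rpow_exp_atTop p).bound one_pos)
  have h2 := ((isLittleO_rpow_exp_atTop q).bound one_pos)
  obtain ⟨Y, hY⟩ := eventually_atTop.1 ((ht.eventually h1).and ((ht.eventually h2).and
    (eventually_ge_atTop 0)))
  refine ⟨(|C| + 1) * Real.exp 2, Y, fun y hy => ?_⟩
  obtain ⟨g1, g2, hy0⟩ := hY y hy
  rw [one_mul, Real.norm_of_nonneg (Real.rpow_nonneg (by linarith) _), Real.norm_of_nonneg (Real.exp_pos _).le,
    Real.exp_add] at g1 g2
  have : C * (2 + y) ^ p ≤ |C| * (Real.exp 2 * Real.exp y) :=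
    (mul_le_mul_of_nonneg_right (le_abs_self C) (Real.rpow_nonneg (by linarith) _)).trans
      (mul_le_mul_of_nonneg_left g1 (abs_nonneg _))
  linarith

section

variable {F : ℂ → ℂ} {r : ℕ} {Q : ℝ} {lam : Fin r → ℝ} {mu : Fin r → ℂ} {omega : ℂ}

theorem SatisfiesFunctionalEquation.exp_logGammaQuotient_mul
    (h : SatisfiesFunctionalEquation F r Q lam mu omega) {s : ℂ} (hs : 0 < s.re) (hs' : s.re < 1) :
    Complex.exp (logGammaQuotient Q lam mu s) * F s = omega * star (F (1 - star s)) := by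
  have hQ : (Q : ℂ) ≠ 0 := by exact_mod_cast h.Q_pos.ne'
  have hpole : ∀ {z : ℂ}, 0 < z.re → ∀ n : ℕ, z ≠ -(n : ℂ) := fun {z} hz n e => by
    rw [e] at hz
    simp only [Complex.neg_re, Complex.natCast_re] at hz
    have : (0 : ℝ) ≤ n := n.cast_nonneg
    linarith
  have p1 := re_gammaArg_pos h.lam_pos h.mu_re_nonneg hs
  have p2 := re_gammaArg_dual_pos h.lam_pos h.mu_re_nonneg hs'
  have e := h.eqn s (by rintro rfl; simp at hs) (by rintro rfl; simp at hs')
    (fun j n => hpole (p1 j) n) (fun j n => hpole (p2 j) n)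
  have hP : ∏ j, Complex.Gamma ((lam j : ℂ) * (1 - s) + star (mu j)) ≠ 0 :=
    Finset.prod_ne_zero_iff.2 fun j _ => Complex.Gamma_ne_zero_of_re_pos (p2 j)
  rw [exp_logGammaQuotient h.Q_pos h.lam_pos h.mu_re_nonneg hs hs']
  have hpow : (Q : ℂ) ^ (2 * s - 1) = (Q : ℂ) ^ s / (Q : ℂ) ^ (1 - s) := by
    rw [← Complex.cpow_sub _ _ hQ]; congr 1; ring
  have hq1 : (Q : ℂ) ^ (1 - s) ≠ 0 := by simp [Complex.cpow_eq_zero_iff, hQ]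
  rw [hpow, div_mul_div_comm, div_mul_eq_mul_div, div_eq_iff (mul_ne_zero hq1 hP)]
  linear_combination e

/-- Phragmén–Lindelöf for a function with a functional equation, inside the critical strip. -/
theorem SatisfiesFunctionalEquation.exists_norm_exp_logGammaQuotient_mul_le
    (h : SatisfiesFunctionalEquation F r Q lam mu omega) {σ : ℝ} (hσ : 1 / 2 < σ) (hσ1 : σ < 1)
    (hdiff : DifferentiableOn ℂ F {s | s.re < 1})
    (hgrow : ∃ A : ℝ, F =O[Bornology.cobounded ℂ ⊓ 𝓟 {s | s.re ≤ σ}] fun s => Real.exp (‖s‖ ^ A))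
    {K : ℝ} (hK : ∀ t : ℝ, ‖F (σ + t * Complex.I)‖ ≤ K) {η : ℝ} (hη : 0 < η) :
    ∃ C, ∀ s : ℂ, 1 - σ ≤ s.re → s.re ≤ σ →
      ‖Complex.exp (logGammaQuotient Q lam mu s) * F s‖ ≤
        C * ‖s + 1‖ ^ ((∑ j, lam j) * (2 * σ - 1) * (1 + η)) := by
  set θ := (∑ j, lam j) * (2 * σ - 1) * (1 + η) with hθ
  have hθ0 : 0 ≤ θ := mul_nonneg (mul_nonneg (Finset.sum_nonneg fun j _ => (h.lam_pos j).le)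
    (by linarith)) (by linarith)
  have hK0 : 0 ≤ K := (norm_nonneg _).trans (hK 0)
  obtain ⟨C, hC, hCb⟩ := exists_norm_exp_logGammaQuotient_le h.Q_pos h.lam_pos h.mu_re_nonneg hσ.le
    hσ1 hη
  obtain ⟨C', hC', hCb'⟩ := exists_norm_logGammaQuotient_le (Q := Q) h.lam_pos h.mu_re_nonneg hσ1
  set Φ : ℂ → ℂ := fun s => Complex.exp (logGammaQuotient Q lam mu s) * F s with hΦ
  -- Division by `(s+1)^θ` makes both edges bounded. On `Re s = 1 - σ` the functional equation gives
  -- `|Φ| = |F|` at the reflected point of the line `Re s = σ`; on `Re s = σ` one has `|Φ| ≤ K C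
  -- (1+|t|)^θ`.
  set f : ℂ → ℂ := fun s => Φ s / (s + 1) ^ (θ : ℂ) with hf
  have hne : ∀ s : ℂ, 0 < s.re → s + 1 ≠ 0 := fun s hs => by
    simpa using add_natCast_ne_zero_of_re_pos hs 1
  have hn1 : ∀ s : ℂ, 0 < s.re → 1 ≤ ‖s + 1‖ := fun s hs => by
    refine le_trans ?_ (Complex.re_le_norm _)
    simp only [Complex.add_re, Complex.one_re]
    linarith
  have hcl : closure (Complex.re ⁻¹' Set.Ioo (1 - σ) σ) ⊆ {s : ℂ | 0 < s.re ∧ s.re < 1} := by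
    refine (closure_minimal (Set.preimage_mono Set.Ioo_subset_Icc_self)
      (isClosed_Icc.preimage Complex.continuous_re)).trans fun s hs => ?_
    exact ⟨by linarith [hs.1], by linarith [hs.2]⟩
  have hΦd : DifferentiableOn ℂ Φ {s : ℂ | 0 < s.re ∧ s.re < 1} := fun s hs =>
    ((hasDerivAt_logGammaQuotient h.lam_pos h.mu_re_nonneg hs.1 hs.2).differentiableAt.cexp
      |>.differentiableWithinAt).mul ((hdiff s hs.2).mono fun w hw => hw.2)
  have hfd : DifferentiableOn ℂ f {s : ℂ | 0 < s.re ∧ s.re < 1} := by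
    refine hΦd.div (fun s hs => ?_) fun s hs => ?_
    · refine ((differentiableAt_id.add_const 1).cpow_const ?_).differentiableWithinAt
      refine Or.inl ?_
      simp only [id, Complex.add_re, Complex.one_re]
      linarith [hs.1]
    · simp [Complex.cpow_eq_zero_iff, hne s hs.1]
  have hfn : ∀ s : ℂ, ‖f s‖ = ‖Φ s‖ / ‖s + 1‖ ^ θ := fun s => by
    rw [hf]; simp only [norm_div, Complex.norm_cpow_real]
  obtain ⟨A, hA⟩ := hgrow
  obtain ⟨c, hc⟩ := hA.bound
  have hbig : ∃ c < Real.pi / (σ - (1 - σ)), ∃ B, f =O[comap (_root_.abs ∘ Complex.im) atTop ⊓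
      𝓟 (Complex.re ⁻¹' Set.Ioo (1 - σ) σ)] fun z ↦ Real.exp (B * Real.exp (c * |z.im|)) := by
    -- The strip has width `2σ - 1 < 1`, so the critical rate exceeds `π` and rate `1` is
    -- admissible.
    refine ⟨1, ?_, ?_⟩
    · rw [lt_div_iff₀ (by linarith)]
      linarith [Real.pi_gt_three]
    obtain ⟨B, Y, hBY⟩ := exists_mul_rpow_add_le_exp C' 2 (max A 0)
    refine ⟨B, IsBigO.of_bound c ?_⟩
    have hcob : Tendsto (fun z : ℂ => z) (comap (_root_.abs ∘ Complex.im) atTop ⊓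
        𝓟 (Complex.re ⁻¹' Set.Ioo (1 - σ) σ)) (Bornology.cobounded ℂ ⊓ 𝓟 {s | s.re ≤ σ}) := by
      refine tendsto_inf.2 ⟨?_, tendsto_inf_right (tendsto_principal_principal.2 fun s hs => hs.2.le)⟩
      refine tendsto_inf_left (tendsto_norm_atTop_iff_cobounded.1 ?_)
      exact tendsto_atTop_mono (fun z => Complex.abs_im_le_norm z) tendsto_comap
    have hY : ∀ Y, ∀ᶠ z in comap (_root_.abs ∘ Complex.im) atTop ⊓
        𝓟 (Complex.re ⁻¹' Set.Ioo (1 - σ) σ), Y ≤ |z.im| := fun Y =>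
      (tendsto_comap.eventually (eventually_ge_atTop Y)).filter_mono inf_le_left
    filter_upwards [hcob.eventually hc, hY Y, mem_inf_of_right (mem_principal_self _), hY 1]
      with z h1 h2 h3 h4
    have hre : 0 < z.re := by linarith [h3.1]
    have hzn : ‖z‖ ≤ 1 + |z.im| := by
      refine (Complex.norm_le_abs_re_add_abs_im z).trans ?_
      rw [abs_of_pos hre]; linarith [h3.2]
    rw [Real.norm_of_nonneg (Real.exp_pos _).le] at h1 ⊢
    have hc0 : 0 ≤ c := by
      by_contra hneg
      have := (norm_nonneg _).trans h1
      exact absurd this (not_le.2 (mul_neg_of_neg_of_pos (not_le.1 hneg) (Real.exp_pos _)))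
    rw [hfn, one_mul]
    have h1n : 1 ≤ ‖z + 1‖ ^ θ := Real.one_le_rpow (hn1 z hre) hθ0
    refine (div_le_self (norm_nonneg _) h1n).trans ?_
    rw [hΦ, norm_mul, Complex.norm_exp]
    have g1 : (logGammaQuotient Q lam mu z).re ≤ C' * (2 + |z.im|) ^ (2 : ℝ) := by
      refine (Complex.re_le_norm _).trans ((hCb' z h3.1.le h3.2.le).trans ?_)
      rw [show (2 : ℝ) = ((2 : ℕ) : ℝ) by norm_num, Real.rpow_natCast]
      have : 1 + ‖z‖ ≤ ((2 : ℕ) : ℝ) + |z.im| := by push_cast; linarith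
      gcongr
    have g2 : ‖z‖ ^ A ≤ (2 + |z.im|) ^ (max A 0) := by
      exact (Real.rpow_le_rpow_of_exponent_le (h4.trans (Complex.abs_im_le_norm z))
        (le_max_left _ _)).trans
          (Real.rpow_le_rpow (norm_nonneg _) (by linarith) (le_max_right _ _))
    calc _ ≤ Real.exp (C' * (2 + |z.im|) ^ (2 : ℝ)) * (c * Real.exp ((2 + |z.im|) ^ (max A 0))) := by
          gcongr
          exact h1.trans (by gcongr)
      _ = c * Real.exp (C' * (2 + |z.im|) ^ (2 : ℝ) + (2 + |z.im|) ^ (max A 0)) := by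
          rw [Real.exp_add]; ring
      _ ≤ _ := by
          have := hBY _ h2
          gcongr
  refine ⟨max K (K * C * 2 ^ θ), fun s h1 h2 => ?_⟩
  have hpl := PhragmenLindelof.vertical_strip (f := f) (C := max K (K * C * 2 ^ θ)) (a := 1 - σ) (b := σ)
    (hfd.mono hcl).diffContOnCl hbig ?_ ?_ h1 h2
  · rw [hfn, div_le_iff₀ (Real.rpow_pos_of_pos (by linarith [hn1 s (by linarith)]) _)] at hpl
    exact hpl
  · intro z hz
    have hre : 0 < z.re := by linarith
    refine le_trans ?_ (le_max_left _ _)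
    rw [hfn]
    refine (div_le_self (norm_nonneg _) (Real.one_le_rpow (hn1 z hre) hθ0)).trans ?_
    rw [hΦ]
    simp only
    rw [h.exp_logGammaQuotient_mul hre (by linarith), norm_mul, h.norm_omega, one_mul, norm_star]
    have : 1 - star z = σ + (z.im : ℂ) * Complex.I := by
      apply Complex.ext <;> simp [hz]
    rw [this]
    exact hK _
  · intro z hz
    have hre : 0 < z.re := by linarith
    refine le_trans ?_ (le_max_right _ _)
    have hz' : z = σ + (z.im : ℂ) * Complex.I := by rw [← hz, Complex.re_add_im]
    have hp : 0 < ‖z + 1‖ ^ θ := Real.rpow_pos_of_pos (by linarith [hn1 z hre]) _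
    rw [hfn, div_le_iff₀ hp, hΦ, norm_mul]
    have g1 := hCb z.im
    have g2 := hK z.im
    rw [← hz'] at g1 g2
    have g3 : (1 + |z.im|) ^ θ ≤ 2 ^ θ * ‖z + 1‖ ^ θ := by
      rw [← Real.mul_rpow zero_le_two (norm_nonneg _)]
      refine Real.rpow_le_rpow (by positivity) ?_ hθ0
      have i1 : |z.im| ≤ ‖z + 1‖ := by simpa using Complex.abs_im_le_norm (z + 1)
      linarith [hn1 z hre]
    calc _ ≤ C * (1 + |z.im|) ^ θ * K := by gcongr
      _ ≤ C * (2 ^ θ * ‖z + 1‖ ^ θ) * K := by gcongr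
      _ = _ := by ring

end

section

variable {F : ℂ → ℂ} {r : ℕ} {Q : ℝ} {lam : Fin r → ℝ} {mu : Fin r → ℂ} {omega : ℂ}

/-- A Dirichlet series with a functional equation of degree `d = 2 ∑ λ_j` does not converge
absolutely to the left of `1 / 2 + 1 / (2 d)`. -/
theorem SatisfiesFunctionalEquation.half_le_of_LSeriesSummable
    (h : SatisfiesFunctionalEquation F r Q lam mu omega) (hr : 0 < r) {σ : ℝ} (hσ : 1 / 2 < σ)
    (hσ1 : σ < 1) (hdiff : DifferentiableOn ℂ F {s | s.re < 1})
    (hgrow : ∃ A : ℝ, F =O[Bornology.cobounded ℂ ⊓ 𝓟 {s | s.re ≤ σ}] fun s => Real.exp (‖s‖ ^ A))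
    {a : ℕ → ℂ} (ha : LSeriesSummable a σ)
    (hF : ∀ t : ℝ, F (σ + t * Complex.I) = LSeries a (σ + t * Complex.I)) {m : ℕ} (hm : m ≠ 0)
    (ham : a m ≠ 0) : 1 / 2 ≤ (∑ j, lam j) * (2 * σ - 1) := by
  by_contra! hlt
  set θ₀ := (∑ j, lam j) * (2 * σ - 1) with hθ₀
  have hθ₀0 : 0 ≤ θ₀ := mul_nonneg (Finset.sum_nonneg fun j _ => (h.lam_pos j).le) (by linarith)
  obtain ⟨η, hη, hθ1⟩ : ∃ η, 0 < η ∧ θ₀ * (1 + η) < 1 / 2 := by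
    -- With this choice `1/2 - θ₀ (1+η) = (1/2 - θ₀)(1 - θ₀)`, which is positive.
    refine ⟨1 / 2 - θ₀, by linarith, by nlinarith⟩
  set θ := θ₀ * (1 + η) with hθ
  have hθ0 : 0 ≤ θ := mul_nonneg hθ₀0 (by linarith)
  set K := ∑' n, ‖LSeries.term a σ n‖ with hKdef
  have hK0 : 0 ≤ K := tsum_nonneg fun n => norm_nonneg _
  have hK : ∀ t : ℝ, ‖F (σ + t * Complex.I)‖ ≤ K := fun t => by
    rw [hF, LSeries]
    refine tsum_of_norm_bounded ha.norm.hasSum fun n => ?_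
    rw [LSeries_term_add_mul_I, norm_mul, ← Complex.ofReal_mul, norm_exp_ofReal_mul_I', mul_one]
  obtain ⟨C₁, hC₁⟩ := h.exists_norm_exp_logGammaQuotient_mul_le hσ hσ1 hdiff hgrow hK hη
  obtain ⟨C₂, hC₂0, hC₂⟩ := exists_norm_exp_logGammaQuotient_le h.Q_pos h.lam_pos h.mu_re_nonneg hσ.le
    hσ1 hη
  obtain ⟨C₃, hC₃0, hC₃⟩ := exists_norm_integral_exp_logGammaQuotient_le (Q := Q) hr h.lam_pos
    h.mu_re_nonneg hσ.le hσ1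
  obtain ⟨C₄, hC₄⟩ := exists_norm_integral_LSeries_mul_exp_sub_le ha hm
  set l := Real.log m with hl
  have hl0 : 0 ≤ l := Real.log_natCast_nonneg m
  -- The factor `exp (-l s) = m^(-s)` selects the coefficient `a(m)` on the left side of the
  -- rectangle; on the right side it only shifts the frequencies `log n` by `log m`.
  set H : ℂ → ℂ := fun s => Complex.exp (logGammaQuotient Q lam mu s) * F s * Complex.exp (-l * s)
    with hH
  have hHd : DifferentiableOn ℂ H {s : ℂ | 0 < s.re ∧ s.re < 1} := fun s hs =>
    (((hasDerivAt_logGammaQuotient h.lam_pos h.mu_re_nonneg hs.1 hs.2).differentiableAt.cexp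
      |>.differentiableWithinAt).mul ((hdiff s hs.2).mono fun w hw => hw.2)).mul
      ((differentiableAt_id.const_mul _).cexp.differentiableWithinAt)
  have hexpn : ∀ s : ℂ, 0 < s.re → ‖Complex.exp (-l * s)‖ ≤ 1 := fun s hs => by
    rw [Complex.norm_exp, ← Complex.ofReal_neg, Complex.re_ofReal_mul, Real.exp_le_one_iff]
    nlinarith
  have hrect : ∀ T : ℝ, 0 < T →
      (∫ x : ℝ in (1 - σ)..σ, H (x + T * Complex.I)) -
      (∫ x : ℝ in (1 - σ)..σ, H (x + (2 * T : ℝ) * Complex.I)) +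
      Complex.I • (∫ y : ℝ in T..(2 * T), H (σ + y * Complex.I)) -
      Complex.I • (∫ y : ℝ in T..(2 * T), H ((1 - σ : ℝ) + y * Complex.I)) = 0 := fun T hT => by
    have := Complex.integral_boundary_rect_eq_zero_of_differentiableOn H
      (⟨1 - σ, T⟩ : ℂ) (⟨σ, 2 * T⟩ : ℂ) (hHd.mono ?_)
    · exact this
    · intro s hs
      rw [Complex.mem_reProdIm] at hs
      have h1 := hs.1
      simp only at h1
      rw [Set.uIcc_of_le (by linarith)] at h1
      exact ⟨by linarith [h1.1], by linarith [h1.2]⟩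
  have hhor : ∀ T : ℝ, 1 ≤ T → ‖∫ x : ℝ in (1 - σ)..σ, H (x + T * Complex.I)‖ ≤
      |C₁| * (3 * T) ^ θ := fun T hT => by
    have hb : ∀ x ∈ Set.uIoc (1 - σ) σ, ‖H (x + T * Complex.I)‖ ≤ |C₁| * (3 * T) ^ θ := by
      intro x hx
      rw [Set.uIoc_of_le (by linarith)] at hx
      have hre : ((x : ℂ) + T * Complex.I).re = x := by simp
      have g1 := hC₁ (x + T * Complex.I) (by rw [hre]; exact hx.1.le) (by rw [hre]; exact hx.2)
      have g2 := hexpn (x + T * Complex.I) (by rw [hre]; linarith [hx.1])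
      simp only [hH]
      rw [norm_mul]
      have g3 : ‖(x : ℂ) + T * Complex.I + 1‖ ≤ 3 * T := by
        refine (Complex.norm_le_abs_re_add_abs_im _).trans ?_
        simp only [Complex.add_re, hre, Complex.one_re, Complex.add_im, Complex.ofReal_im,
          Complex.mul_im, Complex.ofReal_re, Complex.I_im, Complex.I_re, Complex.one_im]
        rw [abs_of_pos (by linarith [hx.1]), abs_of_pos (by linarith)]
        linarith [hx.2]
      calc _ ≤ (C₁ * ‖(x : ℂ) + T * Complex.I + 1‖ ^ θ) * 1 := by
            gcongr
            exact (norm_nonneg _).trans g1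
        _ ≤ (|C₁| * ‖(x : ℂ) + T * Complex.I + 1‖ ^ θ) * 1 := by gcongr; exact le_abs_self _
        _ ≤ _ := by rw [mul_one]; gcongr
    refine (intervalIntegral.norm_integral_le_of_norm_le_const hb).trans ?_
    have hT0 : 0 < T := by linarith
    rw [abs_of_pos (by linarith : (0 : ℝ) < σ - (1 - σ))]
    exact mul_le_of_le_one_right (by positivity) (by linarith)
  -- Each term of the series meets an oscillatory integral with frequency `log n + l`, bounded
  -- uniformly in `n`; absolute convergence at `σ` then sums the terms.
  have hright : ∀ᶠ T : ℝ in atTop, ‖∫ y : ℝ in T..(2 * T), H (σ + y * Complex.I)‖ ≤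
      K * (C₃ * √T * (C₂ * (3 * T) ^ θ)) := by
    filter_upwards [hC₃, eventually_ge_atTop 1] with T hT hT1
    have hk : Continuous fun t : ℝ => Complex.exp (logGammaQuotient Q lam mu (σ + t * Complex.I)) *
        Complex.exp (-l * (σ + t * Complex.I)) := by
      refine Continuous.mul (continuous_iff_continuousAt.2 fun t => ?_) (by fun_prop)
      have hc1 : ContinuousAt (fun t : ℝ => (σ : ℂ) + t * Complex.I) t := by fun_prop
      have := (hasDerivAt_logGammaQuotient (Q := Q) h.lam_pos h.mu_re_nonneg
        (s := σ + t * Complex.I) (by simp; linarith) (by simpa using hσ1)).differentiableAt.cexp.continuousAt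
      exact ContinuousAt.comp (f := fun t : ℝ => (σ : ℂ) + t * Complex.I) this hc1
    have := norm_integral_LSeries_mul_le ha hk T (2 * T) (M := C₃ * √T * (C₂ * (3 * T) ^ θ)) ?_
    · refine le_trans (le_of_eq ?_) this
      congr 1
      refine intervalIntegral.integral_congr fun t _ => ?_
      simp only [hH]
      rw [hF]
      ring
    · intro n
      have e : ∀ t : ℝ, Complex.exp (-(t * Real.log n) * Complex.I) *
          (Complex.exp (logGammaQuotient Q lam mu (σ + t * Complex.I)) *
            Complex.exp (-l * (σ + t * Complex.I))) =
          Complex.exp (-l * σ) * Complex.exp (logGammaQuotient Q lam mu (σ + t * Complex.I) -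
            t * (Real.log n + l : ℝ) * Complex.I) := fun t => by
        rw [← Complex.exp_add, ← Complex.exp_add, ← Complex.exp_add]
        congr 1
        push_cast
        ring
      simp_rw [e]
      rw [intervalIntegral.integral_const_mul, norm_mul]
      have g1 := hexpn σ (by simp; linarith)
      have g2 := hT (Real.log n + l)
      have g3 : ‖Complex.exp (logGammaQuotient Q lam mu (σ + (2 * T : ℝ) * Complex.I))‖ ≤
          C₂ * (3 * T) ^ θ := by
        refine (hC₂ (2 * T)).trans ?_
        rw [abs_of_pos (by linarith)]
        have : 1 + 2 * T ≤ 3 * T := by linarith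
        gcongr
      calc _ ≤ 1 * (C₃ * √T * (C₂ * (3 * T) ^ θ)) := by
            gcongr
            exact g2.trans (by gcongr)
        _ = _ := one_mul _
  -- On `Re s = 1 - σ` the functional equation replaces `H` by a constant times the conjugate of
  -- `F(σ+it) m^(it)`, whose integral is `a(m) m^(-σ) T + O(1)`.
  have hleft : ∀ T : ℝ, 1 ≤ T → ‖LSeries.term a σ m‖ * T - C₄ ≤
      Real.exp l * ‖∫ y : ℝ in T..(2 * T), H ((1 - σ : ℝ) + y * Complex.I)‖ := fun T hT => by
    have e : ∀ t : ℝ, H ((1 - σ : ℝ) + t * Complex.I) = (omega * Real.exp (-l * (1 - σ)) : ℂ) *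
        star (LSeries a (σ + t * Complex.I) * Complex.exp ((t * l) * Complex.I)) := fun t => by
      simp only [hH]
      rw [h.exp_logGammaQuotient_mul (by simp; linarith) (by simp; linarith)]
      have e1 : 1 - star (((1 - σ : ℝ) : ℂ) + t * Complex.I) = σ + t * Complex.I := by
        apply Complex.ext <;> simp
      have e2 : star (Complex.exp ((t * l) * Complex.I)) = Complex.exp (-(t * l) * Complex.I) := by
        rw [Complex.star_def, ← Complex.exp_conj]; congr 1; simp
      rw [e1, hF, star_mul', e2, mul_mul_mul_comm, Complex.ofReal_exp, mul_assoc, mul_assoc,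
        ← Complex.exp_add]
      congr 3
      push_cast
      ring
    simp_rw [e]
    rw [intervalIntegral.integral_const_mul, norm_mul, norm_mul, h.norm_omega, one_mul,
      Complex.norm_real, Real.norm_of_nonneg (Real.exp_pos _).le, ← mul_assoc, ← Real.exp_add]
    have e3 : ‖∫ y : ℝ in T..(2 * T), star (LSeries a (σ + y * Complex.I) *
        Complex.exp ((y * l) * Complex.I))‖ = ‖∫ y : ℝ in T..(2 * T), LSeries a (σ + y * Complex.I) *
        Complex.exp ((y * l) * Complex.I)‖ := by
      simp only [Complex.star_def]
      rw [intervalIntegral.intervalIntegral_conj, Complex.norm_conj]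
    rw [e3]
    have g1 := hC₄ T (2 * T)
    have g2 := norm_sub_norm_le (LSeries.term a σ m * (2 * T - T : ℝ))
      (∫ y : ℝ in T..(2 * T), LSeries a (σ + y * Complex.I) * Complex.exp ((y * l) * Complex.I))
    rw [norm_sub_rev] at g2
    rw [norm_mul, Complex.norm_real, Real.norm_of_nonneg (by linarith)] at g2
    have g3 : (1 : ℝ) ≤ Real.exp (l + -l * (1 - σ)) := Real.one_le_exp (by nlinarith)
    have g4 := le_mul_of_one_le_left (norm_nonneg (∫ y : ℝ in T..(2 * T),
      LSeries a (σ + y * Complex.I) * Complex.exp ((y * l) * Complex.I))) g3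
    linarith
  -- Cauchy's theorem on the rectangle: a positive multiple of `T` is at most `O(T^(1/2 + θ))`, and
  -- `θ < 1/2`.
  have hfinal : ∀ᶠ T : ℝ in atTop, ‖LSeries.term a σ m‖ * T ≤
      C₄ + Real.exp l * (|C₁| * (3 * T) ^ θ + |C₁| * (3 * (2 * T)) ^ θ +
        K * (C₃ * √T * (C₂ * (3 * T) ^ θ))) := by
    filter_upwards [hright, eventually_ge_atTop 1] with T h1 hT
    have h2 := hhor T hT
    have h3 := hhor (2 * T) (by linarith)
    have h4 := hleft T hT
    have e := hrect T (by linarith)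
    set I₁ := ∫ x : ℝ in (1 - σ)..σ, H (x + T * Complex.I)
    set I₂ := ∫ x : ℝ in (1 - σ)..σ, H (x + (2 * T : ℝ) * Complex.I)
    set I₃ := ∫ y : ℝ in T..(2 * T), H (σ + y * Complex.I)
    set I₄ := ∫ y : ℝ in T..(2 * T), H ((1 - σ : ℝ) + y * Complex.I)
    have h5 : ‖I₄‖ ≤ ‖I₁‖ + ‖I₂‖ + ‖I₃‖ := by
      have : Complex.I • I₄ = I₁ - I₂ + Complex.I • I₃ := by linear_combination -e
      calc ‖I₄‖ = ‖Complex.I • I₄‖ := by rw [norm_smul, Complex.norm_I, one_mul]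
        _ ≤ ‖I₁ - I₂‖ + ‖Complex.I • I₃‖ := by rw [this]; exact norm_add_le _ _
        _ ≤ _ := by
          rw [norm_smul, Complex.norm_I, one_mul]
          exact add_le_add_left (norm_sub_le _ _) _
    have h6 : ‖I₄‖ ≤ |C₁| * (3 * T) ^ θ + |C₁| * (3 * (2 * T)) ^ θ +
        K * (C₃ * √T * (C₂ * (3 * T) ^ θ)) := by linarith
    have h7 := mul_le_mul_of_nonneg_left h6 (Real.exp_pos l).le
    linarith
  have hterm : 0 < ‖LSeries.term a σ m‖ := by
    rw [norm_pos_iff, LSeries.term_of_ne_zero hm]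
    have : (m : ℂ) ≠ 0 := by exact_mod_cast hm
    exact div_ne_zero ham (by simp [Complex.cpow_eq_zero_iff, this])
  have hpow : ∀ c : ℝ, 0 < c → ∀ e : ℝ, e < 1 →
      Tendsto (fun T : ℝ => (c * T) ^ e / T) atTop (nhds 0) := fun c hc e he => by
    have h1 := (tendsto_rpow_neg_atTop (y := 1 - e) (by linarith)).const_mul (c ^ e)
    rw [mul_zero] at h1
    refine h1.congr' ?_
    filter_upwards [eventually_gt_atTop 0] with T hT
    rw [Real.mul_rpow hc.le hT.le, neg_sub, Real.rpow_sub_one hT.ne', mul_div_assoc]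
  have hlim : Tendsto (fun T : ℝ => (C₄ + Real.exp l * (|C₁| * (3 * T) ^ θ + |C₁| * (3 * (2 * T)) ^ θ +
        K * (C₃ * √T * (C₂ * (3 * T) ^ θ)))) / T) atTop (nhds 0) := by
    have l0 : Tendsto (fun T : ℝ => C₄ / T) atTop (nhds 0) := tendsto_const_nhds.div_atTop tendsto_id
    have l1 := hpow 3 (by norm_num) θ (by linarith)
    have l2 := hpow 6 (by norm_num) θ (by linarith)
    have l3 := hpow 1 one_pos (1 / 2 + θ) (by linarith)
    have := l0.add (((l1.const_mul |C₁|).add (l2.const_mul |C₁|)).add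
      (l3.const_mul (K * C₃ * C₂ * 3 ^ θ)) |>.const_mul (Real.exp l))
    simp only [mul_zero, add_zero] at this
    refine this.congr' ?_
    filter_upwards [eventually_gt_atTop 0] with T hT
    rw [one_mul, Real.rpow_add hT, ← Real.sqrt_eq_rpow, Real.mul_rpow (by norm_num) hT.le,
      Real.mul_rpow (by norm_num) hT.le, show 3 * (2 * T) = 6 * T by ring,
      Real.mul_rpow (by norm_num) hT.le]
    field_simp
  obtain ⟨T, h1, h2, h3⟩ := (hfinal.and ((hlim.eventually (gt_mem_nhds hterm)).and
    (eventually_gt_atTop 0))).exists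
  rw [div_lt_iff₀ h3] at h2
  linarith

end

/-! ### Lower bound for the abscissa in the extended Selberg class -/

/-- If all coefficients vanish, the identity theorem gives `G = 0`. A function supported at the
single point `1` is excluded by the requirement that `m` be the exact order of the pole. -/
theorem exists_coeff_ne_zero_of_inExtendedSelbergClass {F : ℂ → ℂ} (hF : InExtendedSelbergClass F)
    {a : ℕ → ℂ} (ha : ∀ s : ℂ, 1 < s.re → LSeriesSummable a s ∧ F s = LSeries a s) :
    ∃ m, m ≠ 0 ∧ a m ≠ 0 := by
  by_contra! hz
  obtain ⟨m, G, hG, -, hGF, hm⟩ := hF.continuation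
  have h0 : ∀ s : ℂ, 1 < s.re → F s = 0 := fun s hs => by
    rw [(ha s hs).2, LSeries_congr (g := 0) (fun {n} hn => hz n hn), LSeries_zero, Pi.zero_apply]
  have hG0 : G = 0 := by
    refine (AnalyticOnNhd.eq_of_eventuallyEq (𝕜 := ℂ) (fun z _ => hG.analyticAt z)
      (fun z _ => analyticAt_const) (z₀ := 2) ?_)
    have hopen : IsOpen {s : ℂ | 1 < s.re} := isOpen_lt continuous_const Complex.continuous_re
    filter_upwards [hopen.mem_nhds (show (1 : ℝ) < (2 : ℂ).re by norm_num)] with s hs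
    rw [← hGF s (Or.inl fun h => by simp [h] at hs), h0 s hs, mul_zero]
    rfl
  rcases hm with rfl | hm
  · refine hF.ne_zero (funext fun s => ?_)
    have := hGF s (Or.inr rfl)
    simpa [hG0] using this
  · exact hm (by simp [hG0])

/-- The abscissa of absolute convergence of a member of degree `d` is at least `1/2 + 1/(2d)`. -/
theorem InExtendedSelbergClass.le_of_LSeriesSummable {F : ℂ → ℂ} {d : ℝ}
    (hF : InExtendedSelbergClass F) (hd : HasDegree F d) (hd1 : 1 ≤ d) {a : ℕ → ℂ}
    (ha : ∀ s : ℂ, 1 < s.re → LSeriesSummable a s ∧ F s = LSeries a s) {σ : ℝ}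
    (hσ : LSeriesSummable a σ) : 1 / 2 + 1 / (2 * d) ≤ σ := by
  by_contra! hlt
  obtain ⟨r, Q, lam, mu, omega, hfe, hsum⟩ := hd
  obtain ⟨n, hn, han⟩ := exists_coeff_ne_zero_of_inExtendedSelbergClass hF ha
  obtain ⟨m, G, hG, ⟨A, hA⟩, hGF, hm⟩ := hF.continuation
  have hr : 0 < r := by
    rcases Nat.eq_zero_or_pos r with rfl | h
    · simp at hsum; linarith
    · exact h
  have hdpos : 0 < 1 / (2 * d) := by positivity
  -- The contour argument needs a line strictly between `1/2` and `1`; `d ≥ 1` keeps `τ` below `1`.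
  -- Taking `τ > σ` places the line inside the open half-plane where the series is analytic.
  obtain ⟨τ, hτ1, hτ2⟩ := exists_between (max_lt hlt (show 1 / 2 < 1 / 2 + 1 / (2 * d) by linarith))
  have hτσ : σ < τ := (le_max_left _ _).trans_lt hτ1
  have hτh : 1 / 2 < τ := (le_max_right _ _).trans_lt hτ1
  have hd2 : 1 / (2 * d) ≤ 1 / 2 := by
    rw [div_le_div_iff₀ (by positivity) (by norm_num)]; linarith
  have hτ1' : τ < 1 := by linarith
  have hab : LSeries.abscissaOfAbsConv a ≤ σ := by simpa using hσ.abscissaOfAbsConv_le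
  -- To the left of `1` the value of `F` is known only through `G`; the identity theorem recovers
  -- the Dirichlet series there.
  have hLG : Set.EqOn (fun s => (s - 1) ^ m * LSeries a s) G {s : ℂ | σ < s.re} := by
    have hL : AnalyticOnNhd ℂ (fun s => (s - 1) ^ m * LSeries a s) {s : ℂ | σ < s.re} := fun s hs => by
      refine (((analyticAt_id.sub analyticAt_const).pow m).mul
        (LSeries_analyticOnNhd a s ?_))
      exact hab.trans_lt (by exact_mod_cast hs)
    have hopen : IsOpen {s : ℂ | 1 < s.re} := isOpen_lt continuous_const Complex.continuous_re
    refine hL.eqOn_of_preconnected_of_eventuallyEq (fun z _ => hG.analyticAt z)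
      (convex_halfSpace_re_gt σ).isPreconnected (z₀ := 2) (by simp; linarith) ?_
    filter_upwards [hopen.mem_nhds (show (1 : ℝ) < (2 : ℂ).re by norm_num)] with s hs
    rw [← hGF s (Or.inl fun h => by simp [h] at hs), (ha s hs).2]
  have hquot : ∀ s : ℂ, s ≠ 1 → F s = G s / (s - 1) ^ m := fun s hs => by
    rw [← hGF s (Or.inl hs), mul_div_cancel_left₀ _ (pow_ne_zero _ (sub_ne_zero.2 hs))]
  have key := hfe.half_le_of_LSeriesSummable hr hτh hτ1' ?_ ⟨A, ?_⟩
    (hσ.of_re_le_re (s' := τ) (by simpa using hτσ.le)) ?_ hn han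
  · have h2 : (∑ j, lam j) * (2 * τ - 1) < 1 / 2 := by
      have h3 : ∑ j, lam j = d / 2 := by linarith
      have h4 : 2 * τ - 1 < 1 / d := by
        have : 1 / d = 2 * (1 / (2 * d)) := by field_simp
        linarith
      rw [h3]
      calc d / 2 * (2 * τ - 1) < d / 2 * (1 / d) := by gcongr
        _ = 1 / 2 := by field_simp
    linarith
  · intro s hs
    have h1 : ∀ w ∈ {s : ℂ | s.re < 1}, w ≠ 1 := by rintro w hw rfl; simp at hw
    refine DifferentiableWithinAt.congr (f := fun s => G s / (s - 1) ^ m) ?_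
      (fun w hw => hquot w (h1 w hw)) (hquot s (h1 s hs))
    have hpow : DifferentiableAt ℂ (fun s : ℂ => (s - 1) ^ m) s := by fun_prop
    have hne : (s - 1) ^ m ≠ 0 := pow_ne_zero _ (sub_ne_zero.2 (h1 s hs))
    exact DifferentiableAt.differentiableWithinAt (DifferentiableAt.fun_div (hG s) hpow hne)
  · refine IsBigO.trans (IsBigO.of_bound (((1 - τ) ^ m)⁻¹) ?_) (hA.mono inf_le_left)
    filter_upwards [mem_inf_of_right (mem_principal_self _)] with s hs
    have hs' : s.re ≤ τ := hs
    have h1 : s ≠ 1 := by rintro rfl; simp at hs'; linarith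
    rw [hquot s h1, norm_div, norm_pow, div_eq_inv_mul]
    have h2 : 1 - τ ≤ ‖s - 1‖ := by
      refine le_trans ?_ ((neg_le_abs _).trans (Complex.abs_re_le_norm _))
      simp only [Complex.sub_re, Complex.one_re]; linarith
    have : 0 < 1 - τ := by linarith
    gcongr
  · intro t
    have hre : ((τ : ℂ) + t * Complex.I).re = τ := by simp
    have h1 : (τ : ℂ) + t * Complex.I ≠ 1 := by
      intro e
      rw [e] at hre
      simp at hre
      linarith
    rw [hquot _ h1, ← hLG (show σ < _ by rw [hre]; exact hτσ)]
    exact mul_div_cancel_left₀ _ (pow_ne_zero _ (sub_ne_zero.2 h1))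

/-! ### Lifts of Dirichlet series -/

noncomputable section

/-- The Dirichlet coefficients of the `k`-lift of `∑ a(n) n^(-s)`. -/
def kLiftCoeff (k : ℕ) (a : ℕ → ℂ) : ℕ → ℂ :=
  Function.extend (fun j : ℕ => j ^ k) (fun j => a j * (j : ℂ) ^ (((k : ℂ) - 1) / 2)) 0

end

/-- The lifted series lives on the `k`-th powers `n = j^k`, where `n^(-s) j^((k-1)/2) = j^(-(ks +
(1-k)/2))`. Thus the two series have the same nonzero terms. -/
theorem LSeriesHasSum_kLiftCoeff {k : ℕ} (hk : 1 ≤ k) (a : ℕ → ℂ) (s v : ℂ) :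
    LSeriesHasSum (kLiftCoeff k a) s v ↔ LSeriesHasSum a ((k : ℂ) * s + (1 - (k : ℂ)) / 2) v := by
  have hk0 : k ≠ 0 := by omega
  have hinj : Function.Injective (fun j : ℕ => j ^ k) := Nat.pow_left_injective hk0
  unfold LSeriesHasSum
  rw [← hinj.hasSum_iff]
  · refine iff_of_eq (congrArg (fun f => HasSum f v) (funext fun j => ?_))
    rcases eq_or_ne j 0 with rfl | hj
    · simp [hk0]
    have hj' : (j : ℂ) ≠ 0 := by exact_mod_cast hj
    simp only [Function.comp_apply]
    rw [LSeries.term_of_ne_zero (pow_ne_zero _ hj), LSeries.term_of_ne_zero hj, kLiftCoeff,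
      hinj.extend_apply]
    have e1 : (((j ^ k : ℕ) : ℂ)) ^ s = (j : ℂ) ^ ((k : ℂ) * s) := by
      rw [Complex.cpow_def_of_ne_zero (by exact_mod_cast pow_ne_zero _ hj),
        Complex.cpow_def_of_ne_zero hj', ← Complex.natCast_log, ← Complex.natCast_log, Nat.cast_pow,
        Real.log_pow]
      push_cast
      congr 1; ring
    have e2 : (j : ℂ) ^ ((k : ℂ) * s + (1 - k) / 2) * (j : ℂ) ^ (((k : ℂ) - 1) / 2) =
        (j : ℂ) ^ ((k : ℂ) * s) := by
      rw [← Complex.cpow_add _ _ hj']; congr 1; ring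
    have n1 : (j : ℂ) ^ (((k : ℂ) - 1) / 2) ≠ 0 := by simp [Complex.cpow_eq_zero_iff, hj']
    rw [e1, ← e2, mul_div_mul_right _ _ n1]
  · intro n hn
    rw [LSeries.term_def, kLiftCoeff, Function.extend_apply' _ _ _ (by simpa using hn)]
    simp

theorem LSeriesSummable_kLiftCoeff {k : ℕ} (hk : 1 ≤ k) (a : ℕ → ℂ) (s : ℂ) :
    LSeriesSummable (kLiftCoeff k a) s ↔ LSeriesSummable a ((k : ℂ) * s + (1 - (k : ℂ)) / 2) :=
  ⟨fun h => ((LSeriesHasSum_kLiftCoeff hk a s _).1 h.LSeriesHasSum).LSeriesSummable,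
    fun h => ((LSeriesHasSum_kLiftCoeff hk a s _).2 h.LSeriesHasSum).LSeriesSummable⟩

theorem LSeries_kLiftCoeff {k : ℕ} (hk : 1 ≤ k) (a : ℕ → ℂ) {s : ℂ}
    (hs : LSeriesSummable a ((k : ℂ) * s + (1 - (k : ℂ)) / 2)) :
    LSeries (kLiftCoeff k a) s = LSeries a ((k : ℂ) * s + (1 - (k : ℂ)) / 2) :=
  ((LSeriesHasSum_kLiftCoeff hk a s _).2 hs.LSeriesHasSum).LSeries_eq

theorem re_kLift_arg (k : ℕ) (s : ℂ) :
    ((k : ℂ) * s + (1 - (k : ℂ)) / 2).re = k * s.re + (1 - k) / 2 := by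
  have h2 : ((1 - (k : ℂ)) / 2) = (((1 - (k : ℝ)) / 2 : ℝ) : ℂ) := by push_cast; rfl
  rw [h2, Complex.add_re, Complex.ofReal_re, ← Complex.ofReal_natCast, Complex.re_ofReal_mul]

theorem kLift_dirichlet {F : ℂ → ℂ} {k : ℕ} (hk : 1 ≤ k) {a : ℕ → ℂ}
    (ha : ∀ s : ℂ, 1 < s.re → LSeriesSummable a s ∧ F s = LSeries a s) {s : ℂ}
    (hs : 1 / 2 + 1 / (2 * (k : ℝ)) < s.re) :
    LSeriesSummable (kLiftCoeff k a) s ∧ kLift k F s = LSeries (kLiftCoeff k a) s := by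
  have hk' : (1 : ℝ) ≤ k := by exact_mod_cast hk
  have hre : 1 < ((k : ℂ) * s + (1 - (k : ℂ)) / 2).re := by
    rw [re_kLift_arg]
    have := mul_lt_mul_of_pos_left hs (by linarith : (0 : ℝ) < k)
    have e : (k : ℝ) * (1 / 2 + 1 / (2 * k)) = k / 2 + 1 / 2 := by field_simp
    linarith
  have := ha _ hre
  exact ⟨(LSeriesSummable_kLiftCoeff hk a s).2 this.1, by
    rw [kLift, this.2, LSeries_kLiftCoeff hk a this.1]⟩

/-- Under `σ ↦ kσ + (1-k)/2` the points `1/2 + 1/(2kd)` and `1/2 + 1/(2k)` go to `1/2 + 1/(2d)` and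
`1`. So the claims are the lower bound for `F` itself and the convergence of its series for `Re s >
1`. -/
theorem sigmaA_kLift_bounds {F : ℂ → ℂ} {d : ℝ} {k : ℕ} (hF : InExtendedSelbergClass F)
    (hd : HasDegree F d) (hd1 : 1 ≤ d) (hk : 1 ≤ k) :
    ((1 / 2 + 1 / (2 * (k : ℝ) * d) : ℝ) : EReal) ≤ sigmaA (kLift k F) ∧
      sigmaA (kLift k F) ≤ ((1 / 2 + 1 / (2 * (k : ℝ)) : ℝ) : EReal) := by
  obtain ⟨a, ha⟩ := hF.dirichlet
  have hk' : (0 : ℝ) < k := by exact_mod_cast hk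
  have hD : HasDirichletSeries (kLift k F) (kLiftCoeff k a) :=
    ⟨1 / 2 + 1 / (2 * (k : ℝ)), fun s hs => kLift_dirichlet hk ha hs⟩
  rw [sigmaA_eq_abscissaOfAbsConv hD]
  constructor
  · by_contra! hlt
    obtain ⟨x, hx1, hx2⟩ := EReal.lt_iff_exists_real_btwn.1 hlt
    have hs : LSeriesSummable (kLiftCoeff k a) (x : ℂ) :=
      LSeriesSummable_of_abscissaOfAbsConv_lt_re (by simpa using hx1)
    rw [LSeriesSummable_kLiftCoeff hk] at hs
    have e : (k : ℂ) * x + (1 - (k : ℂ)) / 2 = ((k * x + (1 - k) / 2 : ℝ) : ℂ) := by push_cast; rfl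
    rw [e] at hs
    have := hF.le_of_LSeriesSummable hd hd1 ha hs
    have hx3 : x < 1 / 2 + 1 / (2 * (k : ℝ) * d) := by exact_mod_cast hx2
    have h4 := mul_lt_mul_of_pos_left hx3 hk'
    have e2 : (k : ℝ) * (1 / 2 + 1 / (2 * k * d)) = k / 2 + 1 / (2 * d) := by field_simp
    linarith
  · exact LSeries.abscissaOfAbsConv_le_of_forall_lt_LSeriesSummable fun y hy =>
      (kLift_dirichlet hk ha (by simpa using hy)).1

/-! ### A partition of unity for finite-index subgroups of the modular group -/

section PartitionOfUnity

open MeasureTheory UpperHalfPlane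
open scoped MatrixGroups ENNReal

/-- The imaginary part attains a maximum on the orbit, so the orbit meets the fundamental domain
only in a compact truncation of it; proper discontinuity concludes. -/
theorem finite_setOf_smul_mem_fd (z : ℍ) : {g : SL(2, ℤ) | g • z ∈ ModularGroup.fd}.Finite := by
  obtain ⟨g₀, hg₀⟩ := ModularGroup.exists_max_im z
  have h := ProperlyDiscontinuousSMul.finite_disjoint_inter_image (Γ := 𝒮ℒ) (T := ℍ)
    (isCompact_singleton (x := z))
    (ModularGroup.isCompact_truncatedFundamentalDomain (g₀ • z).im)
  have hinj : Function.Injective (Matrix.SpecialLinearGroup.mapGL (n := Fin 2) (R := ℤ) ℝ) :=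
    Matrix.SpecialLinearGroup.mapGL_injective
  have hinj' : Function.Injective
      (Matrix.SpecialLinearGroup.mapGL (n := Fin 2) (R := ℤ) ℝ).rangeRestrict := fun a b hab =>
    hinj (congrArg Subtype.val hab)
  refine (h.preimage hinj'.injOn).subset fun g hg => ?_
  have hg' : g • z ∈ ModularGroup.truncatedFundamentalDomain (g₀ • z).im := ⟨hg, hg₀ g⟩
  have hne : (((Matrix.SpecialLinearGroup.mapGL ℝ).rangeRestrict g • ·) '' {z} ∩
      ModularGroup.truncatedFundamentalDomain (g₀ • z).im).Nonempty := ⟨g • z, ⟨z, rfl, rfl⟩, hg'⟩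
  exact hne

theorem volume_fd_lt_top : volume ModularGroup.fd < ∞ := by
  rw [volume_eq_lintegral]
  have hsub : (UpperHalfPlane.coe '' ModularGroup.fd) ⊆
      Complex.measurableEquivRealProd ⁻¹' (Set.Icc (-(1 / 2)) (1 / 2) ×ˢ Set.Ici (1 / 2)) := by
    rintro _ ⟨z, hz, rfl⟩
    have h1 := abs_le.1 hz.2
    have h2 := ModularGroup.three_le_four_mul_im_sq_of_mem_fd hz
    have h3 := z.im_pos
    refine Set.mem_prod.2 ⟨Set.mem_Icc.2 h1, ?_⟩
    change 1 / 2 ≤ z.im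
    nlinarith
  refine (lintegral_mono_set hsub).trans_lt ?_
  have hmp := Complex.volume_preserving_equiv_real_prod
  refine lt_of_eq_of_lt (hmp.setLIntegral_comp_preimage_emb
    Complex.measurableEquivRealProd.measurableEmbedding
    (fun p : ℝ × ℝ => (((1 / ‖p.2‖₊) ^ 2 : NNReal) : ℝ≥0∞)) _) ?_
  rw [Measure.volume_eq_prod, ← Measure.prod_restrict, lintegral_prod _ (by fun_prop)]
  simp only [lintegral_const]
  refine ENNReal.mul_lt_top ?_ (by simp)
  have hint : IntegrableOn (fun y : ℝ => y ^ (-2 : ℝ)) (Set.Ioi (1 / 4)) :=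
    integrableOn_Ioi_rpow_of_lt (by norm_num) (by norm_num)
  have := (hint.mono_set (Set.Ici_subset_Ioi.2 (show (1 / 4 : ℝ) < 1 / 2 by norm_num))).2
  refine lt_of_le_of_lt (setLIntegral_mono' measurableSet_Ici fun y hy => ?_) this
  have hy0 : (0 : ℝ) < y := lt_of_lt_of_le (by norm_num) hy
  rw [enorm_eq_nnnorm]
  refine ENNReal.coe_le_coe.2 (le_of_eq ?_)
  ext
  simp [Real.rpow_neg hy0.le]

instance countable_SL2Z : Countable SL(2, ℤ) :=
  have : Countable (Matrix (Fin 2) (Fin 2) ℤ) := inferInstanceAs (Countable (Fin 2 → Fin 2 → ℤ))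
  inferInstanceAs (Countable {A : Matrix (Fin 2) (Fin 2) ℤ // A.det = 1})

variable (Γ : Subgroup SL(2, ℤ)) [Γ.FiniteIndex]

/-- `W = φ / D`, where `D(z)` counts all `g` that move `z` into the standard domain and `φ(z)`
counts those among coset representatives. `D` is invariant and `∑ φ(γz) = D(z)` over `Γ`. Division
by `D` makes boundary identifications and `-1` harmless; `∫ W` is at most the index times the area
of the domain. -/
theorem exists_partition_of_unity : ∃ W : ℍ → ℝ, Measurable W ∧ (∀ z, 0 ≤ W z) ∧
    Integrable W ∧ ∀ z, HasSum (fun γ : Γ => W ((γ : SL(2, ℤ)) • z)) 1 := by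
  classical
  have := Fintype.ofFinite (SL(2, ℤ) ⧸ Γ)
  let χ : ℍ → ℝ≥0∞ := ModularGroup.fd.indicator 1
  have hfd : MeasurableSet (ModularGroup.fd) := ModularGroup.isClosed_fd.measurableSet
  have hsm : ∀ g : SL(2, ℤ), MeasurePreserving (fun z : ℍ => g • z) volume volume := fun g =>
    measurePreserving_smul (Matrix.SpecialLinearGroup.mapGL ℝ g) volume
  have hχ : Measurable χ := measurable_one.indicator hfd
  have hχ1 : ∀ z, χ z ≤ 1 := fun z =>
    Set.indicator_le_self' (f := (1 : ℍ → ℝ≥0∞)) (fun _ _ => zero_le_one) z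
  let D : ℍ → ℝ≥0∞ := fun z => ∑' g : SL(2, ℤ), χ (g • z)
  have hD : Measurable D := Measurable.tsum fun g => hχ.comp (hsm g).measurable
  have hDinv : ∀ (g : SL(2, ℤ)) z, D (g • z) = D z := fun g z => by
    simp only [D, ← mul_smul]
    exact (Equiv.mulRight g).tsum_eq (fun h => χ (h • z))
  have hD1 : ∀ z, 1 ≤ D z := fun z => by
    obtain ⟨g, hg⟩ := ModularGroup.exists_smul_mem_fd z
    refine le_trans (le_of_eq ?_) (ENNReal.le_tsum g)
    exact (Set.indicator_of_mem hg (1 : ℍ → ℝ≥0∞)).symm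
  have hDtop : ∀ z, D z ≠ ∞ := fun z => by
    have h0 : ∀ g ∉ (finite_setOf_smul_mem_fd z).toFinset, χ (g • z) = 0 := fun g hg => by
      simpa [χ] using hg
    simp only [D]
    rw [tsum_eq_sum h0]
    refine ENNReal.sum_ne_top.2 fun g _ => ?_
    exact ne_top_of_le_ne_top ENNReal.one_ne_top (hχ1 _)
  let φ : ℍ → ℝ≥0∞ := fun z => ∑ q : SL(2, ℤ) ⧸ Γ, χ (q.out • z)
  have hφ : Measurable φ := Finset.measurable_sum _ fun q _ => hχ.comp (hsm _).measurable
  -- Every element of the modular group is uniquely a chosen coset representative times an element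
  -- of `Γ`.
  have hφD : ∀ z, ∑' γ : Γ, φ ((γ : SL(2, ℤ)) • z) = D z := fun z => by
    simp only [φ, D, ← mul_smul, ← tsum_fintype (L := SummationFilter.unconditional _)]
    rw [ENNReal.tsum_comm, ← ENNReal.tsum_prod]
    refine (Equiv.ofBijective (fun p : (SL(2, ℤ) ⧸ Γ) × Γ => p.1.out * (p.2 : SL(2, ℤ)))
      ⟨fun p p' h => ?_, fun g => ?_⟩).tsum_eq (fun g => χ (g • z))
    · have h' : p.1.out * (p.2 : SL(2, ℤ)) = p'.1.out * (p'.2 : SL(2, ℤ)) := h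
      have h1 : p.1 = p'.1 := by
        have := congrArg (QuotientGroup.mk (s := Γ)) h'
        simpa using this
      refine Prod.ext h1 (Subtype.ext ?_)
      rw [h1] at h'
      exact mul_left_cancel h'
    · refine ⟨⟨g, ⟨(g : SL(2, ℤ) ⧸ Γ).out⁻¹ * g, ?_⟩⟩, by simp⟩
      exact QuotientGroup.eq.1 (by simp)
  have hW : ∀ z, ∑' γ : Γ, φ ((γ : SL(2, ℤ)) • z) / D ((γ : SL(2, ℤ)) • z) = 1 := fun z => by
    simp only [hDinv, div_eq_mul_inv]
    rw [ENNReal.tsum_mul_right, hφD, ENNReal.mul_inv_cancel (one_pos.trans_le (hD1 z)).ne' (hDtop z)]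
  have hle : ∀ z, φ z / D z ≤ 1 := fun z => by
    have := ENNReal.le_tsum (f := fun γ : Γ => φ ((γ : SL(2, ℤ)) • z) / D ((γ : SL(2, ℤ)) • z)) 1
    rw [hW] at this
    simpa using this
  have hint : ∫⁻ z, φ z / D z ≠ ∞ := by
    refine ne_top_of_le_ne_top ?_ (lintegral_mono (g := φ) fun z => ?_)
    · simp only [φ]
      rw [lintegral_finsetSum (μ := volume) (f := fun (q : SL(2, ℤ) ⧸ Γ) z => χ (q.out • z)) _
        fun q _ => hχ.comp (hsm _).measurable]
      refine ENNReal.sum_ne_top.2 fun q _ => ?_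
      rw [(hsm q.out).lintegral_comp hχ, lintegral_indicator_one hfd]
      exact volume_fd_lt_top.ne
    · exact ENNReal.div_le_of_le_mul (le_mul_of_one_le_right' (hD1 z))
  refine ⟨fun z => (φ z / D z).toReal, (hφ.div hD).ennreal_toReal, fun z => ENNReal.toReal_nonneg,
    integrable_toReal_of_lintegral_ne_top (hφ.div hD).aemeasurable hint, fun z => ?_⟩
  have h := ENNReal.hasSum_toReal (f := fun γ : Γ =>
    φ ((γ : SL(2, ℤ)) • z) / D ((γ : SL(2, ℤ)) • z)) (by rw [hW]; simp)
  rwa [← ENNReal.tsum_toReal_eq fun γ => ne_top_of_le_ne_top ENNReal.one_ne_top (hle _), hW,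
    ENNReal.toReal_one] at h

end PartitionOfUnity

/-! ### Left and right cosets of Hecke matrices -/

section HeckeCosets

open CongruenceSubgroup
open scoped MatrixGroups

/-- The triples `((a, d), b)` indexing the representatives `(a b; 0 d)` of the cosets of `Γ₀(N)`
in the integral matrices `(A B; C D)` of determinant `n` with `N ∣ C` and `(A, N) = 1`. -/
def heckeIndex (N n : ℕ) : Finset (Σ _ : ℕ × ℕ, ℕ) :=
  (n.divisorsAntidiagonal.filter fun p => p.1.Coprime N).sigma fun p => Finset.range p.2

theorem mem_heckeIndex {N n : ℕ} {i : Σ _ : ℕ × ℕ, ℕ} : i ∈ heckeIndex N n ↔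
    (i.1.1 * i.1.2 = n ∧ n ≠ 0) ∧ i.1.1.Coprime N ∧ i.2 < i.1.2 := by
  simp [heckeIndex, and_assoc]

/-- The matrix `(a b; 0 d)`. -/
def upperRep (i : Σ _ : ℕ × ℕ, ℕ) : Matrix (Fin 2) (Fin 2) ℤ := !![(i.1.1 : ℤ), i.2; 0, i.1.2]

/-- The matrix `(a 0; Nb d)`. -/
def lowerRep (N : ℕ) (i : Σ _ : ℕ × ℕ, ℕ) : Matrix (Fin 2) (Fin 2) ℤ :=
  !![(i.1.1 : ℤ), 0; N * i.2, i.1.2]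

/-- The entry `a` is the gcd of the first column; it divides the upper left entry and so is prime to
`N`. Hence the primitive column is still divisible by `N` below, and a Bézout relation completes it
to an element of `Γ₀(N)`. The remaining freedom reduces `b` modulo `d`. -/
theorem exists_eq_mul_upperRep {N n : ℕ} (hn : n ≠ 0) {M : Matrix (Fin 2) (Fin 2) ℤ}
    (hdet : M.det = n) (hN : (N : ℤ) ∣ M 1 0) (hcop : IsCoprime (M 0 0) N) :
    ∃ i ∈ heckeIndex N n, ∃ γ ∈ Gamma0 N, (γ : Matrix (Fin 2) (Fin 2) ℤ) * upperRep i = M := by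
  rw [Matrix.det_fin_two] at hdet
  have hg0 : 0 < Int.gcd (M 0 0) (M 1 0) := by
    rw [Int.gcd_pos_iff]
    by_contra! h
    simp [h] at hdet
    exact hn (by exact_mod_cast hdet.symm)
  obtain ⟨A, C, hAC, hA, hC⟩ := Int.exists_gcd_one hg0
  set g := Int.gcd (M 0 0) (M 1 0) with hg
  obtain ⟨u, v, huv⟩ := Int.isCoprime_iff_gcd_eq_one.2 hAC
  have hgN : IsCoprime (g : ℤ) N := by
    refine IsCoprime.of_isCoprime_of_dvd_left hcop ?_
    exact ⟨A, by rw [hA, mul_comm]⟩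
  have hNC : (N : ℤ) ∣ C := hgN.symm.dvd_of_dvd_mul_right (hC ▸ hN)
  have hd : (g : ℤ) * (A * M 1 1 - C * M 0 1) = n := by
    rw [← hdet, hA, hC]; ring
  have hg0' : (0 : ℤ) < g := by exact_mod_cast hg0
  have hn0 : (0 : ℤ) < n := by exact_mod_cast Nat.pos_of_ne_zero hn
  have hd0 : 0 < A * M 1 1 - C * M 0 1 := by
    rw [← hd] at hn0
    exact (pos_iff_pos_of_mul_pos hn0).1 hg0'
  obtain ⟨d, hdd⟩ := Int.eq_ofNat_of_zero_le hd0.le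
  have hd0' : (0 : ℤ) < d := hdd ▸ hd0
  set b₀ := u * M 0 1 + v * M 1 1 with hb₀
  obtain ⟨b, hb⟩ := Int.eq_ofNat_of_zero_le (Int.emod_nonneg b₀ hd0'.ne')
  have hbd : b < d := by
    have := Int.emod_lt_of_pos b₀ hd0'
    rw [hb] at this
    exact_mod_cast this
  set k := b₀ / d with hk
  have hb₀' : b₀ = b + d * k := by
    rw [← hb]; exact (Int.emod_add_mul_ediv b₀ d).symm
  have hγ : (!![A, -v + A * k; C, u + C * k] : Matrix (Fin 2) (Fin 2) ℤ).det = 1 := by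
    rw [Matrix.det_fin_two_of]
    linear_combination huv
  let γ : SL(2, ℤ) := ⟨_, hγ⟩
  refine ⟨⟨(g, d), b⟩, ?_, γ, ?_, ?_⟩
  · rw [mem_heckeIndex]
    refine ⟨⟨?_, hn⟩, Nat.isCoprime_iff_coprime.1 hgN, hbd⟩
    rw [hdd] at hd
    exact_mod_cast hd
  · rw [Gamma0_mem]
    exact (ZMod.intCast_zmod_eq_zero_iff_dvd _ _).2 hNC
  · change !![A, -v + A * k; C, u + C * k] * _ = M
    ext i j
    fin_cases i <;> fin_cases j <;> simp [upperRep, Matrix.mul_apply, Fin.sum_univ_two]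
    · exact hA.symm
    · linear_combination (-A) * hb₀' + A * hb₀ + M 0 1 * huv + v * hdd
    · exact hC.symm
    · linear_combination (-C) * hb₀' + C * hb₀ + M 1 1 * huv - u * hdd

/-- `γ'⁻¹ γ` is upper triangular with positive diagonal, hence unipotent, and `0 ≤ b, b' < d` makes
it trivial. -/
theorem eq_of_mul_upperRep_eq {N n : ℕ} {i i' : Σ _ : ℕ × ℕ, ℕ} (hi : i ∈ heckeIndex N n)
    (hi' : i' ∈ heckeIndex N n) {γ γ' : SL(2, ℤ)}
    (h : (γ : Matrix (Fin 2) (Fin 2) ℤ) * upperRep i = γ' * upperRep i') : i = i' ∧ γ = γ' := by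
  obtain ⟨⟨a, d⟩, b⟩ := i
  obtain ⟨⟨a', d'⟩, b'⟩ := i'
  rw [mem_heckeIndex] at hi hi'
  obtain ⟨⟨had, hn⟩, -, hb⟩ := hi
  obtain ⟨⟨had', -⟩, -, hb'⟩ := hi'
  dsimp only at had hb had' hb'
  have ha0 : (0 : ℤ) < a := by
    rcases Nat.eq_zero_or_pos a with h | h
    · simp [h] at had; omega
    · exact_mod_cast h
  have ha0' : (0 : ℤ) < a' := by
    rcases Nat.eq_zero_or_pos a' with h | h
    · simp [h] at had'; omega
    · exact_mod_cast h
  have hη : ((γ'⁻¹ * γ : SL(2, ℤ)) : Matrix (Fin 2) (Fin 2) ℤ) * upperRep ⟨(a, d), b⟩ =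
      upperRep ⟨(a', d'), b'⟩ := by
    rw [Matrix.SpecialLinearGroup.coe_mul, mul_assoc, h, ← mul_assoc,
      ← Matrix.SpecialLinearGroup.coe_mul]
    simp
  have hdet := (γ'⁻¹ * γ).det_coe
  suffices hs : γ'⁻¹ * γ = 1 ∧ (⟨(a, d), b⟩ : Σ _ : ℕ × ℕ, ℕ) = ⟨(a', d'), b'⟩ from
    ⟨hs.2, (inv_mul_eq_one.1 hs.1).symm⟩
  set η := γ'⁻¹ * γ
  rw [Matrix.det_fin_two] at hdet
  have e00 := congrFun (congrFun hη 0) 0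
  have e01 := congrFun (congrFun hη 0) 1
  have e10 := congrFun (congrFun hη 1) 0
  have e11 := congrFun (congrFun hη 1) 1
  simp only [upperRep, Matrix.mul_apply, Fin.sum_univ_two, Matrix.of_apply, Matrix.cons_val',
    Matrix.cons_val_zero, Matrix.cons_val_one, Matrix.cons_val_fin_one, mul_zero, add_zero]
    at e00 e01 e10 e11
  have h10 : η 1 0 = 0 := by
    rcases mul_eq_zero.1 e10 with h | h
    · exact h
    · omega
  rw [h10, mul_zero, sub_zero] at hdet
  have h00 : η 0 0 = 1 := by
    have hpos : 0 < η 0 0 := by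
      rw [← e00] at ha0'
      exact (pos_iff_pos_of_mul_pos ha0').2 ha0
    rcases Int.eq_one_or_neg_one_of_mul_eq_one hdet with h | h
    · exact h
    · omega
  have h11 : η 1 1 = 1 := by rwa [h00, one_mul] at hdet
  rw [h10, h11, zero_mul, zero_add, one_mul] at e11
  rw [h00, one_mul] at e00 e01
  have hd : d = d' := by exact_mod_cast e11
  have ha : a = a' := by exact_mod_cast e00
  subst hd ha
  have h01 : η 0 1 = 0 := by
    have h1 : η 0 1 * d = b' - b := by linarith
    have h2 : |η 0 1 * d| < d := by
      rw [h1, abs_lt]; constructor <;> omega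
    rw [abs_mul, Nat.abs_cast] at h2
    have h3 : |η 0 1| < 1 := by nlinarith
    exact Int.abs_lt_one_iff.1 h3
  have hbb : b = b' := by rw [h01, zero_mul, add_zero] at e01; exact_mod_cast e01
  subst hbb
  refine ⟨?_, rfl⟩
  ext i j
  fin_cases i <;> fin_cases j <;> simp [h00, h01, h10, h11]

/-- The anti-involution `(A B; C D) ↦ (A C/N; NB D)` of the matrices with `N ∣ C`. -/
def levelTranspose (N : ℕ) (M : Matrix (Fin 2) (Fin 2) ℤ) : Matrix (Fin 2) (Fin 2) ℤ :=
  !![M 0 0, M 1 0 / N; N * M 0 1, M 1 1]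

variable {N : ℕ} [NeZero N]

theorem levelTranspose_mul {M M' : Matrix (Fin 2) (Fin 2) ℤ} (h : (N : ℤ) ∣ M 1 0)
    (h' : (N : ℤ) ∣ M' 1 0) :
    levelTranspose N (M * M') = levelTranspose N M' * levelTranspose N M := by
  obtain ⟨c, hc⟩ := h
  obtain ⟨c', hc'⟩ := h'
  have hN : (N : ℤ) ≠ 0 := by exact_mod_cast NeZero.ne N
  have e1 : M 1 0 / (N : ℤ) = c := by rw [hc, Int.mul_ediv_cancel_left _ hN]
  have e2 : M' 1 0 / (N : ℤ) = c' := by rw [hc', Int.mul_ediv_cancel_left _ hN]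
  have e3 : (M * M') 1 0 / (N : ℤ) = c * M' 0 0 + M 1 1 * c' := by
    rw [Matrix.mul_apply, Fin.sum_univ_two, hc, hc',
      show (N : ℤ) * c * M' 0 0 + M 1 1 * (N * c') = N * (c * M' 0 0 + M 1 1 * c') by ring,
      Int.mul_ediv_cancel_left _ hN]
  simp only [levelTranspose, e1, e2, e3]
  ext i j
  fin_cases i <;> fin_cases j <;>
    simp [Matrix.mul_apply, Fin.sum_univ_two, hc, hc'] <;> ring

theorem dvd_levelTranspose (M : Matrix (Fin 2) (Fin 2) ℤ) :
    (N : ℤ) ∣ levelTranspose N M 1 0 := by simp [levelTranspose]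

theorem levelTranspose_levelTranspose {M : Matrix (Fin 2) (Fin 2) ℤ} (h : (N : ℤ) ∣ M 1 0) :
    levelTranspose N (levelTranspose N M) = M := by
  have hN : (N : ℤ) ≠ 0 := by exact_mod_cast NeZero.ne N
  ext i j
  fin_cases i <;> fin_cases j <;>
    simp [levelTranspose, Int.mul_ediv_cancel_left _ hN, Int.mul_ediv_cancel' h]

theorem det_levelTranspose {M : Matrix (Fin 2) (Fin 2) ℤ} (h : (N : ℤ) ∣ M 1 0) :
    (levelTranspose N M).det = M.det := by
  rw [levelTranspose, Matrix.det_fin_two_of, Matrix.det_fin_two]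
  linear_combination (-M 0 1) * Int.ediv_mul_cancel h

theorem levelTranspose_upperRep (i : Σ _ : ℕ × ℕ, ℕ) :
    levelTranspose N (upperRep i) = lowerRep N i := by
  simp [levelTranspose, upperRep, lowerRep]

theorem dvd_of_mem_Gamma0 {γ : SL(2, ℤ)} (h : γ ∈ Gamma0 N) : (N : ℤ) ∣ γ 1 0 :=
  (ZMod.intCast_zmod_eq_zero_iff_dvd _ _).1 (Gamma0_mem.1 h)

theorem dvd_upperRep (i : Σ _ : ℕ × ℕ, ℕ) : (N : ℤ) ∣ upperRep i 1 0 := by simp [upperRep]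

theorem dvd_lowerRep (i : Σ _ : ℕ × ℕ, ℕ) : (N : ℤ) ∣ lowerRep N i 1 0 := by simp [lowerRep]

theorem exists_levelTranspose {γ : SL(2, ℤ)} (h : γ ∈ Gamma0 N) :
    ∃ γ' ∈ Gamma0 N, (γ' : Matrix (Fin 2) (Fin 2) ℤ) = levelTranspose N γ := by
  refine ⟨⟨levelTranspose N γ, by rw [det_levelTranspose (dvd_of_mem_Gamma0 h), γ.det_coe]⟩, ?_,
    rfl⟩
  exact Gamma0_mem.2 ((ZMod.intCast_zmod_eq_zero_iff_dvd _ _).2 (dvd_levelTranspose _))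

/-- The anti-involution `levelTranspose` preserves `Γ₀(N)` and the set of Hecke matrices, reverses
products and exchanges `upperRep` with `lowerRep`. It transports the left coset decomposition to a
right one. -/
theorem exists_eq_lowerRep_mul {n : ℕ} (hn : n ≠ 0) {M : Matrix (Fin 2) (Fin 2) ℤ}
    (hdet : M.det = n) (hN : (N : ℤ) ∣ M 1 0) (hcop : IsCoprime (M 0 0) N) :
    ∃ i ∈ heckeIndex N n, ∃ γ ∈ Gamma0 N, lowerRep N i * (γ : Matrix (Fin 2) (Fin 2) ℤ) = M := by
  obtain ⟨i, hi, γ, hγ, h⟩ := exists_eq_mul_upperRep hn (M := levelTranspose N M) (N := N)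
    (by rw [det_levelTranspose hN, hdet]) (dvd_levelTranspose M) (by simpa [levelTranspose])
  obtain ⟨γ', hγ', e⟩ := exists_levelTranspose hγ
  refine ⟨i, hi, γ', hγ', ?_⟩
  rw [e, ← levelTranspose_upperRep, ← levelTranspose_mul (dvd_of_mem_Gamma0 hγ) (dvd_upperRep i),
    h, levelTranspose_levelTranspose hN]

theorem eq_of_lowerRep_mul_eq {n : ℕ} {i i' : Σ _ : ℕ × ℕ, ℕ} (hi : i ∈ heckeIndex N n)
    (hi' : i' ∈ heckeIndex N n) {γ γ' : SL(2, ℤ)} (hγ : γ ∈ Gamma0 N) (hγ' : γ' ∈ Gamma0 N)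
    (h : lowerRep N i * (γ : Matrix (Fin 2) (Fin 2) ℤ) = lowerRep N i' * γ') :
    i = i' ∧ γ = γ' := by
  obtain ⟨δ, hδ, e⟩ := exists_levelTranspose hγ
  obtain ⟨δ', hδ', e'⟩ := exists_levelTranspose hγ'
  have h' := congrArg (levelTranspose N) h
  rw [levelTranspose_mul (dvd_lowerRep i) (dvd_of_mem_Gamma0 hγ),
    levelTranspose_mul (dvd_lowerRep i') (dvd_of_mem_Gamma0 hγ'), ← levelTranspose_upperRep,
    ← levelTranspose_upperRep, levelTranspose_levelTranspose (dvd_upperRep i),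
    levelTranspose_levelTranspose (dvd_upperRep i'), ← e, ← e'] at h'
  obtain ⟨h1, h2⟩ := eq_of_mul_upperRep_eq hi hi' h'
  refine ⟨h1, Subtype.ext ?_⟩
  rw [← levelTranspose_levelTranspose (dvd_of_mem_Gamma0 hγ),
    ← levelTranspose_levelTranspose (dvd_of_mem_Gamma0 hγ'), ← e, ← e', h2]

/-- Left and right cosets of `Γ₀(N)` in the matrices of determinant `n`, matched. -/
theorem exists_heckeIndex_equiv (N : ℕ) [NeZero N] (n : ℕ) :
    ∃ e : heckeIndex N n × Gamma0 N ≃ heckeIndex N n × Gamma0 N, ∀ p,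
      ((p.2 : SL(2, ℤ)) : Matrix (Fin 2) (Fin 2) ℤ) * upperRep p.1 =
        lowerRep N (e p).1 * ((e p).2 : SL(2, ℤ)) := by
  have hn : ∀ i ∈ heckeIndex N n, n ≠ 0 := fun i hi => (mem_heckeIndex.1 hi).1.2
  have key : ∀ M : Matrix (Fin 2) (Fin 2) ℤ,
      -- Both product sets equal the set of integral matrices of determinant `n` with lower left
      -- entry divisible by `N` and upper left entry prime to `N`; comparing the unique
      -- factorizations gives the bijection.
      (∃ p : heckeIndex N n × Gamma0 N,
        ((p.2 : SL(2, ℤ)) : Matrix (Fin 2) (Fin 2) ℤ) * upperRep p.1 = M) ↔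
      (∃ p : heckeIndex N n × Gamma0 N,
        lowerRep N p.1 * ((p.2 : SL(2, ℤ)) : Matrix (Fin 2) (Fin 2) ℤ) = M) := by
    have hcop : ∀ {γ : SL(2, ℤ)}, γ ∈ Gamma0 N → IsCoprime (γ 0 0) (N : ℤ) := fun {γ} hγ => by
      obtain ⟨c, hc⟩ := dvd_of_mem_Gamma0 hγ
      have hdet := γ.det_coe
      rw [Matrix.det_fin_two, hc] at hdet
      exact ⟨γ 1 1, -(γ 0 1 * c), by linear_combination hdet⟩
    intro M
    constructor
    · rintro ⟨⟨⟨i, hi⟩, ⟨γ, hγ⟩⟩, rfl⟩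
      obtain ⟨⟨h1, h2⟩, h3, -⟩ := mem_heckeIndex.1 hi
      obtain ⟨j, hj, γ', hγ', h⟩ := exists_eq_lowerRep_mul (N := N) h2
        (M := (γ : Matrix (Fin 2) (Fin 2) ℤ) * upperRep i)
        (by rw [Matrix.det_mul, γ.det_coe, ← h1]; simp [upperRep])
        (by simpa [upperRep, Matrix.mul_apply] using (dvd_of_mem_Gamma0 hγ).mul_right _)
        (by simpa [upperRep, Matrix.mul_apply] using
          (hcop hγ).mul_left (Nat.isCoprime_iff_coprime.2 h3))
      exact ⟨⟨⟨j, hj⟩, ⟨γ', hγ'⟩⟩, h⟩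
    · rintro ⟨⟨⟨i, hi⟩, ⟨γ, hγ⟩⟩, rfl⟩
      obtain ⟨⟨h1, h2⟩, h3, -⟩ := mem_heckeIndex.1 hi
      obtain ⟨j, hj, γ', hγ', h⟩ := exists_eq_mul_upperRep (N := N) h2
        (M := lowerRep N i * (γ : Matrix (Fin 2) (Fin 2) ℤ))
        (by rw [Matrix.det_mul, γ.det_coe, ← h1]; simp [lowerRep])
        (by
          have h4 := (dvd_of_mem_Gamma0 hγ).mul_left (i.1.2 : ℤ)
          simpa [lowerRep, Matrix.mul_apply, Fin.sum_univ_two, mul_assoc] using h4)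
        (by simpa [lowerRep, Matrix.mul_apply, Fin.sum_univ_two] using
          (Nat.isCoprime_iff_coprime.2 h3).mul_left (hcop hγ))
      exact ⟨⟨⟨j, hj⟩, ⟨γ', hγ'⟩⟩, h⟩
  let L : heckeIndex N n × Gamma0 N → Matrix (Fin 2) (Fin 2) ℤ := fun p =>
    ((p.2 : SL(2, ℤ)) : Matrix (Fin 2) (Fin 2) ℤ) * upperRep p.1
  let R : heckeIndex N n × Gamma0 N → Matrix (Fin 2) (Fin 2) ℤ := fun p =>
    lowerRep N p.1 * ((p.2 : SL(2, ℤ)) : Matrix (Fin 2) (Fin 2) ℤ)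
  have hL : Function.Injective L := fun p q h => by
    obtain ⟨h1, h2⟩ := eq_of_mul_upperRep_eq p.1.2 q.1.2 h
    exact Prod.ext (Subtype.ext h1) (Subtype.ext h2)
  have hR : Function.Injective R := fun p q h => by
    obtain ⟨h1, h2⟩ := eq_of_lowerRep_mul_eq p.1.2 q.1.2 p.2.2 q.2.2 h
    exact Prod.ext (Subtype.ext h1) (Subtype.ext h2)
  have hLR : Set.range L = Set.range R := Set.ext key
  refine ⟨((Equiv.ofInjective L hL).trans (Equiv.setCongr hLR)).trans
    (Equiv.ofInjective R hR).symm, fun p => ?_⟩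
  exact (Equiv.apply_ofInjective_symm hR ⟨L p, hLR ▸ ⟨p, rfl⟩⟩).symm

end HeckeCosets

/-! ### Unfolding integrals with a partition of unity -/

section Unfolding

open MeasureTheory

theorem hasSum_prod_of_finite {ι G : Type*} [Fintype ι] {f : ι × G → ℂ} {a : ι → ℂ}
    (h : ∀ i, HasSum (fun g => f (i, g)) (a i)) : HasSum f (∑ i, a i) := by
  classical
  have h1 : ∀ i, HasSum (fun p : ι × G => if p.1 = i then f p else 0) (a i) := fun i => by
    have hinj : Function.Injective (fun g : G => (i, g)) := fun a b h => congrArg Prod.snd h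
    rw [← hinj.hasSum_iff]
    · simpa [Function.comp_def] using h i
    · rintro ⟨j, g⟩ hj
      rw [if_neg]
      rintro rfl
      exact hj ⟨g, rfl⟩
  simpa using hasSum_sum (s := Finset.univ) fun i _ => h1 i

variable {X H G : Type*} [MeasurableSpace X] {μ : Measure X} [Group H] [MulAction H X]
  [MeasurableConstSMul H X] [SMulInvariantMeasure H X μ] [Group G] [Countable G] {ρ : G →* H}
  {W : X → ℝ}

/-- Insertion of `1 = ∑ W(g β x)` under the integral. The interchange is justified by nonnegativity
of `W`, its integrability and the bound on `h`. -/
theorem hasSum_integral_mul_smul (hW : Measurable W) (hW0 : ∀ x, 0 ≤ W x) (hWi : Integrable W μ)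
    (hW1 : ∀ x, HasSum (fun g => W (ρ g • x)) 1) (β : H) {h : X → ℂ} (hh : Measurable h) {C : ℝ}
    (hC : ∀ x, ‖h x‖ ≤ C) :
    HasSum (fun g => ∫ x, (W x * W (ρ g • β • x) : ℝ) * h x ∂μ) (∫ x, (W x : ℂ) * h x ∂μ) := by
  have hmeas : ∀ g, Measurable fun x => W (ρ g • β • x) := fun g =>
    hW.comp ((measurable_const_smul (ρ g)).comp (measurable_const_smul β))
  have hle : ∀ (s : Finset G) x, ∑ g ∈ s, W (ρ g • β • x) ≤ 1 := fun s x =>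
    sum_le_hasSum s (fun g _ => hW0 _) (hW1 (β • x))
  have hle1 : ∀ g x, W (ρ g • β • x) ≤ 1 := fun g x => by simpa using hle {g} x
  have hn : ∀ g x, ‖((W x * W (ρ g • β • x) : ℝ) : ℂ) * h x‖ =
      W x * W (ρ g • β • x) * ‖h x‖ := fun g x => by
    rw [norm_mul, Complex.norm_real, Real.norm_of_nonneg (mul_nonneg (hW0 _) (hW0 _))]
  have hint : ∀ g, Integrable (fun x => ((W x * W (ρ g • β • x) : ℝ) : ℂ) * h x) μ := fun g => by
    refine Integrable.mono' (hWi.mul_const C)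
      ((Complex.measurable_ofReal.comp (hW.mul (hmeas g))).mul hh).aestronglyMeasurable
      (ae_of_all _ fun x => ?_)
    rw [hn]
    exact mul_le_mul (mul_le_of_le_one_right (hW0 x) (hle1 g x)) (hC x) (norm_nonneg _) (hW0 x)
  have hsum : Summable fun g => ∫ x, ‖((W x * W (ρ g • β • x) : ℝ) : ℂ) * h x‖ ∂μ := by
    refine summable_of_sum_le (c := ∫ x, W x * C ∂μ)
      (fun g => integral_nonneg fun x => norm_nonneg _) fun s => ?_
    rw [← integral_finsetSum _ fun g _ => (hint g).norm]
    refine integral_mono (integrable_finsetSum _ fun g _ => (hint g).norm) (hWi.mul_const C)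
      fun x => ?_
    simp only [hn]
    rw [← Finset.sum_mul, ← Finset.mul_sum]
    exact mul_le_mul (mul_le_of_le_one_right (hW0 x) (hle s x)) (hC x) (norm_nonneg _) (hW0 x)
  have := hasSum_integral_of_summable_integral_norm hint hsum
  convert! this using 2
  funext x
  have h1 : HasSum (fun g => ((W x * W (ρ g • β • x) : ℝ) : ℂ) * h x) ((W x * 1 : ℝ) * h x) :=
    (Complex.hasSum_ofReal.2 ((hW1 (β • x)).mul_left (W x))).mul_right (h x)
  rw [h1.tsum_eq, mul_one]

/-- Each side becomes a double sum of integrals against a product of two weights. Substituting `x ↦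
δ g x` on the right gives weights `W(x) W(δ g x)`, which match `W(x) W(g α x)` under the bijection
of cosets. No fundamental domain has to be moved. -/
theorem integral_mul_sum_eq_of_coset_equiv {ι : Type*} [Fintype ι] (hW : Measurable W)
    (hW0 : ∀ x, 0 ≤ W x) (hWi : Integrable W μ) (hW1 : ∀ x, HasSum (fun g => W (ρ g • x)) 1)
    {α δ : ι → H} (e : ι × G ≃ ι × G) (he : ∀ q, ρ q.2 * α q.1 = δ (e q).1 * ρ (e q).2)
    {p p' : ι → X → ℂ} (hp : ∀ i, Measurable (p i)) (hp' : ∀ i, Measurable (p' i)) {C : ℝ}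
    (hC : ∀ i x, ‖p i x‖ ≤ C) (hC' : ∀ i x, ‖p' i x‖ ≤ C)
    (hpp' : ∀ q x, p q.1 x = p' (e q).1 (ρ (e q).2 • x)) :
    ∑ i, ∫ x, (W x : ℂ) * p i x ∂μ = ∑ i, ∫ x, (W x : ℂ) * p' i ((δ i)⁻¹ • x) ∂μ := by
  have h1 : HasSum (fun q : ι × G =>
      ∫ x, ((W x * W (ρ q.2 • α q.1 • x) : ℝ) : ℂ) * p q.1 x ∂μ)
      (∑ i, ∫ x, (W x : ℂ) * p i x ∂μ) :=
    hasSum_prod_of_finite fun i => hasSum_integral_mul_smul hW hW0 hWi hW1 (α i) (hp i) (hC i)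
  have h2 : HasSum (fun q : ι × G =>
      ∫ x, ((W x * W (δ q.1 • ρ q.2 • x) : ℝ) : ℂ) * p' q.1 (ρ q.2 • x) ∂μ)
      (∑ i, ∫ x, (W x : ℂ) * p' i ((δ i)⁻¹ • x) ∂μ) := by
    refine hasSum_prod_of_finite fun i => ?_
    have h3 := hasSum_integral_mul_smul hW hW0 hWi hW1 (δ i)⁻¹
      ((hp' i).comp (measurable_const_smul (δ i)⁻¹)) (fun x => hC' i _)
    rw [← (Equiv.inv G).hasSum_iff] at h3
    refine h3.congr_fun fun g => ?_
    refine Eq.trans ?_ (integral_smul_eq_self (μ := μ) (g := δ i * ρ g) _)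
    refine integral_congr_ae (ae_of_all _ fun x => ?_)
    simp only [Equiv.inv_apply, Function.comp_apply, map_inv, mul_smul, inv_smul_smul]
    rw [mul_comm (W x)]
  refine h1.unique ?_
  rw [← e.hasSum_iff] at h2
  refine h2.congr_fun fun q => ?_
  refine integral_congr_ae (ae_of_all _ fun x => ?_)
  change _ = ((W x * W (δ (e q).1 • ρ (e q).2 • x) : ℝ) : ℂ) * p' (e q).1 (ρ (e q).2 • x)
  rw [← hpp', ← mul_smul, ← he, mul_smul]

end Unfolding

/-! ### Petersson products and the adjoint of a Hecke operator -/

section PeterssonAdjoint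

open MeasureTheory UpperHalfPlane CongruenceSubgroup ModularForm
open scoped MatrixGroups ModularForm ComplexConjugate

noncomputable section

/-- An integral matrix with nonzero determinant, as an element of `GL(2, ℝ)`. -/
def intGL (M : Matrix (Fin 2) (Fin 2) ℤ) (h : M.det ≠ 0) : GL (Fin 2) ℝ :=
  Matrix.GeneralLinearGroup.mkOfDetNeZero (M.map (Int.cast : ℤ → ℝ)) (by
    have : (M.map (Int.cast : ℤ → ℝ)).det = (M.det : ℝ) := (Int.cast_det M).symm
    rw [this]
    exact_mod_cast h)

end

theorem intGL_apply (M : Matrix (Fin 2) (Fin 2) ℤ) (h : M.det ≠ 0) (i j : Fin 2) :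
    intGL M h i j = (M i j : ℝ) := rfl

theorem det_intGL (M : Matrix (Fin 2) (Fin 2) ℤ) (h : M.det ≠ 0) :
    (intGL M h).det.val = (M.det : ℝ) := (Int.cast_det M).symm

theorem det_upperRep (i : Σ _ : ℕ × ℕ, ℕ) : (upperRep i).det = (i.1.1 : ℤ) * i.1.2 := by
  simp [upperRep]

theorem det_lowerRep (N : ℕ) (i : Σ _ : ℕ × ℕ, ℕ) : (lowerRep N i).det = (i.1.1 : ℤ) * i.1.2 := by
  simp [lowerRep]

theorem mul_ne_zero_of_mem_heckeIndex {N n : ℕ} {i : Σ _ : ℕ × ℕ, ℕ} (hi : i ∈ heckeIndex N n) :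
    (i.1.1 : ℤ) * i.1.2 ≠ 0 := by
  obtain ⟨⟨h1, h2⟩, -⟩ := mem_heckeIndex.1 hi
  rw [← h1] at h2
  exact_mod_cast h2

noncomputable section

/-- The matrix `(a b; 0 d)` in `GL(2, ℝ)`. -/
def upperGL {N n : ℕ} (i : heckeIndex N n) : GL (Fin 2) ℝ :=
  intGL (upperRep i) (by rw [det_upperRep]; exact mul_ne_zero_of_mem_heckeIndex i.2)

/-- The matrix `(a 0; Nb d)` in `GL(2, ℝ)`. -/
def lowerGL {N n : ℕ} (i : heckeIndex N n) : GL (Fin 2) ℝ :=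
  intGL (lowerRep N i) (by rw [det_lowerRep]; exact mul_ne_zero_of_mem_heckeIndex i.2)

end

theorem det_upperGL {N n : ℕ} (i : heckeIndex N n) : (upperGL i).det.val = n := by
  rw [upperGL, det_intGL, det_upperRep]
  exact_mod_cast (mem_heckeIndex.1 i.2).1.1

theorem det_lowerGL {N n : ℕ} (i : heckeIndex N n) : (lowerGL i).det.val = n := by
  rw [lowerGL, det_intGL, det_lowerRep]
  exact_mod_cast (mem_heckeIndex.1 i.2).1.1

/-- The pointwise form of Cauchy–Schwarz is an equality; it bounds mixed Petersson products by
diagonal ones. -/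
theorem norm_petersson_sq (k : ℤ) (f h : ℍ → ℂ) (z : ℍ) :
    ‖petersson k f h z‖ ^ 2 = ‖petersson k f f z‖ * ‖petersson k h h z‖ := by
  simp only [petersson, norm_mul, Complex.norm_conj]
  ring

variable {K : ℤ} {f : ℍ → ℂ}

theorem continuous_slash (hf : Continuous f) (g : GL (Fin 2) ℝ) : Continuous (f ∣[K] g) := by
  rw [slash_def]
  have h1 : Continuous fun z : ℍ => f (g • z) := hf.comp (continuous_const_smul g)
  have h2 : Continuous fun z : ℍ => σ g (f (g • z)) := by
    unfold σ
    split_ifs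
    · exact h1
    · exact Complex.continuous_conj.comp h1
  refine (h2.mul continuous_const).mul ?_
  exact (contMDiff_denom_zpow (n := 1) g (-K)).continuous

theorem exists_norm_petersson_slash_le {C : ℝ} (hC : ∀ z, ‖petersson K f f z‖ ≤ C) (D : ℝ) :
    ∃ B, ∀ g : GL (Fin 2) ℝ, |g.det.val| = D → ∀ z, ‖petersson K f (f ∣[K] g) z‖ ≤ B := by
  have hC0 : 0 ≤ C := (norm_nonneg _).trans (hC UpperHalfPlane.I)
  -- From `x² ≤ B` follows `x ≤ B + 1`; the summand `1` avoids a square root.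
  refine ⟨C * (|D| ^ (K - 2) * C) + 1, fun g hg z => ?_⟩
  have h1 : ‖petersson K (f ∣[K] g) (f ∣[K] g) z‖ ≤ |D| ^ (K - 2) * C := by
    rw [petersson_slash, norm_mul, hg, norm_σ, norm_zpow, Complex.norm_real, Real.norm_eq_abs]
    gcongr
    exact hC _
  have h2 : ‖petersson K f (f ∣[K] g) z‖ ^ 2 ≤ C * (|D| ^ (K - 2) * C) := by
    rw [norm_petersson_sq]
    exact mul_le_mul (hC z) h1 (norm_nonneg _) hC0
  nlinarith [sq_nonneg (‖petersson K f (f ∣[K] g) z‖ - 1)]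

theorem σ_eq_id {g : GL (Fin 2) ℝ} (h : 0 < g.det.val) (w : ℂ) : σ g w = w := by
  simp only [σ, if_pos h]; rfl

theorem character_mul_eq_one {N : ℕ} [NeZero N] (χ : DirichletCharacter ℂ N) {γ : SL(2, ℤ)}
    (h : γ ∈ Gamma0 N) : χ ((γ 0 0 : ℤ) : ZMod N) * χ ((γ 1 1 : ℤ) : ZMod N) = 1 := by
  have hdet := congrArg (Int.cast : ℤ → ZMod N) γ.det_coe
  rw [Matrix.det_fin_two] at hdet
  push_cast at hdet
  rw [Gamma0_mem.1 h, mul_zero, sub_zero] at hdet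
  rw [← map_mul, hdet, map_one]

/-- The unfolded form of the identity between `⟨f, T_n f⟩` and `⟨T_n* f, f⟩`: the adjoint is given
by the inverses of the lower triangular representatives. -/
theorem sum_integral_petersson_eq {N : ℕ} [NeZero N] {χ : DirichletCharacter ℂ N} {n : ℕ}
    (hf : Continuous f) {C : ℝ} (hC : ∀ z, ‖petersson K f f z‖ ≤ C)
    (hχ : ∀ γ ∈ Gamma0 N, f ∣[K] (γ : GL (Fin 2) ℝ) = χ ((γ 1 1 : ℤ) : ZMod N) • f)
    {W : ℍ → ℝ} (hW : Measurable W) (hW0 : ∀ z, 0 ≤ W z) (hWi : Integrable W)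
    (hW1 : ∀ z, HasSum (fun γ : Gamma0 N => W ((γ : SL(2, ℤ)) • z)) 1) :
    ∑ i : heckeIndex N n, ∫ z, (W z : ℂ) *
        (χ (i.1.1.1 : ZMod N) * petersson K f (f ∣[K] upperGL i) z) =
      ∑ i : heckeIndex N n, ∫ z, (W z : ℂ) *
        (χ (i.1.1.1 : ZMod N) * ((n : ℂ) ^ (K - 2) * petersson K (f ∣[K] (lowerGL i)⁻¹) f z)) := by
  obtain ⟨e, he⟩ := exists_heckeIndex_equiv N n
  obtain ⟨B, hB⟩ := exists_norm_petersson_slash_le hC n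
  have hχ1 : ∀ x : ZMod N, ‖χ x‖ ≤ 1 := DirichletCharacter.norm_le_one χ
  have hB' : ∀ (i : heckeIndex N n) (g : GL (Fin 2) ℝ), g.det.val = n → ∀ z,
      ‖χ (i.1.1.1 : ZMod N) * petersson K f (f ∣[K] g) z‖ ≤ B := fun i g hg z => by
    rw [norm_mul]
    refine (mul_le_of_le_one_left (norm_nonneg _) (hχ1 _)).trans (hB g ?_ z)
    rw [hg, Nat.abs_cast]
  have hm : ∀ (i : heckeIndex N n) (g : GL (Fin 2) ℝ),
      Measurable fun z => χ (i.1.1.1 : ZMod N) * petersson K f (f ∣[K] g) z := fun i g =>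
    ((petersson_continuous K hf (continuous_slash hf g)).measurable).const_mul _
  have heGL : ∀ q : heckeIndex N n × Gamma0 N,
      ((q.2 : SL(2, ℤ)) : GL (Fin 2) ℝ) * upperGL q.1 =
        lowerGL (e q).1 * (((e q).2 : SL(2, ℤ)) : GL (Fin 2) ℝ) := fun q => by
    ext i j
    have h := congrFun (congrFun (he q) i) j
    rw [Matrix.mul_apply, Matrix.mul_apply] at h
    have h' := congrArg (Int.cast : ℤ → ℝ) h
    push_cast at h'
    rw [Matrix.GeneralLinearGroup.coe_mul, Matrix.GeneralLinearGroup.coe_mul, Matrix.mul_apply,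
      Matrix.mul_apply]
    exact h'
  refine (integral_mul_sum_eq_of_coset_equiv (μ := volume)
    (ρ := (Matrix.SpecialLinearGroup.mapGL ℝ).comp (Gamma0 N).subtype)
    hW hW0 hWi hW1 (α := upperGL) (δ := lowerGL) e heGL
    (p := fun i z => χ (i.1.1.1 : ZMod N) * petersson K f (f ∣[K] upperGL i) z)
    (p' := fun i z => χ (i.1.1.1 : ZMod N) * petersson K f (f ∣[K] lowerGL i) z)
    (fun i => hm i _) (fun i => hm i _) (fun i => hB' i _ (det_upperGL i))
    (fun i => hB' i _ (det_lowerGL i)) ?_).trans ?_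
  · intro q x
    have hpet : ∀ (c c' : ℂ) (u v : ℍ → ℂ), petersson K (c • u) (c' • v) x =
        conj c * (c' * petersson K u v x) := fun c c' u v => by
      simp only [petersson, Pi.smul_apply, smul_eq_mul, map_mul]
      ring
    have hu := hχ _ q.2.2
    have hu' := hχ _ (e q).2.2
    have h00 := congrFun (congrFun (he q) 0) 0
    have hc := character_mul_eq_one χ q.2.2
    have hc' := character_mul_eq_one χ (e q).2.2
    set γ : SL(2, ℤ) := q.2.1
    set γ' : SL(2, ℤ) := (e q).2.1
    have h1 : petersson K f (f ∣[K] lowerGL (e q).1) (γ' • x) =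
        conj (χ ((γ' 1 1 : ℤ) : ZMod N)) * (χ ((γ 1 1 : ℤ) : ZMod N) *
          petersson K f (f ∣[K] upperGL q.1) x) := by
      rw [← petersson_slash_SL, SL_slash, SL_slash, hu', ← SlashAction.slash_mul]
      erw [← heGL q]
      rw [SlashAction.slash_mul, hu, smul_slash, σ_eq_id (by
        rw [det_upperGL]
        exact_mod_cast Nat.pos_of_ne_zero (mem_heckeIndex.1 q.1.2).1.2), hpet]
    -- Comparison of upper left entries in `γ α = δ γ'`, where `N` divides the lower left ones. This
    -- makes the factors `χ(a)` absorb exactly the characters produced by `γ` and `γ'`.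
    have h2 : χ ((γ 0 0 : ℤ) : ZMod N) * χ (q.1.1.1.1 : ZMod N) =
        χ ((e q).1.1.1.1 : ZMod N) * χ ((γ' 0 0 : ℤ) : ZMod N) := by
      simp only [Matrix.mul_apply, Fin.sum_univ_two, upperRep, lowerRep, Matrix.of_apply,
        Matrix.cons_val', Matrix.cons_val_zero, Matrix.cons_val_one, Matrix.cons_val_fin_one,
        mul_zero, add_zero, zero_mul] at h00
      rw [← map_mul, ← map_mul]
      have := congrArg (Int.cast : ℤ → ZMod N) h00
      push_cast at this
      rw [this]
    have h3 : conj (χ ((γ' 1 1 : ℤ) : ZMod N)) = χ ((γ' 0 0 : ℤ) : ZMod N) := by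
      have hunit : IsUnit ((γ' 1 1 : ℤ) : ZMod N) := by
        by_contra h
        rw [χ.map_nonunit h, mul_zero] at hc'
        exact zero_ne_one hc'
      have hnorm := DirichletCharacter.unit_norm_eq_one χ hunit.unit
      rw [hunit.unit_spec] at hnorm
      have := Complex.conj_mul' (χ ((γ' 1 1 : ℤ) : ZMod N))
      rw [hnorm] at this
      refine mul_right_cancel₀ (b := χ ((γ' 1 1 : ℤ) : ZMod N)) ?_ ?_
      · rw [← norm_ne_zero_iff, hnorm]; exact one_ne_zero
      · rw [this, hc']; simp
    change _ = χ ((e q).1.1.1.1 : ZMod N) * petersson K f (f ∣[K] lowerGL (e q).1) (γ' • x)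
    rw [h1, h3]
    linear_combination (-(χ (q.1.1.1.1 : ZMod N)) * petersson K f (f ∣[K] upperGL q.1) x) * hc +
      χ ((γ 1 1 : ℤ) : ZMod N) * petersson K f (f ∣[K] upperGL q.1) x * h2
  · refine Finset.sum_congr rfl fun i _ => integral_congr_ae (ae_of_all _ fun x => ?_)
    have hdet : (lowerGL i)⁻¹.det.val = (n : ℝ)⁻¹ := by
      rw [map_inv, Units.val_inv_eq_inv_val, det_lowerGL]
    have hn : (0 : ℝ) < n := by
      exact_mod_cast Nat.pos_of_ne_zero (mem_heckeIndex.1 i.2).1.2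
    have h := petersson_slash K f (f ∣[K] lowerGL i) (lowerGL i)⁻¹ x
    rw [← SlashAction.slash_mul, mul_inv_cancel, SlashAction.slash_one, hdet,
      σ_eq_id (by rw [hdet]; positivity), abs_of_pos (by positivity)] at h
    simp only [h]
    rw [← mul_assoc ((n : ℂ) ^ (K - 2))]
    push_cast
    rw [← mul_zpow, mul_inv_cancel₀ (by exact_mod_cast hn.ne'), one_zpow, one_mul]

end PeterssonAdjoint

/-! ### Hecke operators, slash action and the Fricke involution -/

section HeckeFricke

open MeasureTheory UpperHalfPlane CongruenceSubgroup ModularForm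
open scoped MatrixGroups ModularForm ComplexConjugate

theorem coe_intGL_smul (M : Matrix (Fin 2) (Fin 2) ℤ) (h : 0 < M.det) (z : ℍ) :
    ((intGL M h.ne' • z : ℍ) : ℂ) = (M 0 0 * z + M 0 1) / (M 1 0 * z + M 1 1) := by
  rw [coe_smul_of_det_pos (by rw [det_intGL]; exact_mod_cast h)]
  simp [num, denom, intGL_apply]

theorem slash_intGL (K : ℤ) (f : ℍ → ℂ) (M : Matrix (Fin 2) (Fin 2) ℤ) (h : 0 < M.det) (z : ℍ) :
    (f ∣[K] intGL M h.ne') z =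
      (M.det : ℂ) ^ (K - 1) * (M 1 0 * z + M 1 1) ^ (-K) *
        f (ofComplex ((M 0 0 * z + M 0 1) / (M 1 0 * z + M 1 1))) := by
  have hd : (0 : ℝ) < M.det := by exact_mod_cast h
  rw [slash_apply, σ_eq_id (by rw [det_intGL]; exact hd), det_intGL, abs_of_pos hd,
    ← coe_intGL_smul M h, ofComplex_apply]
  simp only [denom, intGL_apply, Complex.ofReal_intCast]
  ring

theorem heckeT_eq_sum_slash {N : ℕ} (χ : DirichletCharacter ℂ N) (K : ℤ) (n : ℕ) (f : ℍ → ℂ) :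
    heckeT χ K n f = ∑ i : heckeIndex N n, χ (i.1.1.1 : ZMod N) • f ∣[K] upperGL i := by
  funext z
  rw [Finset.sum_apply]
  obtain ⟨F, hF⟩ : ∃ F : (Σ _ : ℕ × ℕ, ℕ) → ℂ, F = fun j => χ (j.1.1 : ZMod N) *
    ((n : ℂ) ^ (K - 1) * (j.1.2 : ℂ) ^ (-K) *
      f (ofComplex (((j.1.1 : ℂ) * (z : ℂ) + (j.2 : ℂ)) / (j.1.2 : ℂ)))) := ⟨_, rfl⟩
  have h1 : ∀ i : heckeIndex N n, (χ (i.1.1.1 : ZMod N) • f ∣[K] upperGL i) z = F i := fun i => by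
    have hpos : 0 < (upperRep i).det := by
      rw [det_upperRep]
      exact lt_of_le_of_ne (by positivity) (mul_ne_zero_of_mem_heckeIndex i.2).symm
    have hdet : ((upperRep i).det : ℂ) = n := by
      rw [det_upperRep]; exact_mod_cast (mem_heckeIndex.1 i.2).1.1
    rw [Pi.smul_apply, smul_eq_mul, upperGL, slash_intGL K f _ hpos, hdet]
    simp [upperRep, hF]
  rw [Finset.sum_congr rfl fun i _ => h1 i, Finset.sum_coe_sort (heckeIndex N n), hF, heckeIndex,
    Finset.sum_sigma, Finset.sum_filter_of_ne, heckeT, Finset.mul_sum]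
  · refine Finset.sum_congr rfl fun p _ => ?_
    rw [Finset.mul_sum, Finset.mul_sum]
    refine Finset.sum_congr rfl fun b _ => ?_
    ring
  · intro p _ hp
    by_contra hcop
    refine hp (Finset.sum_eq_zero fun b _ => ?_)
    rw [χ.map_nonunit (by rwa [ZMod.isUnit_iff_coprime]), zero_mul]

noncomputable section

/-- The matrix `(0 -1; N 0)`. -/
def frickeGL (N : ℕ) [NeZero N] : GL (Fin 2) ℝ :=
  intGL !![0, -1; (N : ℤ), 0] (by simp [NeZero.ne N])

end

theorem fricke_eq_slash {N : ℕ} [NeZero N] (K : ℤ) (f : ℍ → ℂ) :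
    fricke N K f = (N : ℂ) ^ (1 - (K : ℂ) / 2) • f ∣[K] frickeGL N := by
  have hN : (N : ℂ) ≠ 0 := by exact_mod_cast NeZero.ne N
  funext z
  rw [Pi.smul_apply, frickeGL, slash_intGL K f _ (by simp [Nat.pos_of_ne_zero (NeZero.ne N)]),
    fricke]
  simp only [Matrix.det_fin_two_of, Matrix.of_apply, Matrix.cons_val', Matrix.cons_val_zero,
    Matrix.cons_val_one, Matrix.cons_val_fin_one, smul_eq_mul]
  push_cast
  simp only [zero_mul, zero_add, add_zero, neg_mul, one_mul, sub_neg_eq_add]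
  rw [mul_zpow, ← mul_assoc, ← mul_assoc, ← mul_assoc]
  congr 2
  rw [sub_eq_add_neg, Complex.cpow_add _ _ hN, Complex.cpow_one, ← neg_div, mul_assoc _ (_ ^ (K - 1)),
    ← zpow_add₀ hN, show K - 1 + -K = -1 by ring, zpow_neg_one]
  field_simp

theorem slash_scalar (K : ℤ) (f : ℍ → ℂ) {n : ℕ} (hn : 0 < n) (h : (!![(n : ℤ), 0; 0, n]).det ≠ 0) :
    f ∣[K] intGL !![(n : ℤ), 0; 0, n] h = (n : ℂ) ^ (K - 2) • f := by
  have hn' : (n : ℂ) ≠ 0 := by exact_mod_cast hn.ne'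
  funext z
  rw [slash_intGL K f _ (by simp [hn])]
  simp only [Matrix.det_fin_two_of, Matrix.of_apply, Matrix.cons_val', Matrix.cons_val_zero,
    Matrix.cons_val_one, Matrix.cons_val_fin_one, Pi.smul_apply, smul_eq_mul]
  push_cast
  rw [zero_mul, zero_add, add_zero, mul_div_cancel_left₀ _ hn', ofComplex_apply]
  congr 1
  rw [sub_zero, mul_zpow, ← zpow_add₀ hn', ← zpow_add₀ hn']
  congr 1
  ring

/-- Up to the scalar `n`, conjugation by `W_N` carries `(lowerGL i)⁻¹` to `upperGL i`. -/
theorem lowerGL_mul_frickeGL_mul_upperGL {N n : ℕ} [NeZero N] (i : heckeIndex N n)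
    (h : (!![(n : ℤ), 0; 0, n]).det ≠ 0) :
    lowerGL i * (frickeGL N * upperGL i) = frickeGL N * intGL !![(n : ℤ), 0; 0, n] h := by
  have e : (i.1.1.1 : ℝ) * i.1.1.2 = n := by exact_mod_cast (mem_heckeIndex.1 i.2).1.1
  ext j k
  rw [Matrix.GeneralLinearGroup.coe_mul, Matrix.GeneralLinearGroup.coe_mul,
    Matrix.GeneralLinearGroup.coe_mul, Matrix.mul_apply, Matrix.mul_apply]
  simp only [Fin.sum_univ_two, Matrix.mul_apply, lowerGL, upperGL, frickeGL, intGL_apply]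
  fin_cases j <;> fin_cases k <;> simp [lowerRep, upperRep, ← e] <;> ring

/-- Removes `W_N` from the eigenvalue equation for `f|W_N`, leaving the sum over inverse lower
representatives that occurs in the adjoint formula. -/
theorem sum_slash_lowerGL_inv_eq {N : ℕ} [NeZero N] {χ : DirichletCharacter ℂ N} {K : ℤ} {n : ℕ}
    (hn : 0 < n) {f : ℍ → ℂ} {c : ℂ}
    (h : ∀ z, heckeT χ K n (fricke N K f) z = c * fricke N K f z) :
    ∑ i : heckeIndex N n, (χ (i.1.1.1 : ZMod N) * (n : ℂ) ^ (K - 2)) • f ∣[K] (lowerGL i)⁻¹ =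
      c • f := by
  have hN : (N : ℂ) ≠ 0 := by exact_mod_cast NeZero.ne N
  have hs : (!![(n : ℤ), 0; 0, n]).det ≠ 0 := by simp [hn.ne']
  have hdet : 0 < (frickeGL N).det.val := by
    rw [frickeGL, det_intGL]; simp [Nat.pos_of_ne_zero (NeZero.ne N)]
  have hσ : ∀ c : ℂ, σ (frickeGL N) c = c := σ_eq_id hdet
  have hterm : ∀ i : heckeIndex N n, (f ∣[K] frickeGL N) ∣[K] upperGL i =
      ((n : ℂ) ^ (K - 2)) • (f ∣[K] (lowerGL i)⁻¹) ∣[K] frickeGL N := fun i => by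
    have hσ' : ∀ c : ℂ, σ (intGL !![(n : ℤ), 0; 0, n] hs) c = c :=
      σ_eq_id (by rw [det_intGL]; simp [hn])
    have e : frickeGL N * upperGL i =
        (lowerGL i)⁻¹ * (frickeGL N * intGL !![(n : ℤ), 0; 0, n] hs) := by
      rw [← lowerGL_mul_frickeGL_mul_upperGL i, inv_mul_cancel_left]
    rw [← SlashAction.slash_mul, e, SlashAction.slash_mul, SlashAction.slash_mul,
      slash_scalar K _ hn]
  have h1 : heckeT χ K n (fricke N K f) = c • fricke N K f := funext h
  rw [heckeT_eq_sum_slash, fricke_eq_slash] at h1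
  have hup : ∀ (i : heckeIndex N n) (c : ℂ), σ (upperGL i) c = c := fun i =>
    σ_eq_id (by rw [det_upperGL]; exact_mod_cast hn)
  simp only [smul_slash, hup, hterm] at h1
  have h2 : (N : ℂ) ^ (1 - (K : ℂ) / 2) • (∑ i : heckeIndex N n,
      (χ (i.1.1.1 : ZMod N) * (n : ℂ) ^ (K - 2)) • (f ∣[K] (lowerGL i)⁻¹)) ∣[K] frickeGL N =
      (N : ℂ) ^ (1 - (K : ℂ) / 2) • (c • f) ∣[K] frickeGL N := by
    rw [SlashAction.sum_slash, Finset.smul_sum, smul_slash, hσ, smul_comm _ c, ← h1]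
    refine Finset.sum_congr rfl fun i _ => ?_
    rw [smul_slash, hσ]
    simp only [smul_smul]
    congr 1
    ring
  have h3 := smul_right_injective _ ((Complex.cpow_ne_zero_iff.2 (Or.inl hN))) h2
  have h4 := congrArg (fun u => u ∣[K] (frickeGL N)⁻¹) h3
  simpa only [← SlashAction.slash_mul, mul_inv_cancel, SlashAction.slash_one] using h4

end HeckeFricke

/-! ### Eigenvalues of the adjoint are conjugate -/

section EigenvalueConj

open MeasureTheory UpperHalfPlane CongruenceSubgroup ModularForm
open scoped MatrixGroups ModularForm ComplexConjugate

instance isOpenPosMeasure_upperHalfPlane : (volume : Measure ℍ).IsOpenPosMeasure where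
  open_pos U hU hne := by
    rw [volume_def]
    intro h
    have hmeas : Measurable fun z : ℍ => (((1 / NNReal.mk z.im z.im_pos.le) ^ 2 : NNReal) : ENNReal) := by
      have : Measurable fun z : ℍ => NNReal.mk z.im z.im_pos.le :=
        (continuous_im.subtype_mk _).measurable
      fun_prop
    rw [withDensity_apply_eq_zero hmeas] at h
    have hset : {z : ℍ | (((1 / NNReal.mk z.im z.im_pos.le) ^ 2 : NNReal) : ENNReal) ≠ 0} ∩ U = U := by
      refine Set.inter_eq_right.2 fun z _ => ?_
      have : NNReal.mk z.im z.im_pos.le ≠ 0 := fun h => z.im_pos.ne' (congrArg NNReal.toReal h)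
      exact ENNReal.coe_ne_zero.2 (pow_ne_zero _ (one_div_ne_zero this))
    rw [hset, measurableEmbedding_coe.comap_apply] at h
    exact (isOpenEmbedding_coe.isOpenMap U hU).measure_ne_zero volume (hne.image _) h

variable {K : ℤ} {f : ℍ → ℂ} {N : ℕ} [NeZero N] {χ : DirichletCharacter ℂ N}

theorem petersson_self (z : ℍ) : petersson K f f z = ((‖f z‖ ^ 2 * z.im ^ K : ℝ) : ℂ) := by
  rw [petersson, Complex.conj_mul']
  push_cast
  rfl

/-- The integrand is nonnegative, so a zero integral makes it vanish almost everywhere. As `|f|²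
y^K` is invariant and at each point some translate of `W` is nonzero, `f` vanishes almost
everywhere, and everywhere by continuity. -/
theorem integral_petersson_self_ne_zero (hf : Continuous f) (hf0 : f ≠ 0) {C : ℝ}
    (hC : ∀ z, ‖petersson K f f z‖ ≤ C)
    (hχ : ∀ γ ∈ Gamma0 N, f ∣[K] (γ : GL (Fin 2) ℝ) = χ ((γ 1 1 : ℤ) : ZMod N) • f)
    {W : ℍ → ℝ} (hW : Measurable W) (hW0 : ∀ z, 0 ≤ W z) (hWi : Integrable W)
    (hW1 : ∀ z, HasSum (fun γ : Gamma0 N => W ((γ : SL(2, ℤ)) • z)) 1) :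
    ∫ z, (W z : ℂ) * petersson K f f z ≠ 0 := by
  intro h
  have hP0 : ∀ z : ℍ, 0 ≤ ‖f z‖ ^ 2 * z.im ^ K := fun z =>
    mul_nonneg (sq_nonneg _) (zpow_nonneg z.im_pos.le _)
  have hcont : Continuous fun z => petersson K f f z := petersson_continuous K hf hf
  have hint : Integrable fun z => W z * (‖f z‖ ^ 2 * z.im ^ K) := by
    have h1 : (fun z => W z * (‖f z‖ ^ 2 * z.im ^ K)) = fun z => W z * ‖petersson K f f z‖ := by
      funext z
      rw [petersson_self, Complex.norm_real, Real.norm_of_nonneg (hP0 z)]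
    rw [h1]
    refine Integrable.mono' (hWi.mul_const C) (hW.mul hcont.norm.measurable).aestronglyMeasurable
      (ae_of_all _ fun z => ?_)
    rw [norm_mul, norm_norm, Real.norm_of_nonneg (hW0 z)]
    exact mul_le_mul_of_nonneg_left (hC z) (hW0 z)
  simp only [petersson_self, ← Complex.ofReal_mul] at h
  rw [integral_complex_ofReal, Complex.ofReal_eq_zero, integral_eq_zero_iff_of_nonneg
    (fun z => mul_nonneg (hW0 z) (hP0 z)) hint] at h
  have hγ : ∀ γ : Gamma0 N, ∀ᵐ z : ℍ, W ((γ : SL(2, ℤ)) • z) * (‖f z‖ ^ 2 * z.im ^ K) = 0 := fun γ => by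
    have hmp : MeasurePreserving (fun z : ℍ => (γ : SL(2, ℤ)) • z) volume volume :=
      measurePreserving_smul (Matrix.SpecialLinearGroup.mapGL ℝ (γ : SL(2, ℤ))) volume
    filter_upwards [hmp.quasiMeasurePreserving.ae h] with z hz
    rcases mul_eq_zero.1 hz with h1 | h1
    · rw [h1, zero_mul]
    · have h2 := petersson_slash_SL K f f (γ : SL(2, ℤ)) z
      rw [SL_slash, hχ _ γ.2, petersson_self, petersson_self, h1, Complex.ofReal_zero,
        Complex.ofReal_eq_zero] at h2
      have h3 : χ ((((γ : SL(2, ℤ)) 1 1 : ℤ)) : ZMod N) ≠ 0 := fun h0 => by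
        have := character_mul_eq_one χ γ.2
        rw [h0, mul_zero] at this
        exact zero_ne_one this
      rw [Pi.smul_apply, smul_eq_mul, norm_mul, mul_pow, mul_assoc] at h2
      rw [(mul_eq_zero.1 h2).resolve_left (by simpa using h3), mul_zero]
  have hae : (fun z => petersson K f f z) =ᵐ[volume] fun _ => 0 := by
    filter_upwards [ae_all_iff.2 hγ] with z hz
    have h1 : ∃ γ : Gamma0 N, W ((γ : SL(2, ℤ)) • z) ≠ 0 := by
      by_contra! h0
      have := hW1 z
      simp only [h0] at this
      exact zero_ne_one (hasSum_zero.unique this)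
    obtain ⟨γ, hγ⟩ := h1
    rw [petersson_self, (mul_eq_zero.1 (hz γ)).resolve_left hγ, Complex.ofReal_zero]
  have hall := Continuous.ae_eq_iff_eq volume hcont continuous_const |>.1 hae
  refine hf0 (funext fun z => ?_)
  have h1 := congrFun hall z
  simp only [petersson_self, Complex.ofReal_eq_zero] at h1
  simpa using (mul_eq_zero.1 h1).resolve_right (zpow_ne_zero _ z.im_pos.ne')

/-- The adjoint formula reads `c ⟨f, f⟩ = conj c' ⟨f, f⟩`, and the weighted norm is not zero. -/
theorem heckeT_eigenvalue_eq_conj (hf : Continuous f) (hf0 : f ≠ 0) {C : ℝ}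
    (hC : ∀ z, ‖petersson K f f z‖ ≤ C)
    (hχ : ∀ γ ∈ Gamma0 N, f ∣[K] (γ : GL (Fin 2) ℝ) = χ ((γ 1 1 : ℤ) : ZMod N) • f)
    {n : ℕ} (hn : 0 < n) {c c' : ℂ} (hc : ∀ z, heckeT χ K n f z = c * f z)
    (hc' : ∀ z, heckeT χ⁻¹ K n (fricke N K f) z = c' * fricke N K f z) : c = conj c' := by
  obtain ⟨W, hW, hW0, hWi, hW1⟩ := exists_partition_of_unity (Gamma0 N)
  have h := sum_integral_petersson_eq (n := n) hf hC hχ hW hW0 hWi hW1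
  have hI := integral_petersson_self_ne_zero hf hf0 hC hχ hW hW0 hWi hW1
  obtain ⟨B, hB⟩ := exists_norm_petersson_slash_le hC n
  obtain ⟨B', hB'⟩ := exists_norm_petersson_slash_le hC (n : ℝ)⁻¹
  have hint : ∀ (u : ℍ → ℂ) (B : ℝ), Continuous u → (∀ z, ‖u z‖ ≤ B) →
      Integrable fun z => (W z : ℂ) * u z := fun u B hu hB => by
    refine Integrable.mono' (hWi.mul_const B)
      ((Complex.measurable_ofReal.comp hW).mul hu.measurable).aestronglyMeasurable
      (ae_of_all _ fun z => ?_)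
    rw [norm_mul, Complex.norm_real, Real.norm_of_nonneg (hW0 z)]
    exact mul_le_mul_of_nonneg_left (hB z) (hW0 z)
  have hmul : ∀ (a : ℂ) (u : ℍ → ℂ), (fun z => (W z : ℂ) * (a * u z)) =
      fun z => a * ((W z : ℂ) * u z) := fun a u => by funext z; ring
  rw [← integral_finsetSum, ← integral_finsetSum] at h
  · refine mul_right_cancel₀ hI ?_
    rw [← integral_const_mul, ← integral_const_mul]
    refine Eq.trans (integral_congr_ae (ae_of_all _ fun z => ?_))
      (h.trans (integral_congr_ae (ae_of_all _ fun z => ?_)))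
    · have h1 := hc z
      rw [heckeT_eq_sum_slash, Finset.sum_apply] at h1
      simp only [Pi.smul_apply, smul_eq_mul] at h1
      simp only [petersson]
      rw [← Finset.mul_sum]
      calc c * ((W z : ℂ) * (conj (f z) * f z * (z.im : ℂ) ^ K)) =
          (W z : ℂ) * (conj (f z) * (c * f z) * (z.im : ℂ) ^ K) := by ring
        _ = _ := by
          rw [← h1, Finset.mul_sum, Finset.sum_mul]
          congr 1
          exact Finset.sum_congr rfl fun i _ => by ring
    · have h1 := congrArg conj (congrFun (sum_slash_lowerGL_inv_eq hn hc') z)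
      rw [Finset.sum_apply, map_sum] at h1
      have h2 : ∀ a : ZMod N, conj (χ⁻¹ a) = χ a := fun a => by
        rw [← MulChar.star_eq_inv, MulChar.star_apply]
        simp
      simp only [Pi.smul_apply, smul_eq_mul, map_mul, map_zpow₀, h2, Complex.conj_natCast] at h1
      simp only [petersson]
      rw [← Finset.mul_sum]
      calc _ = (W z : ℂ) * ((conj c' * conj (f z)) * f z * (z.im : ℂ) ^ K) := by
            rw [← h1, Finset.sum_mul, Finset.sum_mul]
            congr 1
            exact Finset.sum_congr rfl fun i _ => by ring
        _ = _ := by ring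
  · intro i _
    rw [hmul]
    refine Integrable.const_mul ?_ _
    rw [hmul]
    refine (hint _ B' (petersson_continuous K (continuous_slash hf _) hf) fun z => ?_).const_mul _
    rw [petersson_norm_symm]
    refine hB' _ ?_ z
    rw [map_inv, Units.val_inv_eq_inv_val, det_lowerGL, abs_of_nonneg (by positivity)]
  · intro i _
    rw [hmul]
    refine (hint _ B (petersson_continuous K hf (continuous_slash hf _)) fun z => ?_).const_mul _
    exact hB _ (by rw [det_upperGL, Nat.abs_cast]) z

end EigenvalueConj

/-! ### Hecke operators on Fourier coefficients -/

section QExpansions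

open UpperHalfPlane
open scoped Real

noncomputable section

/-- `f(z) = ∑ a(m) e(mz)` on the upper half-plane. -/
def HasQExpansion (f : ℍ → ℂ) (a : ℕ → ℂ) : Prop :=
  ∀ z : ℍ, HasSum (fun m : ℕ => a m * Complex.exp (2 * π * Complex.I * (m * z))) (f z)

/-- The coefficients of `T_n f` in terms of those of `f`. -/
def heckeCoeff {N : ℕ} (χ : DirichletCharacter ℂ N) (K : ℤ) (n : ℕ) (a : ℕ → ℂ) (m : ℕ) : ℂ :=
  ∑ p ∈ n.divisorsAntidiagonal, χ (p.1 : ZMod N) * (p.1 : ℂ) ^ (K - 1) *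
    if p.1 ∣ m then a (p.2 * (m / p.1)) else 0

end

theorem qParam_one_pow (z : ℂ) (m : ℕ) :
    Function.Periodic.qParam 1 z ^ m = Complex.exp (2 * π * Complex.I * (m * z)) := by
  rw [Function.Periodic.qParam, ← Complex.exp_nat_mul]
  congr 1
  push_cast
  ring

theorem HasQExpansion.sub {f g : ℍ → ℂ} {a b : ℕ → ℂ} (hf : HasQExpansion f a)
    (hg : HasQExpansion g b) : HasQExpansion (f - g) (a - b) := fun z => by
  simpa [sub_mul] using (hf z).sub (hg z)

theorem HasQExpansion.const_smul {f : ℍ → ℂ} {a : ℕ → ℂ} (hf : HasQExpansion f a) (c : ℂ) :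
    HasQExpansion (c • f) (c • a) := fun z => by
  simpa [mul_assoc] using (hf z).mul_left c

theorem HasQExpansion.eq_zero {a : ℕ → ℂ} (h : HasQExpansion 0 a) : a = 0 := by
  have h0 : cuspFunction 1 (0 : ℍ → ℂ) = 0 := by
    funext q
    rcases eq_or_ne q 0 with rfl | hq
    · simpa [cuspFunction, Function.Periodic.cuspFunction]
        using! (tendsto_const_nhds.mono_left nhdsWithin_le_nhds).limUnder_eq
    · simp [cuspFunction, Function.Periodic.cuspFunction, hq]
  have h1 := hasFPowerSeriesOnBall_cuspFunction (c := a) (f := (0 : ℍ → ℂ)) one_pos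
    (by rw [h0]; exact analyticAt_const) (fun τ => by
      simpa only [smul_eq_mul, qParam_one_pow] using h τ)
  rw [h0] at h1
  have h2 := h1.hasFPowerSeriesAt.eq_zero
  funext m
  have h3 := congrArg (fun p => FormalMultilinearSeries.coeff p m) h2
  rw [FormalMultilinearSeries.coeff_ofScalars] at h3
  exact h3

theorem HasQExpansion.unique {f : ℍ → ℂ} {a b : ℕ → ℂ} (ha : HasQExpansion f a)
    (hb : HasQExpansion f b) : a = b := by
  have := ha.sub hb
  rw [sub_self] at this
  exact sub_eq_zero.1 this.eq_zero

theorem sum_range_exp_two_pi_I {D : ℕ} (hD : 0 < D) (m : ℕ) :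
    ∑ b ∈ Finset.range D, Complex.exp (2 * π * Complex.I * (m * (b / D))) =
      if D ∣ m then (D : ℂ) else 0 := by
  have hD0 : (D : ℂ) ≠ 0 := by exact_mod_cast hD.ne'
  have hpi : (2 * π * Complex.I : ℂ) ≠ 0 := Complex.two_pi_I_ne_zero
  have h1 : ∀ b : ℕ, Complex.exp (2 * π * Complex.I * (m * (b / D))) =
      Complex.exp (2 * π * Complex.I * (m / D)) ^ b := fun b => by
    rw [← Complex.exp_nat_mul]; congr 1; ring
  simp only [h1]
  split_ifs with h
  · obtain ⟨k, rfl⟩ := h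
    have : Complex.exp (2 * π * Complex.I * (((D * k : ℕ) : ℂ) / D)) = 1 := by
      rw [Complex.exp_eq_one_iff]
      refine ⟨k, ?_⟩
      push_cast
      rw [mul_div_cancel_left₀ _ hD0]; ring
    rw [this]
    simp
  · have hne : Complex.exp (2 * π * Complex.I * (m / D)) ≠ 1 := by
      intro h0
      obtain ⟨k, hk⟩ := Complex.exp_eq_one_iff.1 h0
      rw [mul_comm] at hk
      have h2 := mul_right_cancel₀ hpi hk
      rw [div_eq_iff hD0] at h2
      have h3 : (m : ℤ) = k * D := by exact_mod_cast h2
      exact h (Int.natCast_dvd_natCast.1 ⟨k, by rw [h3, mul_comm]⟩)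
    have h2 : Complex.exp (2 * π * Complex.I * (m / D)) ^ D = 1 := by
      rw [← Complex.exp_nat_mul, Complex.exp_eq_one_iff]
      refine ⟨m, ?_⟩
      push_cast
      field_simp
    have h3 := geom_sum_mul (Complex.exp (2 * π * Complex.I * (m / D))) D
    rw [h2, sub_self] at h3
    exact (mul_eq_zero.1 h3).resolve_right (sub_ne_zero.2 hne)

/-- Averaging over `b` modulo `D` kills the terms whose index is not divisible by `D`, by
orthogonality of roots of unity; reindexing by `D m'` and `A m'` does the rest. -/
theorem HasQExpansion.sum_range {f : ℍ → ℂ} {a : ℕ → ℂ} (hf : HasQExpansion f a) {A D : ℕ}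
    (hA : 0 < A) (hD : 0 < D) :
    HasQExpansion (fun z => ∑ b ∈ Finset.range D,
        f (ofComplex (((A : ℂ) * (z : ℂ) + (b : ℂ)) / (D : ℂ))))
      (fun m => D * if A ∣ m then a (D * (m / A)) else 0) := fun z => by
  have hD0 : (D : ℂ) ≠ 0 := by exact_mod_cast hD.ne'
  have hA0 : (A : ℂ) ≠ 0 := by exact_mod_cast hA.ne'
  have him : ∀ b : ℕ, 0 < (((A : ℂ) * (z : ℂ) + (b : ℂ)) / (D : ℂ)).im := fun b => by
    rw [Complex.div_natCast_im]
    have : ((A : ℂ) * (z : ℂ) + (b : ℂ)).im = A * z.im := by simp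
    rw [this]
    have := z.im_pos
    positivity
  have h1 := hasSum_sum (s := Finset.range D)
    fun b _ => hf (ofComplex (((A : ℂ) * (z : ℂ) + (b : ℂ)) / (D : ℂ)))
  have h2 : ∀ m : ℕ, ∑ b ∈ Finset.range D, a m * Complex.exp (2 * π * Complex.I *
      (m * (ofComplex (((A : ℂ) * (z : ℂ) + (b : ℂ)) / (D : ℂ)) : ℍ))) =
      if D ∣ m then D * a m * Complex.exp (2 * π * Complex.I * (m * (A * z / D))) else 0 :=
      fun m => by
    have h3 : ∀ b : ℕ, a m * Complex.exp (2 * π * Complex.I *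
      (m * (ofComplex (((A : ℂ) * (z : ℂ) + (b : ℂ)) / (D : ℂ)) : ℍ))) =
        a m * Complex.exp (2 * π * Complex.I * (m * (A * z / D))) *
          Complex.exp (2 * π * Complex.I * (m * (b / D))) := fun b => by
      rw [ofComplex_apply_of_im_pos (him b), mul_assoc (a m), ← Complex.exp_add]
      congr 2
      ring
    rw [Finset.sum_congr rfl fun b _ => h3 b, ← Finset.mul_sum, sum_range_exp_two_pi_I hD]
    split_ifs <;> ring
  simp only [h2] at h1
  have hinjD : Function.Injective fun m : ℕ => D * m := fun x y h => Nat.eq_of_mul_eq_mul_left hD h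
  have hinjA : Function.Injective fun m : ℕ => A * m := fun x y h => Nat.eq_of_mul_eq_mul_left hA h
  rw [← hinjD.hasSum_iff (by
    intro m hm
    rw [if_neg]
    rintro ⟨k, rfl⟩
    exact hm ⟨k, rfl⟩)] at h1
  rw [← hinjA.hasSum_iff (by
    intro m hm
    dsimp only
    rw [if_neg, mul_zero, zero_mul]
    rintro ⟨k, rfl⟩
    exact hm ⟨k, rfl⟩)]
  refine h1.congr_fun fun m => ?_
  simp only [Function.comp_apply, dvd_mul_right, if_true]
  rw [Nat.mul_div_cancel_left _ hA]
  congr 2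
  push_cast
  field_simp

theorem HasQExpansion.heckeT {f : ℍ → ℂ} {a : ℕ → ℂ} (hf : HasQExpansion f a) {N : ℕ}
    (χ : DirichletCharacter ℂ N) (K : ℤ) (n : ℕ) :
    HasQExpansion (heckeT χ K n f) (heckeCoeff χ K n a) := fun z => by
  simp only [heckeCoeff, Finset.sum_mul]
  rw [_root_.heckeT, Finset.mul_sum]
  refine hasSum_sum fun p hp => ?_
  obtain ⟨h1, h2⟩ := Nat.mem_divisorsAntidiagonal.1 hp
  have hA : 0 < p.1 := Nat.pos_of_ne_zero fun h => h2 (by rw [← h1, h, zero_mul])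
  have hD : 0 < p.2 := Nat.pos_of_ne_zero fun h => h2 (by rw [← h1, h, mul_zero])
  have hA0 : (p.1 : ℂ) ≠ 0 := by exact_mod_cast hA.ne'
  have hD0 : (p.2 : ℂ) ≠ 0 := by exact_mod_cast hD.ne'
  have h3 := ((hf.sum_range hA hD) z).mul_left
    ((n : ℂ) ^ (K - 1) * (χ (p.1 : ZMod N) * (p.2 : ℂ) ^ (-K)))
  simp only [← mul_assoc] at h3 ⊢
  refine h3.congr_fun fun m => ?_
  have h4 : (n : ℂ) ^ (K - 1) * (p.2 : ℂ) ^ (-K) * p.2 = (p.1 : ℂ) ^ (K - 1) := by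
    rw [← h1, Nat.cast_mul, mul_zpow, zpow_sub_one₀ hD0, zpow_neg]
    field_simp
  rw [← h4]
  ring

theorem heckeCoeff_one {N : ℕ} (χ : DirichletCharacter ℂ N) (K : ℤ) {n : ℕ} (hn : n ≠ 0)
    (a : ℕ → ℂ) : heckeCoeff χ K n a 1 = a n := by
  rw [heckeCoeff, Finset.sum_eq_single (1, n)]
  · simp
  · rintro ⟨A, D⟩ hp hne
    obtain ⟨h1, -⟩ := Nat.mem_divisorsAntidiagonal.1 hp
    rw [if_neg, mul_zero]
    intro hA
    have : A = 1 := Nat.dvd_one.1 hA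
    subst this
    exact hne (Prod.ext rfl (by simpa using h1))
  · intro h
    exact absurd (Nat.mem_divisorsAntidiagonal.2 ⟨one_mul n, hn⟩) h

/-- Compare first coefficients: in that of `T_n f` only the divisor `1` contributes, and it gives `a
n`. -/
theorem HasQExpansion.coeff_eq_of_heckeT_eq {f : ℍ → ℂ} {a : ℕ → ℂ} (hf : HasQExpansion f a)
    {N : ℕ} {χ : DirichletCharacter ℂ N} {K : ℤ} {n : ℕ} (hn : n ≠ 0) {c : ℂ}
    (h : ∀ z, _root_.heckeT χ K n f z = c * f z) : a n = c * a 1 := by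
  have h1 := hf.heckeT χ K n
  rw [show _root_.heckeT χ K n f = c • f from funext h] at h1
  rw [← heckeCoeff_one χ K hn a, h1.unique (hf.const_smul c)]
  rfl

end QExpansions

/-! ### Fourier coefficients of an eigenform and of its Fricke image -/

section EigenformCoefficients

open UpperHalfPlane CongruenceSubgroup ModularForm
open scoped MatrixGroups ModularForm ComplexConjugate Real Manifold

theorem hasQExpansion_of_slash_T {f : ℍ → ℂ} {K : ℤ} (hT : f ∣[K] ModularGroup.T = f)
    (hf : MDiff f) (hz : IsZeroAtImInfty f) :
    HasQExpansion f (fun n => (qExpansion 1 f).coeff n) ∧ (qExpansion 1 f).coeff 0 = 0 := by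
  have hper : Function.Periodic (f ∘ ofComplex) ((1 : ℝ) : ℂ) := by
    intro w
    by_cases! hw : 0 < w.im
    · have hw' : 0 < (w + (1 : ℝ)).im := by simp [hw]
      simp only [Function.comp_apply, ofComplex_apply_of_im_pos hw', ofComplex_apply_of_im_pos hw]
      have h1 := congrFun hT ⟨w, hw⟩
      rw [SL_slash_apply, modular_T_smul] at h1
      rw [ModularGroup.denom_apply] at h1
      simp only [ModularGroup.coe_T, Matrix.of_apply, Matrix.cons_val', Matrix.cons_val_zero,
        Matrix.cons_val_one, Matrix.cons_val_fin_one, Int.cast_zero, zero_mul, Int.cast_one,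
        zero_add, one_zpow, mul_one] at h1
      rw [← h1]
      congr 1
      ext
      simp [add_comm]
    · have hw' : (w + (1 : ℝ)).im ≤ 0 := by simpa using hw
      rw [Function.comp_apply, Function.comp_apply, ofComplex_apply_of_im_nonpos hw',
        ofComplex_apply_of_im_nonpos hw]
  have hb := hz.isBoundedAtImInfty
  refine ⟨fun z => ?_, ?_⟩
  · simpa only [smul_eq_mul, qParam_one_pow] using hasSum_qExpansion one_pos hper hf hb z
  · rw [qExpansion_coeff_zero one_pos (analyticAt_cuspFunction_zero one_pos hper hf hb) hper,
      hz.valueAtInfty_eq_zero]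

/-- Boundedness of `|g|² y^K` with `K > 0` forces decay. As the bound survives the slash action,
this gives vanishing of `f|W_N` at infinity without inspection of cusps. -/
theorem isZeroAtImInfty_of_norm_petersson_le {g : ℍ → ℂ} {K : ℤ} (hK : 0 < K) {B : ℝ}
    (hB : ∀ z, ‖petersson K g g z‖ ≤ B) : IsZeroAtImInfty g := by
  rw [isZeroAtImInfty_iff]
  intro ε hε
  refine ⟨max 1 (B / ε ^ 2), fun z hz => ?_⟩
  have h1 : 1 ≤ z.im := (le_max_left _ _).trans hz
  have h2 : B / ε ^ 2 ≤ z.im := (le_max_right _ _).trans hz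
  have h3 := hB z
  rw [petersson_self, Complex.norm_real, Real.norm_of_nonneg
    (mul_nonneg (sq_nonneg _) (zpow_nonneg z.im_pos.le _))] at h3
  have h4 : z.im ≤ z.im ^ K := by
    simpa using zpow_le_zpow_right₀ h1 (show (1 : ℤ) ≤ K by omega)
  have h5 : ‖g z‖ ^ 2 * z.im ≤ B := (mul_le_mul_of_nonneg_left h4 (sq_nonneg _)).trans h3
  rw [div_le_iff₀ (by positivity)] at h2
  have h6 : ‖g z‖ ^ 2 * z.im ≤ ε ^ 2 * z.im := by linarith
  exact le_of_sq_le_sq (le_of_mul_le_mul_right h6 z.im_pos) hε.le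

variable {N : ℕ} [NeZero N] {K : ℤ} {χ : DirichletCharacter ℂ N} {f : CuspFormGamma1 N K}

theorem IsEigenform.slash_eq (hf : IsEigenform χ f) {γ : SL(2, ℤ)} (hγ : γ ∈ Gamma0 N) :
    (f : ℍ → ℂ) ∣[K] (γ : GL (Fin 2) ℝ) = χ ((γ 1 1 : ℤ) : ZMod N) • (f : ℍ → ℂ) := by
  funext z
  rw [← SL_slash, SL_slash_apply, hf.character γ hγ z, Pi.smul_apply, smul_eq_mul]
  have h : denom (γ : GL (Fin 2) ℝ) z = ((γ 1 0 : ℤ) : ℂ) * (z : ℂ) + ((γ 1 1 : ℤ) : ℂ) := by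
    simp [denom]
  have h0 := denom_ne_zero (γ : GL (Fin 2) ℝ) z
  rw [← h, mul_right_comm, mul_assoc (χ _), ← zpow_add₀ h0, add_neg_cancel, zpow_zero, mul_one]

theorem cuspForm_continuous (f : CuspFormGamma1 N K) : Continuous f :=
  (CuspFormClass.holo f).continuous

theorem one_mem_strictPeriods_Gamma1 (N : ℕ) : (1 : ℝ) ∈
    ((Gamma1 N).map (Matrix.SpecialLinearGroup.mapGL ℝ)).strictPeriods := by simp

theorem hasQExpansion_cuspForm (f : CuspFormGamma1 N K) :
    HasQExpansion f (fun n => (qExpansion 1 f).coeff n) := fun z => by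
  simpa only [qParam_one_pow] using
    ModularForm.hasSum_qExpansion f one_pos (one_mem_strictPeriods_Gamma1 N) z

theorem coeff_zero_cuspForm (f : CuspFormGamma1 N K) : (qExpansion 1 f).coeff 0 = 0 :=
  CuspFormClass.qExpansion_coeff_zero f one_pos (one_mem_strictPeriods_Gamma1 N)

/-- Otherwise `a(n) = c_n a(1)` makes every coefficient vanish. -/
theorem IsEigenform.coeff_one_ne_zero (hf : IsEigenform χ f) : (qExpansion 1 f).coeff 1 ≠ 0 := by
  intro h
  refine hf.ne_zero ?_
  ext z
  have h0 : ∀ n, (qExpansion 1 f).coeff n = 0 := fun n => by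
    rcases Nat.eq_zero_or_pos n with rfl | hn
    · exact coeff_zero_cuspForm f
    · obtain ⟨c, hc⟩ := hf.eigen n hn
      rw [(hasQExpansion_cuspForm f).coeff_eq_of_heckeT_eq hn.ne' hc, h, mul_zero]
  have h1 := hasQExpansion_cuspForm f z
  simp only [h0, zero_mul] at h1
  exact h1.unique hasSum_zero

/-- The matrix `(1 0; -N 1)`. -/
def lowerUnipotent (N : ℕ) : SL(2, ℤ) := ⟨!![1, 0; -(N : ℤ), 1], by simp⟩

/-- Translation by `1` after `W_N` becomes a lower unipotent element of `Γ₀(N)`, on which the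
character is trivial. Hence `f|W_N` has period 1. -/
theorem frickeGL_mul_T : frickeGL N * (ModularGroup.T : GL (Fin 2) ℝ) =
    (lowerUnipotent N : GL (Fin 2) ℝ) * frickeGL N := by
  have hcoe : ∀ (γ : SL(2, ℤ)) (i j : Fin 2), (γ : GL (Fin 2) ℝ) i j = ((γ i j : ℤ) : ℝ) :=
    fun _ _ _ => rfl
  ext i j
  rw [Matrix.GeneralLinearGroup.coe_mul, Matrix.GeneralLinearGroup.coe_mul, Matrix.mul_apply,
    Matrix.mul_apply]
  simp only [Fin.sum_univ_two, frickeGL, intGL_apply, hcoe]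
  fin_cases i <;> fin_cases j <;> simp [ModularGroup.T, lowerUnipotent]

theorem IsEigenform.fricke_hasQExpansion (hK : 0 < K) (hf : IsEigenform χ f) :
    HasQExpansion (fricke N K f) (fun n => (qExpansion 1 (fricke N K f)).coeff n) ∧
      (qExpansion 1 (fricke N K f)).coeff 0 = 0 := by
  rw [fricke_eq_slash]
  refine hasQExpansion_of_slash_T (K := K) ?_ ?_ ?_
  · rw [SL_smul_slash, SL_slash, ← SlashAction.slash_mul, frickeGL_mul_T, SlashAction.slash_mul,
      hf.slash_eq]
    · simp [lowerUnipotent]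
    · rw [Gamma0_mem]
      simp [lowerUnipotent]
  · exact ((CuspFormClass.holo f).slash K (frickeGL N)).const_smul _
  · obtain ⟨C, hC⟩ := CuspFormClass.petersson_bounded_left K _ f f
    refine isZeroAtImInfty_of_norm_petersson_le hK
      (B := ‖(N : ℂ) ^ (1 - (K : ℂ) / 2)‖ ^ 2 * (|(frickeGL N).det.val| ^ (K - 2) * C)) fun z => ?_
    have h1 : ∀ (c : ℂ) (u : ℍ → ℂ), ‖petersson K (c • u) (c • u) z‖ =
        ‖c‖ ^ 2 * ‖petersson K u u z‖ := fun c u => by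
      simp only [petersson, Pi.smul_apply, smul_eq_mul, norm_mul, Complex.norm_conj]
      ring
    rw [h1, petersson_slash, norm_mul, norm_σ, norm_zpow, Complex.norm_real, Real.norm_eq_abs,
      abs_abs]
    gcongr
    exact hC _

theorem exp_ofComplex_I_mul {t : ℝ} (ht : 0 < t) (n : ℕ) :
    Complex.exp (2 * π * Complex.I * (n * (ofComplex (Complex.I * t) : ℍ))) =
      (Real.exp (-(2 * π * n * t)) : ℝ) := by
  rw [ofComplex_apply_of_im_pos (by simpa using ht)]
  push_cast
  congr 1
  linear_combination (2 * π * n * t : ℂ) * Complex.I_sq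

/-- The coefficients of `f|W_N` are `b(1) c'_n` and those of `f` are `a(1) c_n` with `c_n = conj
c'_n`, so the first are a constant times the conjugates of the second. On the imaginary axis the
exponentials are real, so conjugating coefficients conjugates values. -/
theorem IsEigenform.exists_fricke_eq (hK : 0 < K) (hf : IsEigenform χ f) :
    ∃ C : ℂ, ∀ t : ℝ, 0 < t → fricke N K f (ofComplex (Complex.I * t)) =
      C * conj (f (ofComplex (Complex.I * t))) := by
  obtain ⟨hg, hg0⟩ := hf.fricke_hasQExpansion hK
  have hfq := hasQExpansion_cuspForm f
  have ha1 := hf.coeff_one_ne_zero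
  set a := fun n => (qExpansion 1 f).coeff n with ha
  set b := fun n => (qExpansion 1 (fricke N K f)).coeff n with hb
  obtain ⟨B, hB⟩ := CuspFormClass.petersson_bounded_left K _ f f
  have hf0 : (f : ℍ → ℂ) ≠ 0 := fun h => hf.ne_zero (DFunLike.coe_injective h)
  have ha1' : conj (a 1) ≠ 0 := (map_ne_zero _).2 ha1
  have hab : ∀ n, b n = b 1 / conj (a 1) * conj (a n) := fun n => by
    rcases Nat.eq_zero_or_pos n with rfl | hn
    · have h1 : a 0 = 0 := coeff_zero_cuspForm f
      have h2 : b 0 = 0 := hg0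
      rw [h1, h2]; simp
    · obtain ⟨c, hc⟩ := hf.eigen n hn
      obtain ⟨c', hc'⟩ := hf.eigen_adjoint n hn
      have hcc := heckeT_eigenvalue_eq_conj (cuspForm_continuous f) hf0 hB
        (fun γ hγ => hf.slash_eq hγ) hn hc hc'
      rw [hfq.coeff_eq_of_heckeT_eq hn.ne' hc, hg.coeff_eq_of_heckeT_eq hn.ne' hc', hcc, map_mul,
        Complex.conj_conj]
      field_simp
  refine ⟨b 1 / conj (a 1), fun t ht => ?_⟩
  have h1 := hg (ofComplex (Complex.I * t))
  have h2 := (Complex.hasSum_conj'.2 (hfq (ofComplex (Complex.I * t)))).mul_left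
    (b 1 / conj (a 1))
  refine h1.unique (h2.congr_fun fun n => ?_)
  rw [hab n, exp_ofComplex_I_mul ht, map_mul, Complex.conj_ofReal, mul_assoc]

end EigenformCoefficients

/-! ### Growth of the gamma function and its reciprocal -/

section GammaBounds

theorem exists_norm_Gamma_le_exp : ∃ C, 0 ≤ C ∧ ∀ z : ℂ, 1 / 2 ≤ z.re →
    ‖Complex.Gamma z‖ ≤ Real.exp (C * (1 + ‖z‖) ^ 2) ∧
      ‖(Complex.Gamma z)⁻¹‖ ≤ Real.exp (C * (1 + ‖z‖) ^ 2) := by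
  obtain ⟨C, hC0, hC⟩ := exists_norm_logGammaSeries_le (show (0 : ℝ) < 1 / 2 by norm_num)
  refine ⟨C, hC0, fun z hz => ?_⟩
  have h1 := abs_le.1 ((Complex.abs_re_le_norm _).trans (hC z hz))
  rw [← exp_logGammaSeries (by linarith), ← Complex.exp_neg, Complex.norm_exp, Complex.norm_exp]
  refine ⟨Real.exp_le_exp.2 h1.2, Real.exp_le_exp.2 ?_⟩
  rw [Complex.neg_re]
  linarith [h1.1]

theorem inv_Gamma_eq {z : ℂ} (hz : z.re < 1) : (Complex.Gamma z)⁻¹ =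
    Complex.Gamma (1 - z) * Complex.sin (Real.pi * z) / Real.pi := by
  have hpi : (Real.pi : ℂ) ≠ 0 := by exact_mod_cast Real.pi_ne_zero
  have h0 : Complex.Gamma (1 - z) ≠ 0 :=
    Complex.Gamma_ne_zero_of_re_pos (by simpa using hz)
  have h := Complex.Gamma_mul_Gamma_one_sub z
  rcases eq_or_ne (Complex.sin (Real.pi * z)) 0 with hs | hs
  · rw [hs, div_zero] at h
    rw [(mul_eq_zero.1 h).resolve_right h0, hs]
    simp
  · have hG : Complex.Gamma z ≠ 0 := by
      intro hG
      rw [hG, zero_mul] at h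
      exact div_ne_zero hpi hs h.symm
    rw [eq_div_iff hs] at h
    rw [inv_eq_iff_eq_inv, inv_div, eq_div_iff (mul_ne_zero h0 hs), ← mul_assoc, h]

theorem norm_sin_le (z : ℂ) : ‖Complex.sin z‖ ≤ Real.exp ‖z‖ := by
  have h1 : ∀ w : ℂ, ‖w‖ = ‖z‖ → ‖Complex.exp w‖ ≤ Real.exp ‖z‖ := fun w hw => by
    rw [Complex.norm_exp, ← hw]
    exact Real.exp_le_exp.2 (Complex.re_le_norm w)
  rw [Complex.sin, norm_div, norm_mul, Complex.norm_I, mul_one, Complex.norm_ofNat,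
    div_le_iff₀ (by norm_num)]
  refine (norm_sub_le _ _).trans ?_
  have h2 := h1 (-z * Complex.I) (by simp)
  have h3 := h1 (z * Complex.I) (by simp)
  linarith

/-- For `Re z ≥ 1/2` this is the logarithmic series; the reflection formula reduces the rest of the
plane to it at the cost of a sine. -/
theorem exists_norm_inv_Gamma_le_exp : ∃ C, 0 ≤ C ∧ ∀ z : ℂ,
    ‖(Complex.Gamma z)⁻¹‖ ≤ Real.exp (C * (1 + ‖z‖) ^ 2) := by
  obtain ⟨C, hC0, hC⟩ := exists_norm_Gamma_le_exp
  refine ⟨4 * C + Real.pi, by positivity, fun z => ?_⟩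
  have hz := norm_nonneg z
  rcases le_total (1 / 2) z.re with h | h
  · refine ((hC z h).2).trans (Real.exp_le_exp.2 ?_)
    gcongr
    linarith [Real.pi_pos]
  · rw [inv_Gamma_eq (by linarith), norm_div, norm_mul, Complex.norm_real,
      Real.norm_of_nonneg Real.pi_pos.le, div_le_iff₀ Real.pi_pos]
    have h1 := (hC (1 - z) (by simp; linarith)).1
    have h2 : ‖1 - z‖ ≤ 1 + ‖z‖ := (norm_sub_le _ _).trans (by simp)
    have h3 := norm_sin_le (Real.pi * z)
    rw [norm_mul, Complex.norm_real, Real.norm_of_nonneg Real.pi_pos.le] at h3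
    calc _ ≤ Real.exp (C * (1 + ‖1 - z‖) ^ 2) * Real.exp (Real.pi * ‖z‖) := by gcongr
      _ ≤ Real.exp ((4 * C + Real.pi) * (1 + ‖z‖) ^ 2) := by
        rw [← Real.exp_add, add_mul]
        refine Real.exp_le_exp.2 (add_le_add ?_ ?_)
        · rw [mul_comm 4 C, mul_assoc]
          refine mul_le_mul_of_nonneg_left ?_ hC0
          nlinarith [norm_nonneg (1 - z)]
        · refine mul_le_mul_of_nonneg_left ?_ Real.pi_pos.le
          nlinarith
      _ ≤ _ := le_mul_of_one_le_right (Real.exp_pos _).le (by linarith [Real.pi_gt_three])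

end GammaBounds

/-! ### Mean square of the Fourier coefficients -/

section CoefficientBounds

open MeasureTheory UpperHalfPlane CongruenceSubgroup
open scoped MatrixGroups Real ComplexConjugate

variable {N : ℕ} [NeZero N] {K : ℤ} (f : CuspFormGamma1 N K)

/-- Parseval on the horizontal line at height `1/n`, where `|f|² ≤ B n^K`. For `m ≤ n` the weight
`exp (2π m y)` is at most `exp (2π)`, whose square is the constant. -/
theorem exists_sum_norm_coeff_sq_le : ∃ C, 0 ≤ C ∧ ∀ n : ℕ, 1 ≤ n →
    ∑ m ∈ Finset.Icc 1 n, ‖(qExpansion 1 f).coeff m‖ ^ 2 ≤ C * (n : ℝ) ^ K := by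
  obtain ⟨B, hB⟩ := CuspFormClass.petersson_bounded_left K _ f f
  have hB0 : 0 ≤ B := (norm_nonneg _).trans (hB UpperHalfPlane.I)
  refine ⟨Real.exp (4 * π) * B, by positivity, fun n hn => ?_⟩
  have hn0 : (0 : ℝ) < n := by exact_mod_cast hn
  set y : ℝ := (n : ℝ)⁻¹ with hy
  have hy0 : 0 < y := inv_pos.2 hn0
  let g : ℝ → ℂ := fun x => f ⟨x + y * Complex.I, by simpa using hy0⟩
  have hgB : ∀ x, ‖g x‖ ^ 2 ≤ B * (n : ℝ) ^ K := fun x => by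
    have h1 := hB ⟨x + y * Complex.I, by simpa using hy0⟩
    rw [petersson_self, Complex.norm_real, Real.norm_of_nonneg
      (mul_nonneg (sq_nonneg _) (zpow_nonneg (UpperHalfPlane.im_pos _).le _))] at h1
    have h2 : (⟨x + y * Complex.I, by simpa using hy0⟩ : ℍ).im = y := by
      simp [UpperHalfPlane.im]
    have h3 : y ^ K = ((n : ℝ) ^ K)⁻¹ := by rw [hy, inv_zpow]
    rw [h2, h3, ← div_eq_mul_inv, div_le_iff₀ (by positivity)] at h1
    exact h1
  have hgc : Continuous g := by
    refine (CuspFormClass.holo f).continuous.comp ?_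
    refine UpperHalfPlane.isEmbedding_coe.continuous_iff.2 ?_
    change Continuous fun x : ℝ => (x : ℂ) + y * Complex.I
    fun_prop
  have hL2 : MemLp g 2 (volume.restrict (Set.Ioc 0 1)) := by
    refine MemLp.of_bound hgc.aestronglyMeasurable (Real.sqrt (B * (n : ℝ) ^ K))
      (ae_of_all _ fun x => Real.le_sqrt_of_sq_le (hgB x))
  have hP := hasSum_sq_fourierCoeffOn zero_lt_one hL2
  have hint : (1 - 0 : ℝ)⁻¹ • ∫ x in (0 : ℝ)..1, ‖g x‖ ^ 2 ≤ B * (n : ℝ) ^ K := by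
    have h1 : ∫ x in (0 : ℝ)..1, ‖g x‖ ^ 2 ≤ ∫ x in (0 : ℝ)..1, B * (n : ℝ) ^ K :=
      intervalIntegral.integral_mono_on zero_le_one
        ((hgc.norm.pow 2).intervalIntegrable _ _) (by simp) fun x _ => hgB x
    simpa using h1
  have hcoeff : ∀ m : ℕ, ‖(qExpansion 1 f).coeff m‖ =
      Real.exp (2 * π * m * y) * ‖fourierCoeffOn zero_lt_one g m‖ := fun m => by
    have hcast : Fact (IsCusp OnePoint.infty
      ((Gamma1 N).map (Matrix.SpecialLinearGroup.mapGL ℝ))) := inferInstance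
    rw [qExpansion_coeff_eq_intervalIntegral one_pos
      (SlashInvariantFormClass.periodic_comp_ofComplex f (one_mem_strictPeriods_Gamma1 N))
      (CuspFormClass.holo f) (ModularFormClass.bdd_at_infty f) m hy0, fourierCoeffOn_eq_integral,
      ← Complex.norm_of_nonneg (Real.exp_pos (2 * π * m * y)).le, ← norm_mul]
    congr 1
    rw [sub_zero, div_one, one_smul, Complex.ofReal_one, div_one, one_mul,
      ← intervalIntegral.integral_const_mul]
    refine intervalIntegral.integral_congr fun x _ => ?_
    simp only [g, smul_eq_mul]
    rw [qParam_one_pow, fourier_coe_apply, one_div, ← Complex.exp_neg]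
    refine Eq.trans (congrArg (· * _) ?_) (mul_assoc _ _ _)
    push_cast
    rw [← Complex.exp_add]
    congr 1
    linear_combination (-(2 * π * m * y) : ℂ) * Complex.I_sq
  have hle : ∀ m ∈ Finset.Icc 1 n, ‖(qExpansion 1 f).coeff m‖ ^ 2 ≤
      Real.exp (4 * π) * ‖fourierCoeffOn zero_lt_one g m‖ ^ 2 := fun m hm => by
    rw [hcoeff, mul_pow, ← Real.exp_nat_mul]
    refine mul_le_mul_of_nonneg_right (Real.exp_le_exp.2 ?_) (sq_nonneg _)
    have h1 : (m : ℝ) * y ≤ 1 := by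
      rw [hy, ← div_eq_mul_inv, div_le_one hn0]
      exact_mod_cast (Finset.mem_Icc.1 hm).2
    push_cast
    nlinarith [Real.pi_pos]
  refine (Finset.sum_le_sum hle).trans ?_
  rw [← Finset.mul_sum, mul_assoc]
  refine mul_le_mul_of_nonneg_left ?_ (Real.exp_pos _).le
  refine le_trans ?_ hint
  have h2 := sum_le_hasSum ((Finset.Icc 1 n).map ⟨fun m : ℕ => (m : ℤ), Nat.cast_injective⟩)
    (fun i _ => sq_nonneg _) hP
  simpa using h2

/-- Cauchy–Schwarz gives `∑_{m ≤ n} |a(m)| ≪ n^((K+1)/2)`. After the normalizing shift this is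
convergence for `Re s > 1`; no pointwise Ramanujan bound is needed. -/
theorem LSeriesSummable_coeff (hK : 0 < K) {s : ℂ} (hs : ((K : ℝ) + 1) / 2 < s.re) :
    LSeriesSummable (fun n => (qExpansion 1 f).coeff n) s := by
  obtain ⟨C, hC0, hC⟩ := exists_sum_norm_coeff_sq_le f
  have hK' : (0 : ℝ) < K := by exact_mod_cast hK
  refine LSeriesSummable_of_sum_norm_bigO (r := ((K : ℝ) + 1) / 2) ?_ (by positivity) hs
  refine IsBigO.of_bound (Real.sqrt C) ?_
  filter_upwards [eventually_ge_atTop 1] with n hn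
  have hn0 : (0 : ℝ) < n := by exact_mod_cast hn
  rw [Real.norm_of_nonneg (Finset.sum_nonneg fun _ _ => norm_nonneg _),
    Real.norm_of_nonneg (by positivity)]
  refine le_of_sq_le_sq ?_ (by positivity)
  have h1 := sq_sum_le_card_mul_sum_sq (s := Finset.Icc 1 n)
    (f := fun m => ‖(qExpansion 1 f).coeff m‖)
  rw [Nat.card_Icc, Nat.add_sub_cancel] at h1
  refine h1.trans ?_
  rw [mul_pow, Real.sq_sqrt hC0, ← Real.rpow_natCast (_ ^ _), ← Real.rpow_mul hn0.le]
  have h2 : ((K : ℝ) + 1) / 2 * (2 : ℕ) = 1 + (K : ℝ) := by push_cast; ring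
  rw [h2, Real.rpow_add hn0, Real.rpow_one, Real.rpow_intCast]
  nlinarith [hC n hn]

end CoefficientBounds

/-! ### The completed L-function and its functional equation -/

section CompletedLFunction

open MeasureTheory UpperHalfPlane CongruenceSubgroup
open scoped MatrixGroups Real ComplexConjugate

theorem mellin_conj (F : ℝ → ℂ) (s : ℂ) :
    mellin (fun t => conj (F t)) s = conj (mellin F (conj s)) := by
  rw [mellin, mellin, ← integral_conj]
  refine setIntegral_congr_fun measurableSet_Ioi fun t ht => ?_
  have ht' : (t : ℂ).arg ≠ π := by
    rw [Complex.arg_ofReal_of_nonneg (le_of_lt ht)]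
    exact Real.pi_pos.ne
  simp only [smul_eq_mul, map_mul]
  have h := Complex.conj_cpow (t : ℂ) (s - 1) ht'
  rw [Complex.conj_ofReal] at h
  rw [h]
  simp

variable {N : ℕ} [NeZero N] {K : ℤ} {χ : DirichletCharacter ℂ N} (hK : 0 < K)
  {f : CuspFormGamma1 N K}

theorem L_eq_mul_inv_Gamma (s : ℂ) : ModularForm.L hK f s =
    ModularForm.Λ hK f s * (2 * π : ℂ) ^ s * (Complex.Gamma s)⁻¹ := by
  rw [ModularForm.L, Complex.Gammaℂ, Complex.cpow_neg, mul_assoc (ModularForm.Λ hK f s),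
    mul_assoc 2, div_eq_mul_inv, mul_inv,
    mul_inv, inv_inv]
  ring

/-- The series formula on `Re s > K/2 + 1` extends by the identity theorem to the larger half-plane
given by the mean-square bound. -/
theorem L_eq_LSeries {s : ℂ} (hs : ((K : ℝ) + 1) / 2 < s.re) :
    ModularForm.L hK f s = LSeries (fun n => (qExpansion 1 f).coeff n) s := by
  set a := fun n => (qExpansion 1 f).coeff n with ha
  have ha0 : a 0 = 0 := coeff_zero_cuspForm f
  have hopen : IsOpen {s : ℂ | (K : ℝ) / 2 + 1 < s.re} :=
    isOpen_lt continuous_const Complex.continuous_re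
  have habs : LSeries.abscissaOfAbsConv a ≤ (((K : ℝ) + 1) / 2 : ℝ) :=
    LSeries.abscissaOfAbsConv_le_of_forall_lt_LSeriesSummable' fun y hy => by
      refine LSeriesSummable_coeff f hK ?_
      simpa using hy
  have h1 : AnalyticOnNhd ℂ (LSeries a) {s : ℂ | ((K : ℝ) + 1) / 2 < s.re} := fun z hz =>
    LSeries_analyticOnNhd a z (habs.trans_lt (by exact_mod_cast hz))
  have h2 : AnalyticOnNhd ℂ (ModularForm.L hK f) {s : ℂ | ((K : ℝ) + 1) / 2 < s.re} :=
    fun z _ => (CuspForm.differentiable_L hK f).analyticAt z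
  refine h2.eqOn_of_preconnected_of_eventuallyEq h1
    (convex_halfSpace_re_gt _).isPreconnected (z₀ := ((K : ℝ) / 2 + 2 : ℝ)) ?_ ?_ hs
  · simp only [Set.mem_ofPred_eq, Complex.ofReal_re]; linarith
  · filter_upwards [hopen.mem_nhds (show (K : ℝ) / 2 + 1 < (((K : ℝ) / 2 + 2 : ℝ) : ℂ).re by
      rw [Complex.ofReal_re]; linarith)] with z hz
    have h3 := CuspForm.hasSum_L hK f hz
    rw [strictWidthInfty_Gamma1, Complex.ofReal_one, Complex.one_cpow, one_mul] at h3
    refine h3.unique ?_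
    have hz' : LSeriesSummable a z := by
      refine LSeriesSummable_coeff f hK ?_
      have : (K : ℝ) / 2 + 1 < z.re := hz
      linarith
    refine hz'.LSeriesHasSum.congr_fun fun n => ?_
    rcases Nat.eq_zero_or_pos n with rfl | hn
    · change a 0 / _ = _
      rw [ha0]; simp
    · rw [LSeries.term_of_ne_zero hn.ne']

theorem L_ne_zero (h1 : (qExpansion 1 f).coeff 1 ≠ 0) : ModularForm.L hK f ≠ 0 := by
  intro h
  set a := fun n => (qExpansion 1 f).coeff n with ha
  have h2 : (fun x : ℝ => LSeries a x) =ᶠ[atTop] 0 := by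
    filter_upwards [eventually_gt_atTop (((K : ℝ) + 1) / 2)] with x hx
    rw [← L_eq_LSeries hK (by simpa using hx), h]
    rfl
  rcases LSeries_eventually_eq_zero_iff'.1 h2 with h3 | h3
  · exact h1 (h3 1 one_ne_zero)
  · have h4 := (LSeriesSummable_coeff f hK (s := (((K : ℝ) + 1) / 2 + 1 : ℝ))
      (by rw [Complex.ofReal_re]; linarith)).abscissaOfAbsConv_le
    change LSeries.abscissaOfAbsConv a ≤ _ at h4
    rw [h3] at h4
    exact absurd h4 (not_le.2 (EReal.coe_lt_top _))

/-- Mellin transform of `F(1/(Nt)) = const · t^K conj (F(t))`, which is the proportionality of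
`f|W_N` and `conj f` on the imaginary axis. -/
theorem IsEigenform.exists_Lambda_eq (hf : IsEigenform χ f) : ∃ ω : ℂ, ‖ω‖ = 1 ∧ ∀ s : ℂ,
    ModularForm.Λ hK f s =
      ω * (N : ℂ) ^ ((K : ℂ) / 2 - s) * conj (ModularForm.Λ hK f (K - conj s)) := by
  obtain ⟨C, hC⟩ := hf.exists_fricke_eq hK
  have hN0 : (0 : ℝ) < N := by exact_mod_cast Nat.pos_of_ne_zero (NeZero.ne N)
  have hN : (N : ℂ) ≠ 0 := by exact_mod_cast hN0.ne'
  set F : ℝ → ℂ := fun t => f (ofComplex (Complex.I * t)) with hF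
  have hΛ : ModularForm.Λ hK f = mellin F := CuspForm.Λ_eq_mellin hK f
  have hFe : ∀ t : ℝ, 0 < t → F ((N * t)⁻¹) =
      (C * (N : ℂ) ^ ((K : ℂ) / 2) * Complex.I ^ K) * ((t : ℂ) ^ (K : ℂ) * conj (F t)) := by
    intro t ht
    have h1 := hC t ht
    have ht0 : (t : ℂ) ≠ 0 := by exact_mod_cast ht.ne'
    rw [fricke, ofComplex_apply_of_im_pos (by simpa using ht)] at h1
    have h2 : -1 / ((N : ℂ) * (Complex.I * t)) = Complex.I * ((N * t)⁻¹ : ℝ) := by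
      push_cast
      field_simp
      rw [Complex.I_sq]
    simp only at h1
    rw [h2] at h1
    have h3 : F t = f ⟨Complex.I * t, by simpa using ht⟩ := by
      rw [hF]
      simp only
      rw [ofComplex_apply_of_im_pos (by simpa using ht)]
    rw [← h3] at h1
    have h4 : (N : ℂ) ^ (-(K : ℂ) / 2) * (N : ℂ) ^ ((K : ℂ) / 2) = 1 := by
      rw [← Complex.cpow_add _ _ hN, neg_div, neg_add_cancel, Complex.cpow_zero]
    have h5 : (Complex.I * (t : ℂ)) ^ (-K) * (Complex.I ^ K * (t : ℂ) ^ K) = 1 := by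
      rw [← mul_zpow, ← zpow_add₀ (mul_ne_zero Complex.I_ne_zero ht0), neg_add_cancel, zpow_zero]
    rw [Complex.cpow_intCast]
    change f (ofComplex (Complex.I * ((N * t)⁻¹ : ℝ))) = _
    linear_combination (N : ℂ) ^ ((K : ℂ) / 2) * (Complex.I ^ K * (t : ℂ) ^ K) * h1 -
      f (ofComplex (Complex.I * ((N * t)⁻¹ : ℝ))) * h4 * 1 -
      f (ofComplex (Complex.I * ((N * t)⁻¹ : ℝ))) * (N : ℂ) ^ (-(K : ℂ) / 2) *
        (N : ℂ) ^ ((K : ℂ) / 2) * h5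
  have hmain : ∀ s : ℂ, ModularForm.Λ hK f s = (C * Complex.I ^ K) * (N : ℂ) ^ ((K : ℂ) / 2 - s) *
      conj (ModularForm.Λ hK f (K - conj s)) := fun s => by
    have h1 : mellin (fun t => F ((N * t)⁻¹)) (-s) = (N : ℂ) ^ s * mellin F s := by
      have h2 := mellin_comp_mul_left (fun t => F t⁻¹) (-s) hN0
      rw [mellin_comp_inv, neg_neg, smul_eq_mul] at h2
      exact_mod_cast h2
    have h3 : mellin (fun t => F ((N * t)⁻¹)) (-s) =
        (C * (N : ℂ) ^ ((K : ℂ) / 2) * Complex.I ^ K) * conj (mellin F (K - conj s)) := by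
      have h4 : mellin (fun t => F ((N * t)⁻¹)) (-s) = mellin (fun t =>
          (C * (N : ℂ) ^ ((K : ℂ) / 2) * Complex.I ^ K) • ((t : ℂ) ^ (K : ℂ) • conj (F t))) (-s) :=
        setIntegral_congr_fun measurableSet_Ioi fun t ht => by
          simp only [smul_eq_mul]
          rw [hFe t ht]
      rw [h4, mellin_const_smul, mellin_cpow_smul, mellin_conj, smul_eq_mul]
      congr 3
      rw [map_add, map_neg, map_intCast]
      ring
    rw [hΛ]
    rw [h1] at h3
    rw [Complex.cpow_sub _ _ hN]
    have h5 : (N : ℂ) ^ s ≠ 0 := (Complex.cpow_ne_zero_iff.2 (Or.inl hN))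
    field_simp
    linear_combination h3
  refine ⟨C * Complex.I ^ K, ?_, hmain⟩
  -- Applying the equation twice yields `Λ = |ω|² Λ`, so one nonzero value of `Λ` gives `|ω| = 1`.
  obtain ⟨s, hs⟩ : ∃ s, ModularForm.Λ hK f s ≠ 0 := by
    by_contra! h
    refine L_ne_zero hK hf.coeff_one_ne_zero (funext fun s => ?_)
    rw [L_eq_mul_inv_Gamma, h s]
    simp
  set ω := C * Complex.I ^ K
  have h1 := hmain s
  have h2 := congrArg conj (hmain (K - conj s))
  have h3 : (K : ℂ) - conj (K - conj s) = s := by simp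
  have hNarg : (N : ℂ).arg ≠ π := by
    rw [Complex.natCast_arg]; exact Real.pi_pos.ne
  have hcj : ∀ w : ℂ, conj ((N : ℂ) ^ w) = (N : ℂ) ^ conj w := fun w => by
    rw [Complex.cpow_conj _ _ hNarg, Complex.conj_natCast]
  rw [h3, map_mul, map_mul, Complex.conj_conj, hcj] at h2
  rw [h2] at h1
  have h4 : (N : ℂ) ^ ((K : ℂ) / 2 - s) * (N : ℂ) ^ (conj ((K : ℂ) / 2 - (K - conj s))) = 1 := by
    rw [← Complex.cpow_add _ _ hN]
    convert Complex.cpow_zero (N : ℂ) using 2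
    have h2 : conj (2 : ℂ) = 2 := Complex.conj_ofNat 2
    simp only [map_sub, map_div₀, map_intCast, Complex.conj_conj, h2]
    ring
  have h5 : ω * conj ω = 1 := by
    refine mul_right_cancel₀ hs ?_
    linear_combination -h1 - ω * conj ω * ModularForm.Λ hK f s * h4
  rw [Complex.mul_conj'] at h5
  have h6 : ‖ω‖ ^ 2 = 1 := by exact_mod_cast h5
  nlinarith [norm_nonneg ω]

end CompletedLFunction

/-! ### Finite order of the L-function -/

section FiniteOrder

open MeasureTheory UpperHalfPlane CongruenceSubgroup
open scoped MatrixGroups Real ComplexConjugate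

theorem le_exp_mul_one_add_sq {B x : ℝ} (hB : 0 ≤ B) (hx : 0 ≤ x) :
    B ≤ Real.exp (B * (1 + x) ^ 2) := by
  refine le_trans ?_ (Real.add_one_le_exp _)
  nlinarith [mul_nonneg hB hx, mul_nonneg hB (sq_nonneg x)]

/-- For `t > 0` the kernel `t^(Re s - 1)` is dominated by the sum of its values at the two edges of
the strip. -/
theorem norm_mellin_le {F : ℝ → ℂ} {a b : ℝ} (ha : MellinConvergent F a)
    (hb : MellinConvergent F b) {s : ℂ} (has : a ≤ s.re) (hsb : s.re ≤ b) :
    ‖mellin F s‖ ≤ (∫ t in Set.Ioi (0 : ℝ), ‖(t : ℂ) ^ ((a : ℂ) - 1) • F t‖) +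
      ∫ t in Set.Ioi (0 : ℝ), ‖(t : ℂ) ^ ((b : ℂ) - 1) • F t‖ := by
  rw [← integral_add ha.norm hb.norm]
  refine norm_integral_le_of_norm_le (ha.norm.add hb.norm) ?_
  filter_upwards [ae_restrict_mem measurableSet_Ioi] with t ht
  have ht' : 0 < t := ht
  simp only [norm_smul, Complex.norm_cpow_eq_rpow_re_of_pos ht', Complex.sub_re,
    Complex.ofReal_re, Complex.one_re]
  rw [← add_mul]
  refine mul_le_mul_of_nonneg_right ?_ (norm_nonneg _)
  rcases le_total 1 t with h | h
  · have h1 := Real.rpow_le_rpow_of_exponent_le h (by linarith : s.re - 1 ≤ b - 1)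
    have h2 := Real.rpow_nonneg ht'.le (a - 1)
    linarith
  · have h1 := Real.rpow_le_rpow_of_exponent_ge ht' h (by linarith : a - 1 ≤ s.re - 1)
    have h2 := Real.rpow_nonneg ht'.le (b - 1)
    linarith

variable {N : ℕ} [NeZero N] {K : ℤ} {χ : DirichletCharacter ℂ N} (hK : 0 < K)
  {f : CuspFormGamma1 N K}

theorem exists_norm_L_le {b : ℝ} (hb : ((K : ℝ) + 1) / 2 < b) :
    ∃ C, 0 ≤ C ∧ ∀ s : ℂ, b ≤ s.re → ‖ModularForm.L hK f s‖ ≤ C := by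
  set a := fun n => (qExpansion 1 f).coeff n with ha
  have hb' : LSeriesSummable a (b : ℂ) := LSeriesSummable_coeff f hK (by simpa using hb)
  refine ⟨∑' n, ‖LSeries.term a b n‖, tsum_nonneg fun _ => norm_nonneg _, fun s hs => ?_⟩
  rw [L_eq_LSeries hK (by linarith)]
  exact tsum_of_norm_bounded hb'.norm.hasSum fun n =>
    LSeries.norm_term_le_of_re_le_re a (by simpa using hs) n

theorem exists_norm_two_pi_cpow_le : ∃ C, 0 ≤ C ∧ ∀ s : ℂ,
    ‖(2 * π : ℂ) ^ s‖ ≤ Real.exp (C * (1 + ‖s‖) ^ 2) := by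
  have h2 : (1 : ℝ) ≤ 2 * π := by linarith [Real.pi_gt_three]
  refine ⟨Real.log (2 * π), Real.log_nonneg h2, fun s => ?_⟩
  rw [← Complex.ofReal_ofNat, ← Complex.ofReal_mul,
    Complex.norm_cpow_eq_rpow_re_of_pos (by linarith), Real.rpow_def_of_pos (by linarith)]
  refine Real.exp_le_exp.2 (mul_le_mul_of_nonneg_left ?_ (Real.log_nonneg h2))
  nlinarith [Complex.re_le_norm s, norm_nonneg s]

theorem exists_norm_Lambda_le_right : ∃ b C : ℝ, (K : ℝ) / 2 < b ∧ 0 ≤ C ∧ ∀ s : ℂ, b ≤ s.re →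
    ‖ModularForm.Λ hK f s‖ ≤ Real.exp (C * (1 + ‖s‖) ^ 2) := by
  have hK' : (0 : ℝ) < K := by exact_mod_cast hK
  obtain ⟨B, hB0, hB⟩ := exists_norm_L_le hK (f := f)
    (show ((K : ℝ) + 1) / 2 < (K : ℝ) / 2 + 1 by linarith)
  obtain ⟨C, hC0, hC⟩ := exists_norm_Gamma_le_exp
  refine ⟨(K : ℝ) / 2 + 1, B + C, by linarith, by positivity, fun s hs => ?_⟩
  have hG := Complex.Gamma_ne_zero_of_re_pos (show 0 < s.re by linarith)
  have hpi : (2 * π : ℂ) ≠ 0 := by exact_mod_cast Real.two_pi_pos.ne'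
  have h1 : ModularForm.Λ hK f s =
      ModularForm.L hK f s * ((2 * π : ℂ) ^ (-s) * Complex.Gamma s) := by
    rw [L_eq_mul_inv_Gamma, Complex.cpow_neg]
    have := (Complex.cpow_ne_zero_iff (y := s)).2 (Or.inl hpi)
    field_simp
  have h2 : ‖(2 * π : ℂ) ^ (-s)‖ ≤ 1 := by
    rw [← Complex.ofReal_ofNat, ← Complex.ofReal_mul,
      Complex.norm_cpow_eq_rpow_re_of_pos Real.two_pi_pos]
    refine Real.rpow_le_one_of_one_le_of_nonpos (by linarith [Real.pi_gt_three]) ?_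
    rw [Complex.neg_re]
    linarith
  rw [h1, norm_mul, norm_mul, add_mul, Real.exp_add]
  refine mul_le_mul ((hB s hs).trans (le_exp_mul_one_add_sq hB0 (norm_nonneg s))) ?_
    (by positivity) (by positivity)
  have h3 := (hC s (by linarith)).1
  calc _ ≤ 1 * ‖Complex.Gamma s‖ := mul_le_mul_of_nonneg_right h2 (norm_nonneg _)
    _ ≤ _ := by rwa [one_mul]

/-- Three ranges: far right by the Dirichlet series and the gamma factor, a middle strip by absolute
convergence of the Mellin integral, and the left by the functional equation. -/
theorem IsEigenform.exists_norm_Lambda_le (hf : IsEigenform χ f) : ∃ C, 0 ≤ C ∧ ∀ s : ℂ,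
    ‖ModularForm.Λ hK f s‖ ≤ Real.exp (C * (1 + ‖s‖) ^ 2) := by
  have hK' : (0 : ℝ) < K := by exact_mod_cast hK
  obtain ⟨b, C, hb, hC0, hC⟩ := exists_norm_Lambda_le_right hK (f := f)
  obtain ⟨ω, hω, hΛ⟩ := hf.exists_Lambda_eq hK
  have hN1 : (1 : ℝ) ≤ N := by exact_mod_cast Nat.one_le_iff_ne_zero.2 (NeZero.ne N)
  have hconv : ∀ s, MellinConvergent (fun t : ℝ => f (ofComplex (Complex.I * t))) s := fun s =>
    ((CuspForm.isStrongFEPair hK f).hasMellin s).1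
  set D := (∫ t in Set.Ioi (0 : ℝ), ‖(t : ℂ) ^ (((K - b : ℝ) : ℂ) - 1) •
      f (ofComplex (Complex.I * t))‖) +
    ∫ t in Set.Ioi (0 : ℝ), ‖(t : ℂ) ^ ((b : ℂ) - 1) • f (ofComplex (Complex.I * t))‖
  have hD0 : 0 ≤ D := add_nonneg (integral_nonneg fun _ => norm_nonneg _)
    (integral_nonneg fun _ => norm_nonneg _)
  have hlog := Real.log_nonneg hN1
  refine ⟨D + Real.log N * K + C * (1 + K) ^ 2, by positivity, fun s => ?_⟩
  have hs0 := norm_nonneg s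
  rcases le_total b s.re with h | h
  · refine (hC s h).trans (Real.exp_le_exp.2 (mul_le_mul_of_nonneg_right ?_ (by positivity)))
    nlinarith [mul_nonneg hlog hK'.le, mul_nonneg hC0 hK'.le, mul_nonneg hC0 (sq_nonneg (K : ℝ))]
  rcases le_total (K - b : ℝ) s.re with h' | h'
  · rw [CuspForm.Λ_eq_mellin]
    refine (norm_mellin_le (hconv _) (hconv _) h' h).trans
      ((le_exp_mul_one_add_sq hD0 hs0).trans (Real.exp_le_exp.2
        (mul_le_mul_of_nonneg_right ?_ (by positivity))))
    nlinarith [mul_nonneg hlog hK'.le, mul_nonneg hC0 (sq_nonneg (1 + K : ℝ))]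
  · have hre : b ≤ ((K : ℂ) - conj s).re := by
      rw [Complex.sub_re, Complex.conj_re, Complex.intCast_re]
      linarith
    have hKs : ‖(K : ℂ) - conj s‖ ≤ K + ‖s‖ := by
      refine (norm_sub_le _ _).trans ?_
      rw [Complex.norm_conj, Complex.norm_intCast, abs_of_pos hK']
    rw [hΛ s, norm_mul, norm_mul, hω, one_mul, Complex.norm_conj, ← Complex.ofReal_natCast,
      Complex.norm_cpow_eq_rpow_re_of_pos (by linarith), Real.rpow_def_of_pos (by linarith)]
    refine (mul_le_mul_of_nonneg_left (hC _ hre) (Real.exp_pos _).le).trans ?_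
    rw [← Real.exp_add]
    refine Real.exp_le_exp.2 ?_
    have hre2 : ((K : ℂ) / 2 - s).re ≤ K * (1 + ‖s‖) ^ 2 := by
      have e : ((K : ℂ) / 2 - s).re = (K : ℝ) / 2 - s.re := by simp
      have h1 := (abs_le.1 (Complex.abs_re_le_norm s)).1
      have hK1 : (1 : ℝ) ≤ K := by exact_mod_cast hK
      rw [e]
      nlinarith [mul_nonneg (sub_nonneg.2 hK1) hs0, mul_nonneg hK'.le (sq_nonneg ‖s‖)]
    have h3 := mul_le_mul_of_nonneg_left hre2 hlog
    have h4 : (1 + ‖(K : ℂ) - conj s‖) ^ 2 ≤ (1 + K) ^ 2 * (1 + ‖s‖) ^ 2 := by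
      rw [← mul_pow]
      refine pow_le_pow_left₀ (by positivity) ?_ 2
      nlinarith [mul_nonneg hK'.le hs0]
    have h5 := mul_le_mul_of_nonneg_left h4 hC0
    have h6 := mul_nonneg hD0 (sq_nonneg (1 + ‖s‖))
    nlinarith

theorem IsEigenform.exists_norm_L_le_exp (hf : IsEigenform χ f) : ∃ C, 0 ≤ C ∧ ∀ s : ℂ,
    ‖ModularForm.L hK f s‖ ≤ Real.exp (C * (1 + ‖s‖) ^ 2) := by
  obtain ⟨C₁, h₁, hC₁⟩ := hf.exists_norm_Lambda_le hK
  obtain ⟨C₂, h₂, hC₂⟩ := exists_norm_two_pi_cpow_le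
  obtain ⟨C₃, h₃, hC₃⟩ := exists_norm_inv_Gamma_le_exp
  refine ⟨C₁ + C₂ + C₃, by positivity, fun s => ?_⟩
  rw [L_eq_mul_inv_Gamma, norm_mul, norm_mul, add_mul, add_mul, Real.exp_add, Real.exp_add]
  exact mul_le_mul (mul_le_mul (hC₁ s) (hC₂ s) (norm_nonneg _) (Real.exp_pos _).le) (hC₃ s)
    (norm_nonneg _) (by positivity)

/-- Exponent `3` in place of `2` absorbs all constants, including those of the affine substitution.
-/
theorem isBigO_exp_of_norm_le_comp_affine {G : ℂ → ℂ} {C : ℝ} (hC0 : 0 ≤ C)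
    (hG : ∀ s, ‖G s‖ ≤ Real.exp (C * (1 + ‖s‖) ^ 2)) (α β : ℂ) :
    (fun s => G (α * s + β)) =O[Bornology.cobounded ℂ]
      fun s : ℂ => Real.exp (‖s‖ ^ (3 : ℝ)) := by
  refine IsBigO.of_bound 1 ?_
  set D := 1 + ‖α‖ + ‖β‖
  have hD : 0 ≤ D := by positivity
  filter_upwards [tendsto_norm_cobounded_atTop.eventually_ge_atTop (1 + C * (2 * D) ^ 2)]
    with s hs
  have hs1 : 1 ≤ ‖s‖ := by nlinarith [mul_nonneg hC0 (sq_nonneg (2 * D))]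
  rw [one_mul, Real.norm_of_nonneg (Real.exp_pos _).le]
  refine (hG _).trans (Real.exp_le_exp.2 ?_)
  have h1 : 1 + ‖α * s + β‖ ≤ 2 * D * ‖s‖ := by
    have := (norm_add_le (α * s) β).trans_eq (by rw [norm_mul])
    nlinarith [mul_nonneg (norm_nonneg α) (norm_nonneg s), mul_nonneg (norm_nonneg β) (sub_nonneg.2 hs1),
      norm_nonneg α, norm_nonneg β, show D = 1 + ‖α‖ + ‖β‖ from rfl]
  have h2 : (1 + ‖α * s + β‖) ^ 2 ≤ (2 * D * ‖s‖) ^ 2 := pow_le_pow_left₀ (by positivity) h1 2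
  have e : ‖s‖ ^ (3 : ℝ) = ‖s‖ * ‖s‖ ^ 2 := by
    rw [show (3 : ℝ) = ((3 : ℕ) : ℝ) by norm_num, Real.rpow_natCast]; ring
  rw [e]
  calc C * (1 + ‖α * s + β‖) ^ 2 ≤ C * (2 * D * ‖s‖) ^ 2 := mul_le_mul_of_nonneg_left h2 hC0
    _ = C * (2 * D) ^ 2 * ‖s‖ ^ 2 := by ring
    _ ≤ ‖s‖ * ‖s‖ ^ 2 := mul_le_mul_of_nonneg_right (by linarith) (sq_nonneg _)

end FiniteOrder

/-! ### Normalized L-functions of eigenforms and their lifts -/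

section NormalizedLFunction

open MeasureTheory UpperHalfPlane CongruenceSubgroup
open scoped MatrixGroups Real ComplexConjugate

theorem LSeries.term_mul_cpow_neg (a : ℕ → ℂ) (w s : ℂ) (n : ℕ) :
    LSeries.term (fun n => a n * (n : ℂ) ^ (-w)) s n = LSeries.term a (s + w) n := by
  rcases eq_or_ne n 0 with rfl | hn
  · simp
  · have hn' : (n : ℂ) ≠ 0 := by exact_mod_cast hn
    rw [LSeries.term_of_ne_zero hn, LSeries.term_of_ne_zero hn, Complex.cpow_add _ _ hn',
      Complex.cpow_neg]
    have h1 := (Complex.cpow_ne_zero_iff (y := s)).2 (Or.inl hn')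
    have h2 := (Complex.cpow_ne_zero_iff (y := w)).2 (Or.inl hn')
    field_simp

variable {N : ℕ} [NeZero N] {K : ℤ} {χ : DirichletCharacter ℂ N} (hK : 0 < K)
  {f : CuspFormGamma1 N K}

theorem normalizedL_dirichlet {s : ℂ} (hs : 1 < s.re) :
    LSeriesSummable (fun n => (qExpansion 1 f).coeff n * (n : ℂ) ^ (-(((K : ℂ) - 1) / 2))) s ∧
      normalizedL hK f s =
        LSeries (fun n => (qExpansion 1 f).coeff n * (n : ℂ) ^ (-(((K : ℂ) - 1) / 2))) s := by
  have hre : ((K : ℝ) + 1) / 2 < (s + ((K : ℂ) - 1) / 2).re := by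
    have : (((K : ℂ) - 1) / 2) = (((K : ℝ) - 1) / 2 : ℝ) := by push_cast; rfl
    rw [this, Complex.add_re, Complex.ofReal_re]
    linarith
  constructor
  · rw [LSeriesSummable, funext (LSeries.term_mul_cpow_neg _ _ _)]
    exact LSeriesSummable_coeff f hK hre
  · rw [normalizedL, L_eq_LSeries hK hre, LSeries, LSeries]
    exact tsum_congr fun n => (LSeries.term_mul_cpow_neg _ _ _ n).symm

theorem kLift_normalizedL (k : ℕ) (s : ℂ) : kLift k (normalizedL hK f) s =
    ModularForm.L hK f ((k : ℂ) * s + ((K : ℂ) - k) / 2) := by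
  rw [kLift, normalizedL]
  congr 1
  ring

theorem kLift_one (F : ℂ → ℂ) : kLift 1 F = F := by
  funext s
  simp [kLift]

/-- With `u = ks + (K - k)/2` the reflection `u ↦ K - u` becomes `s ↦ 1 - s`, and `Γ(u)` is a single
factor with `λ = k` and `μ = (K - k)/2`. The hypothesis `k ≤ K` is what makes `μ` admissible. -/
theorem IsEigenform.satisfiesFunctionalEquation_kLift (hf : IsEigenform χ f) {k : ℕ}
    (hk : 1 ≤ k) (hkK : (k : ℤ) ≤ K) : ∃ (Q : ℝ) (omega : ℂ),
      SatisfiesFunctionalEquation (kLift k (normalizedL hK f)) 1 Q (fun _ => (k : ℝ))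
        (fun _ => ((K : ℂ) - k) / 2) omega := by
  obtain ⟨ω, hω, hΛ⟩ := hf.exists_Lambda_eq hK
  have hN0 : (0 : ℝ) < N := by exact_mod_cast Nat.pos_of_ne_zero (NeZero.ne N)
  have hk0 : (0 : ℝ) < k := by exact_mod_cast hk
  have hkK' : (k : ℝ) ≤ K := by exact_mod_cast hkK
  have hpi : (2 * π : ℂ) ≠ 0 := by exact_mod_cast Real.two_pi_pos.ne'
  have hN : (N : ℂ) ≠ 0 := by exact_mod_cast hN0.ne'
  -- `Q = exp (k L₁) = (√N / (2π))^k` combines the conductor power with the factor `(2π)^(-u)`.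
  set L₁ : ℝ := Real.log N / 2 - Real.log (2 * π) with hL₁
  have hlogN : Complex.log N = (Real.log N : ℂ) := by
    rw [← Complex.ofReal_natCast, Complex.ofReal_log hN0.le]
  have hlogpi : Complex.log (2 * π) = (Real.log (2 * π) : ℂ) := by
    rw [Complex.ofReal_log Real.two_pi_pos.le]; push_cast; rfl
  have hQ : (((Real.exp (k * L₁) : ℝ)) : ℂ) ≠ 0 := by exact_mod_cast (Real.exp_pos _).ne'
  have hlogQ : Complex.log ((Real.exp (k * L₁) : ℝ) : ℂ) = (k : ℂ) * L₁ := by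
    rw [← Complex.ofReal_log (Real.exp_pos _).le, Real.log_exp]; push_cast; rfl
  have hΓL : ∀ u : ℂ, (∀ n : ℕ, u ≠ -(n : ℂ)) → Complex.Gamma u * ModularForm.L hK f u =
      (2 * π : ℂ) ^ u * ModularForm.Λ hK f u := fun u hu => by
    have hG := Complex.Gamma_ne_zero hu
    rw [L_eq_mul_inv_Gamma]
    field_simp
  have hmu : conj (((K : ℂ) - k) / 2) = ((K : ℂ) - k) / 2 := by
    rw [map_div₀, map_sub, map_intCast, Complex.conj_natCast]
    congr 1
    exact Complex.conj_ofNat 2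
  refine ⟨Real.exp (k * L₁), ω, Real.exp_pos _, fun _ => hk0, fun _ => ?_, hω, ?_⟩
  · have : (((K : ℂ) - k) / 2) = (((K : ℝ) - k) / 2 : ℝ) := by push_cast; rfl
    rw [this, Complex.ofReal_re]
    linarith
  intro s _ _ h1 h2
  have h1' := h1 0
  have h2' := h2 0
  simp only [Finset.prod_const, Finset.card_univ, Fintype.card_fin, pow_one, kLift_normalizedL,
    Complex.star_def, Complex.ofReal_natCast, hmu] at h1' h2' ⊢
  set u : ℂ := (k : ℂ) * s + ((K : ℂ) - k) / 2 with hu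
  set v : ℂ := (k : ℂ) * (1 - s) + ((K : ℂ) - k) / 2 with hv
  have hvu : (k : ℂ) * (1 - conj s) + ((K : ℂ) - k) / 2 = conj v := by
    rw [hv, map_add, hmu]; simp
  have hKu : (K : ℂ) - conj u = conj v := by
    rw [hu, ← hvu, map_add, hmu, map_mul, Complex.conj_natCast]
    ring
  have e1 := hΓL u h1'
  have e2 := congrArg conj (hΓL (conj v) fun n hn => h2' n (by
    have := congrArg conj hn
    simpa using this))
  rw [map_mul, map_mul, Complex.Gamma_conj, Complex.conj_conj] at e2
  have hpiarg : (2 * π : ℂ).arg ≠ π := by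
    rw [← Complex.ofReal_ofNat, ← Complex.ofReal_mul, Complex.arg_ofReal_of_nonneg
      Real.two_pi_pos.le]
    exact Real.pi_pos.ne
  have hcj : conj ((2 * π : ℂ) ^ conj v) = (2 * π : ℂ) ^ v := by
    have h := Complex.cpow_conj (2 * π : ℂ) v hpiarg
    rw [h, Complex.conj_conj]
    congr 1
    rw [map_mul, Complex.conj_ofReal]
    congr 1
    exact Complex.conj_ofNat 2
  rw [hcj] at e2
  have hΛu := hΛ u
  rw [hKu] at hΛu
  rw [hvu, mul_assoc, e1, hΛu, mul_assoc (ω * _), e2]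
  have key : ((Real.exp (k * L₁) : ℝ) : ℂ) ^ s * (2 * π : ℂ) ^ u * (N : ℂ) ^ ((K : ℂ) / 2 - u) =
      ((Real.exp (k * L₁) : ℝ) : ℂ) ^ (1 - s) * (2 * π : ℂ) ^ v := by
    rw [Complex.cpow_def_of_ne_zero hQ, Complex.cpow_def_of_ne_zero hQ,
      Complex.cpow_def_of_ne_zero hpi, Complex.cpow_def_of_ne_zero hpi,
      Complex.cpow_def_of_ne_zero hN, hlogQ, hlogpi, hlogN, ← Complex.exp_add,
      ← Complex.exp_add, ← Complex.exp_add, hu, hv, hL₁]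
    congr 1
    push_cast
    ring
  linear_combination ω * conj (ModularForm.Λ hK f (conj v)) * key

theorem IsEigenform.kLift_mem (hf : IsEigenform χ f) {k : ℕ} (hk : 1 ≤ k) (hkK : (k : ℤ) ≤ K) :
    InExtendedSelbergClass (kLift k (normalizedL hK f)) where
  ne_zero h := by
    refine L_ne_zero hK hf.coeff_one_ne_zero (funext fun u => ?_)
    have hk0 : (k : ℂ) ≠ 0 := by exact_mod_cast Nat.one_le_iff_ne_zero.1 hk
    have h1 := congrFun h ((u - ((K : ℂ) - k) / 2) / k)
    rw [kLift_normalizedL, mul_div_cancel₀ _ hk0, sub_add_cancel] at h1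
    exact h1
  dirichlet := by
    refine ⟨_, fun s hs => kLift_dirichlet hk (fun s hs => normalizedL_dirichlet hK hs) ?_⟩
    have hk' : (1 : ℝ) ≤ k := by exact_mod_cast hk
    have : 1 / (2 * (k : ℝ)) ≤ 1 / 2 := one_div_le_one_div_of_le (by norm_num) (by linarith)
    linarith
  continuation := by
    obtain ⟨C, hC0, hC⟩ := hf.exists_norm_L_le_exp hK
    refine ⟨0, kLift k (normalizedL hK f), ?_, ⟨3, ?_⟩, fun s _ => by simp, Or.inl rfl⟩
    · rw [funext (kLift_normalizedL hK k)]
      exact (CuspForm.differentiable_L hK f).comp (by fun_prop)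
    · rw [funext (kLift_normalizedL hK k)]
      exact isBigO_exp_of_norm_le_comp_affine hC0 hC _ _
  functional_equation := by
    obtain ⟨Q, ω, h⟩ := hf.satisfiesFunctionalEquation_kLift hK hk hkK
    exact ⟨_, _, _, _, _, h⟩

theorem IsEigenform.normalizedL_mem (hf : IsEigenform χ f) :
    InExtendedSelbergClass (normalizedL hK f) := by
  simpa only [kLift_one] using hf.kLift_mem hK le_rfl (by exact_mod_cast hK)

theorem IsEigenform.hasDegree_normalizedL (hf : IsEigenform χ f) :
    HasDegree (normalizedL hK f) 2 := by
  obtain ⟨Q, ω, h⟩ := hf.satisfiesFunctionalEquation_kLift hK le_rfl (by exact_mod_cast hK)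
  rw [kLift_one] at h
  exact ⟨_, _, _, _, _, h, by simp⟩

end NormalizedLFunction

/-! ### Commuting operators and commutation on coefficients -/

section HeckeCommute

/-- A minimal nonzero subspace stable under all the operators lies in an eigenspace of each: by
commutation, its intersection with an eigenspace is again stable. -/
theorem exists_common_eigenvector {V ι : Type*} [AddCommGroup V] [Module ℂ V]
    [FiniteDimensional ℂ V] [Nontrivial V] (T : ι → Module.End ℂ V)
    (hT : ∀ i j, Commute (T i) (T j)) : ∃ v : V, v ≠ 0 ∧ ∀ i, ∃ c : ℂ, T i v = c • v := by
  obtain ⟨W, ⟨hW0, hWT⟩, hWmin⟩ := wellFounded_lt.has_min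
    {W : Submodule ℂ V | W ≠ ⊥ ∧ ∀ i, ∀ w ∈ W, T i w ∈ W} ⟨⊤, top_ne_bot, fun _ _ _ => trivial⟩
  obtain ⟨v, hvW, hv0⟩ := Submodule.exists_mem_ne_zero_of_ne_bot hW0
  refine ⟨v, hv0, fun i => ?_⟩
  have : Nontrivial W := Submodule.nontrivial_iff_ne_bot.2 hW0
  obtain ⟨c, hc⟩ := Module.End.exists_eigenvalue ((T i).restrict (hWT i))
  obtain ⟨w, hw⟩ := hc.exists_hasEigenvector
  have hTw : T i w = c • (w : V) := congrArg Subtype.val hw.apply_eq_smul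
  have hE : ¬ W ⊓ Module.End.eigenspace (T i) c < W := hWmin _ ⟨by
    rw [Submodule.ne_bot_iff]
    exact ⟨w, ⟨w.2, Module.End.mem_eigenspace_iff.2 hTw⟩, fun h => hw.2 (Subtype.ext h)⟩,
    fun j u hu => ⟨hWT j u hu.1, Module.End.mem_eigenspace_iff.2 (by
      have h1 := Module.End.mem_eigenspace_iff.1 hu.2
      have h2 := LinearMap.congr_fun (hT i j).eq u
      rw [Module.End.mul_apply, Module.End.mul_apply, h1, map_smul] at h2
      exact h2)⟩⟩
  have hEW : W ⊓ Module.End.eigenspace (T i) c = W := by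
    by_contra h
    exact hE (lt_of_le_of_ne inf_le_left h)
  rw [← hEW] at hvW
  exact ⟨c, Module.End.mem_eigenspace_iff.1 hvW.2⟩

variable {N : ℕ} (χ : DirichletCharacter ℂ N) (K : ℤ)

theorem heckeCoeff_heckeCoeff (l n : ℕ) (a : ℕ → ℂ) (m : ℕ) :
    heckeCoeff χ K l (heckeCoeff χ K n a) m =
      ∑ x ∈ (l.divisorsAntidiagonal ×ˢ n.divisorsAntidiagonal).filter
          (fun x => x.1.1 ∣ m ∧ x.1.1 * x.2.1 ∣ x.1.2 * m),
        χ ((x.1.1 * x.2.1 : ℕ) : ZMod N) * ((x.1.1 * x.2.1 : ℕ) : ℂ) ^ (K - 1) *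
          a (x.1.2 * x.2.2 * m / (x.1.1 * x.2.1)) := by
  rw [Finset.sum_filter, Finset.sum_product]
  simp only [heckeCoeff]
  refine Finset.sum_congr rfl fun p hp => ?_
  obtain ⟨hp1, hl⟩ := Nat.mem_divisorsAntidiagonal.1 hp
  have hA : 0 < p.1 := Nat.pos_of_ne_zero fun h => hl (by rw [← hp1, h, zero_mul])
  by_cases hpm : p.1 ∣ m
  · obtain ⟨m', rfl⟩ := hpm
    rw [if_pos (dvd_mul_right _ _), Nat.mul_div_cancel_left _ hA, Finset.mul_sum]
    refine Finset.sum_congr rfl fun q hq => ?_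
    obtain ⟨hq1, hn⟩ := Nat.mem_divisorsAntidiagonal.1 hq
    have hB : 0 < q.1 := Nat.pos_of_ne_zero fun h => hn (by rw [← hq1, h, zero_mul])
    have e : p.2 * (p.1 * m') = p.1 * (p.2 * m') := by ring
    have hiff : p.1 * q.1 ∣ p.2 * (p.1 * m') ↔ q.1 ∣ p.2 * m' := by
      rw [e, Nat.mul_dvd_mul_iff_left hA]
    by_cases hq : q.1 ∣ p.2 * m'
    · have e2 : p.2 * q.2 * (p.1 * m') / (p.1 * q.1) = q.2 * (p.2 * m' / q.1) := by
        obtain ⟨c, hc⟩ := hq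
        rw [hc, Nat.mul_div_cancel_left _ hB]
        refine Nat.div_eq_of_eq_mul_left (by positivity) ?_
        linear_combination (q.2 * p.1) * hc
      rw [if_pos hq, if_pos ⟨dvd_mul_right _ _, hiff.2 hq⟩, e2]
      push_cast
      rw [map_mul, mul_zpow]
      ring
    · rw [if_neg hq, if_neg fun h => hq (hiff.1 h.2)]
      ring
  · rw [if_neg hpm, mul_zero, Finset.sum_eq_zero fun q _ => if_neg fun h => hpm h.1]

/-- The exchange of the factors of `(A D, B E)` behind the commutation of Hecke operators. -/
def heckeSwap (x : (ℕ × ℕ) × ℕ × ℕ) : (ℕ × ℕ) × ℕ × ℕ :=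
  ((x.2.1 / x.2.1.gcd x.1.2 * x.1.1.gcd x.2.2, x.2.2 / x.1.1.gcd x.2.2 * x.2.1.gcd x.1.2),
    (x.1.1 / x.1.1.gcd x.2.2 * x.2.1.gcd x.1.2, x.1.2 / x.2.1.gcd x.1.2 * x.1.1.gcd x.2.2))

/-- Exchanging `(A, D)` and `(B, E)` outright may destroy the condition `A ∣ m`. Writing `A = αg`,
`E = εg`, `B = βh`, `D = δh` with `(α, ε) = (β, δ) = 1`, the pairs `(βg, εh)` and `(αh, δg)` keep
`AB` and `DE`, and coprimality of `β` and `δ` supplies the divisibility. -/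
theorem heckeSwap_spec {A D B E : ℕ} (hA : 0 < A) (hB : 0 < B) (m : ℕ)
    (h1 : A ∣ m) (h2 : A * B ∣ D * m) : ∃ A' D' B' E', heckeSwap ((A, D), (B, E)) =
      ((B', E'), (A', D')) ∧ A' * D' = A * D ∧ B' * E' = B * E ∧ A' * B' = A * B ∧
        D' * E' = D * E ∧ B' ∣ m ∧ B' * A' ∣ E' * m ∧
        heckeSwap ((B', E'), (A', D')) = ((A, D), (B, E)) := by
  obtain ⟨g, α, ε, hg, hcop, rfl, rfl⟩ := Nat.exists_coprime' (m := A) (n := E)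
    (Nat.gcd_pos_of_pos_left _ hA)
  obtain ⟨h, β, δ, hh, hcop', rfl, rfl⟩ := Nat.exists_coprime' (m := B) (n := D)
    (Nat.gcd_pos_of_pos_left _ hB)
  have key : ∀ {x y u v : ℕ}, x.Coprime y → 0 < u → 0 < v → (x * u).gcd (y * u) = u := by
    intro x y u v hxy _ _
    rw [Nat.gcd_mul_right, hxy.gcd_eq_one, one_mul]
  have hsw : ∀ {α ε β δ g h : ℕ}, α.Coprime ε → β.Coprime δ → 0 < g → 0 < h →
      heckeSwap ((α * g, δ * h), (β * h, ε * g)) = ((β * g, ε * h), (α * h, δ * g)) := by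
    intro α ε β δ g h h1 h2 hg hh
    simp only [heckeSwap, key h1 hg hg, key h2 hh hh, Nat.mul_div_cancel _ hg,
      Nat.mul_div_cancel _ hh]
  obtain ⟨m', rfl⟩ := h1
  have hβ : β ∣ m' := by
    have : (α * g * h) * β ∣ (α * g * h) * (δ * m') := by
      convert h2 using 1 <;> ring
    exact hcop'.dvd_of_dvd_mul_left ((Nat.mul_dvd_mul_iff_left (by positivity)).1 this)
  obtain ⟨m'', rfl⟩ := hβ
  refine ⟨α * h, δ * g, β * g, ε * h, hsw hcop hcop' hg hh, by ring, by ring, by ring, by ring,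
    ⟨α * m'', by ring⟩, ⟨ε * m'', by ring⟩, ?_⟩
  exact hsw hcop' hcop hg hh |>.trans (by rfl)

theorem heckeCoeff_comm (l n : ℕ) (a : ℕ → ℂ) :
    heckeCoeff χ K l (heckeCoeff χ K n a) = heckeCoeff χ K n (heckeCoeff χ K l a) := by
  funext m
  rw [heckeCoeff_heckeCoeff, heckeCoeff_heckeCoeff]
  have main : ∀ (l n : ℕ) (x : (ℕ × ℕ) × ℕ × ℕ),
      x ∈ (l.divisorsAntidiagonal ×ˢ n.divisorsAntidiagonal).filter
          (fun x => x.1.1 ∣ m ∧ x.1.1 * x.2.1 ∣ x.1.2 * m) →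
      heckeSwap x ∈ (n.divisorsAntidiagonal ×ˢ l.divisorsAntidiagonal).filter
          (fun x => x.1.1 ∣ m ∧ x.1.1 * x.2.1 ∣ x.1.2 * m) ∧
        heckeSwap (heckeSwap x) = x ∧
        x.1.1 * x.2.1 = (heckeSwap x).1.1 * (heckeSwap x).2.1 ∧
        x.1.2 * x.2.2 = (heckeSwap x).1.2 * (heckeSwap x).2.2 := by
    rintro l n ⟨⟨A, D⟩, B, E⟩ hx
    rw [Finset.mem_filter, Finset.mem_product, Nat.mem_divisorsAntidiagonal,
      Nat.mem_divisorsAntidiagonal] at hx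
    obtain ⟨⟨⟨hl, hl0⟩, hn, hn0⟩, h1, h2⟩ := hx
    simp only at hl hn h1 h2
    obtain ⟨A', D', B', E', hs, h3, h4, h5, h6, h7, h8, h9⟩ := heckeSwap_spec
      (Nat.pos_of_ne_zero fun h => hl0 (by rw [← hl, h, zero_mul]))
      (Nat.pos_of_ne_zero fun h => hn0 (by rw [← hn, h, zero_mul])) (E := E) m h1 h2
    rw [hs, Finset.mem_filter, Finset.mem_product, Nat.mem_divisorsAntidiagonal,
      Nat.mem_divisorsAntidiagonal]
    exact ⟨⟨⟨⟨h4.trans hn, hn0⟩, h3.trans hl, hl0⟩, h7, h8⟩, h9, by linarith, by linarith⟩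
  refine Finset.sum_nbij' heckeSwap heckeSwap (fun x hx => (main l n x hx).1)
    (fun x hx => (main n l x hx).1) (fun x hx => (main l n x hx).2.1)
    (fun x hx => (main n l x hx).2.1) fun x hx => ?_
  obtain ⟨-, -, h1, h2⟩ := main l n x hx
  rw [h1, h2]

end HeckeCommute

/-! ### Eigenforms of level one and the limit to 1/2 -/

section LevelOneHecke

open UpperHalfPlane CongruenceSubgroup ModularForm
open scoped MatrixGroups Manifold ModularForm

variable {K : ℤ}

theorem heckeT_add {N : ℕ} (χ : DirichletCharacter ℂ N) (n : ℕ) (f g : ℍ → ℂ) :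
    heckeT χ K n (f + g) = heckeT χ K n f + heckeT χ K n g := by
  funext z
  simp only [heckeT, Pi.add_apply, Finset.sum_add_distrib, mul_add]

theorem heckeT_smul {N : ℕ} (χ : DirichletCharacter ℂ N) (n : ℕ) (c : ℂ) (f : ℍ → ℂ) :
    heckeT χ K n (c • f) = c • heckeT χ K n f := by
  funext z
  simp only [heckeT, Pi.smul_apply, smul_eq_mul, ← Finset.mul_sum]
  simp only [Finset.mul_sum]
  exact Finset.sum_congr rfl fun p _ => Finset.sum_congr rfl fun b _ => by ring

theorem slash_eq_of_levelOne (f : CuspFormGamma1 1 K) (γ : SL(2, ℤ)) :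
    (f : ℍ → ℂ) ∣[K] (γ : GL (Fin 2) ℝ) = f :=
  f.slash_action_eq' _ ⟨γ, by simp [Gamma1_mem, Subsingleton.elim _ (1 : ZMod 1)], rfl⟩

theorem heckeT_one_eq_sum_slash (n : ℕ) (f : ℍ → ℂ) :
    heckeT (1 : DirichletCharacter ℂ 1) K n f = ∑ i : heckeIndex 1 n, f ∣[K] upperGL i := by
  rw [heckeT_eq_sum_slash]
  refine Finset.sum_congr rfl fun i _ => ?_
  rw [Subsingleton.elim (i.1.1.1 : ZMod 1) 1, map_one, one_smul]

theorem intGL_mul_coe {M M' : Matrix (Fin 2) (Fin 2) ℤ} (h : M.det ≠ 0) (h' : M'.det ≠ 0)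
    {γ γ' : SL(2, ℤ)} (e : (γ' : Matrix (Fin 2) (Fin 2) ℤ) * M' = M * γ) :
    intGL M h * (γ : GL (Fin 2) ℝ) = (γ' : GL (Fin 2) ℝ) * intGL M' h' := by
  have hcoe : ∀ (γ : SL(2, ℤ)) (i j : Fin 2), (γ : GL (Fin 2) ℝ) i j = ((γ i j : ℤ) : ℝ) :=
    fun _ _ _ => rfl
  ext i j
  have := congrArg (Int.cast : ℤ → ℝ) (congrFun (congrFun e i) j)
  rw [Matrix.mul_apply, Matrix.mul_apply] at this
  push_cast at this
  rw [Matrix.GeneralLinearGroup.coe_mul, Matrix.GeneralLinearGroup.coe_mul, Matrix.mul_apply,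
    Matrix.mul_apply]
  simp only [intGL_apply, hcoe]
  exact this.symm

/-- Right multiplication by `γ` permutes the left cosets of the representatives; injectivity on a
finite set suffices. -/
theorem heckeT_slash (n : ℕ) (f : CuspFormGamma1 1 K) (γ : SL(2, ℤ)) :
    heckeT (1 : DirichletCharacter ℂ 1) K n f ∣[K] (γ : GL (Fin 2) ℝ) =
      heckeT (1 : DirichletCharacter ℂ 1) K n f := by
  have hex : ∀ i : heckeIndex 1 n, ∃ j : heckeIndex 1 n, ∃ γ' : SL(2, ℤ),
      (γ' : Matrix (Fin 2) (Fin 2) ℤ) * upperRep j = upperRep i * γ := fun i => by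
    obtain ⟨⟨h1, h2⟩, -⟩ := mem_heckeIndex.1 i.2
    obtain ⟨j, hj, γ', -, e⟩ := exists_eq_mul_upperRep (N := 1) h2
      (M := upperRep i * (γ : Matrix (Fin 2) (Fin 2) ℤ))
      (by rw [Matrix.det_mul, γ.det_coe, mul_one, det_upperRep]; exact_mod_cast h1)
      (by simp) (by simpa using isCoprime_one_right)
    exact ⟨⟨j, hj⟩, γ', e⟩
  choose j γ' hj using hex
  have hinj : Function.Injective j := fun i i' h => by
    have e1 := hj i
    have e2 := hj i'
    rw [h] at e1
    have e3 : ((γ' i' * (γ' i)⁻¹ : SL(2, ℤ)) : Matrix (Fin 2) (Fin 2) ℤ) * upperRep i =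
        ((1 : SL(2, ℤ)) : Matrix (Fin 2) (Fin 2) ℤ) * upperRep i' := by
      have e4 : (γ : Matrix (Fin 2) (Fin 2) ℤ) * ((γ⁻¹ : SL(2, ℤ)) : Matrix (Fin 2) (Fin 2) ℤ) = 1 := by
        rw [← Matrix.SpecialLinearGroup.coe_mul, mul_inv_cancel, Matrix.SpecialLinearGroup.coe_one]
      have e5 : (((γ' i)⁻¹ : SL(2, ℤ)) : Matrix (Fin 2) (Fin 2) ℤ) * (γ' i : Matrix (Fin 2) (Fin 2) ℤ)
          = 1 := by
        rw [← Matrix.SpecialLinearGroup.coe_mul, inv_mul_cancel, Matrix.SpecialLinearGroup.coe_one]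
      have e6 : upperRep i = (γ' i : Matrix (Fin 2) (Fin 2) ℤ) * upperRep (j i') *
          ((γ⁻¹ : SL(2, ℤ)) : Matrix (Fin 2) (Fin 2) ℤ) := by
        rw [e1, mul_assoc, e4, mul_one]
      have e7 : upperRep i' = (γ' i' : Matrix (Fin 2) (Fin 2) ℤ) * upperRep (j i') *
          ((γ⁻¹ : SL(2, ℤ)) : Matrix (Fin 2) (Fin 2) ℤ) := by
        rw [e2, mul_assoc, e4, mul_one]
      rw [Matrix.SpecialLinearGroup.coe_one, one_mul, Matrix.SpecialLinearGroup.coe_mul, e6, e7,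
        mul_assoc, ← mul_assoc _ (_ * _) _, ← mul_assoc _ _ (upperRep _), e5, one_mul, mul_assoc]
    exact Subtype.ext (eq_of_mul_upperRep_eq i.2 i'.2 e3).1
  have hbij : Function.Bijective j := Finite.injective_iff_bijective.1 hinj
  rw [heckeT_one_eq_sum_slash, SlashAction.sum_slash]
  refine (Finset.sum_congr rfl fun i _ => ?_).trans
    (Function.Bijective.sum_comp hbij fun i => (f : ℍ → ℂ) ∣[K] upperGL i)
  rw [← SlashAction.slash_mul, upperGL, intGL_mul_coe _ _ (hj i), SlashAction.slash_mul,
    slash_eq_of_levelOne]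
  rfl

noncomputable section

/-- The Hecke operator `T_n` on cusp forms of level one. -/
def heckeOperator (K : ℤ) (n : ℕ) : Module.End ℂ (CuspFormGamma1 1 K) where
  toFun f :=
    { toFun := heckeT (1 : DirichletCharacter ℂ 1) K n f
      slash_action_eq' := by
        rintro _ ⟨γ, -, rfl⟩
        exact heckeT_slash n f γ
      holo' := by
        change MDiff (heckeT (1 : DirichletCharacter ℂ 1) K n f)
        rw [heckeT_one_eq_sum_slash]
        exact MDifferentiable.sum fun i _ => (CuspFormClass.holo f).slash K _
      -- All cusps are equivalent under the modular group, so by invariance only infinity matters.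
      -- There each upper triangular representative preserves vanishing.
      zero_at_cusps' := fun {c} hc => by
        have hc' : IsCusp c 𝒮ℒ := hc.mono (by rw [MonoidHom.range_eq_map]; exact Subgroup.map_mono le_top)
        rw [OnePoint.isZeroAt_iff_forall_SL2Z hc']
        intro γ _
        change IsZeroAtImInfty (heckeT (1 : DirichletCharacter ℂ 1) K n f ∣[K] γ)
        rw [SL_slash, heckeT_slash, heckeT_one_eq_sum_slash]
        have h0 : IsZeroAtImInfty (f : ℍ → ℂ) := CuspFormClass.zero_at_infty f
        have h1 : ∀ i : heckeIndex 1 n, IsZeroAtImInfty ((f : ℍ → ℂ) ∣[K] upperGL i) := fun i =>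
          IsZeroAtImInfty.slash K (by simp [upperGL, intGL_apply, upperRep]) h0
        have h2 := tendsto_finsetSum Finset.univ fun i _ => h1 i
        simpa only [IsZeroAtImInfty, Filter.ZeroAtFilter, Finset.sum_const_zero,
          Finset.sum_fn] using h2 }
  map_add' f g := by
    ext z
    exact congrFun (heckeT_add _ _ _ _) z
  map_smul' c f := by
    ext z
    exact congrFun (heckeT_smul _ _ _ _) z

end

theorem coe_heckeOperator (n : ℕ) (f : CuspFormGamma1 1 K) :
    (heckeOperator K n f : ℍ → ℂ) = heckeT (1 : DirichletCharacter ℂ 1) K n f := rfl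

/-- Two functions with the same Fourier expansion coincide, so commutation may be checked on
coefficients. -/
theorem heckeOperator_commute (l n : ℕ) : Commute (heckeOperator K l) (heckeOperator K n) := by
  refine LinearMap.ext fun f => ?_
  refine DFunLike.coe_injective ?_
  have hf := hasQExpansion_cuspForm f
  have h1 := (hf.heckeT (1 : DirichletCharacter ℂ 1) K n).heckeT (1 : DirichletCharacter ℂ 1) K l
  have h2 := (hf.heckeT (1 : DirichletCharacter ℂ 1) K l).heckeT (1 : DirichletCharacter ℂ 1) K n
  rw [heckeCoeff_comm] at h1
  funext z
  exact (h1 z).unique (h2 z)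

theorem fricke_one (f : CuspFormGamma1 1 K) : fricke 1 K f = f := by
  have h : frickeGL 1 = (ModularGroup.S : GL (Fin 2) ℝ) := by
    ext i j
    have hcoe : (ModularGroup.S : GL (Fin 2) ℝ) i j = ((ModularGroup.S i j : ℤ) : ℝ) := rfl
    rw [hcoe]
    fin_cases i <;> fin_cases j <;> simp [frickeGL, intGL_apply, ModularGroup.S]
  rw [fricke_eq_slash, h, slash_eq_of_levelOne]
  simp

theorem map_Gamma1_one : (Gamma1 1).map (Matrix.SpecialLinearGroup.mapGL ℝ) = 𝒮ℒ := by
  have : Gamma1 1 = ⊤ := by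
    ext γ
    simp [Gamma1_mem, Subsingleton.elim _ (1 : ZMod 1)]
  rw [this, MonoidHom.range_eq_map]

theorem finiteDimensional_cuspForm_of_eq {Γ : Subgroup (GL (Fin 2) ℝ)} [Γ.HasDetOne] (h : Γ = 𝒮ℒ) :
    FiniteDimensional ℂ (CuspForm Γ K) := by
  subst h
  exact Module.Finite.equiv CuspForm.discriminantEquiv.symm

/-- Division by the discriminant identifies these cusp forms with modular forms of weight `12j`, a
space of positive dimension. -/
theorem nontrivial_cuspForm_of_eq {Γ : Subgroup (GL (Fin 2) ℝ)} [Γ.HasDetOne] (h : Γ = 𝒮ℒ)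
    (j : ℕ) : Nontrivial (CuspForm Γ (12 * (j + 1) : ℤ)) := by
  subst h
  have e : (12 * (j + 1) : ℤ) - 12 = ((12 * j : ℕ) : ℤ) := by push_cast; ring
  have h1 := ModularForm.dimension_level_one (12 * j) (by simp [parity_simps])
  rw [← e, ← CuspForm.discriminantEquiv.rank_eq, if_neg (by simp [Nat.ModEq])] at h1
  refine rank_pos_iff_nontrivial.1 (?_ : 0 < Module.rank ℂ _)
  rw [h1]
  exact_mod_cast Nat.succ_pos _

/-- In level one the Fricke involution is the identity and the character is trivial, so the adjoint
condition repeats the eigenvalue condition. -/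
theorem exists_isEigenform (j : ℕ) :
    ∃ f : CuspFormGamma1 1 (12 * (j + 1)), IsEigenform (1 : DirichletCharacter ℂ 1) f := by
  have := finiteDimensional_cuspForm_of_eq (K := 12 * (j + 1)) map_Gamma1_one
  have := nontrivial_cuspForm_of_eq map_Gamma1_one j
  obtain ⟨f, hf0, hf⟩ := exists_common_eigenvector (heckeOperator (12 * (j + 1)))
    heckeOperator_commute
  have heig : ∀ n : ℕ, ∃ c : ℂ, ∀ z : ℍ,
      heckeT (1 : DirichletCharacter ℂ 1) (12 * (j + 1)) n f z = c * f z := fun n => by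
    obtain ⟨c, hc⟩ := hf n
    refine ⟨c, fun z => ?_⟩
    rw [← coe_heckeOperator, hc]
    rfl
  refine ⟨f, hf0, fun γ _ z => ?_, fun n _ => heig n, fun n _ => ?_⟩
  · have h1 := congrFun (slash_eq_of_levelOne f γ) z
    rw [← SL_slash, SL_slash_apply] at h1
    have h : denom (γ : GL (Fin 2) ℝ) z = ((γ 1 0 : ℤ) : ℂ) * (z : ℂ) + ((γ 1 1 : ℤ) : ℂ) := by
      simp [denom]
    have h0 := denom_ne_zero (γ : GL (Fin 2) ℝ) z
    rw [Subsingleton.elim ((γ 1 1 : ℤ) : ZMod 1) 1, map_one, one_mul, ← h, ← h1,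
      mul_comm (f _), ← mul_assoc, ← zpow_add₀ h0, add_neg_cancel, zpow_zero, one_mul]
  · rw [fricke_one, inv_one]
    exact heig n

theorem exists_isEigenform_sigmaA_kLift_lt (ε : ℝ) (M : ℤ) (hε : 0 < ε) :
    ∃ (N : ℕ) (_ : NeZero N) (K : ℤ) (hK : 0 < K) (χ : DirichletCharacter ℂ N)
      (f : CuspFormGamma1 N K) (k : ℕ), M ≤ K ∧ IsEigenform χ f ∧ 1 ≤ k ∧ (k : ℤ) ≤ K ∧
        InExtendedSelbergClass (kLift k (normalizedL hK f)) ∧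
        ((1 / 2 : ℝ) : EReal) < sigmaA (kLift k (normalizedL hK f)) ∧
        sigmaA (kLift k (normalizedL hK f)) < ((1 / 2 + ε : ℝ) : EReal) := by
  -- Weight and lift are both `12(j+1)`; the upper bound `1/2 + 1/(24(j+1))` then stays below `1/2 +
  -- ε`, and degree `2` keeps the lower bound above `1/2`.
  obtain ⟨j, hj⟩ := exists_nat_ge (max (M : ℝ) (1 / ε))
  have hMj : M ≤ j := by exact_mod_cast (le_max_left _ _).trans hj
  obtain ⟨f, hf⟩ := exists_isEigenform j
  have hK : (0 : ℤ) < 12 * (j + 1) := by positivity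
  have hk : 1 ≤ 12 * (j + 1) := by lia
  have hkK : ((12 * (j + 1) : ℕ) : ℤ) ≤ 12 * (j + 1) := by push_cast; rfl
  obtain ⟨h1, h2⟩ := sigmaA_kLift_bounds (hf.normalizedL_mem hK) (hf.hasDegree_normalizedL hK)
    one_le_two hk
  have hj0 : (0 : ℝ) ≤ j := j.cast_nonneg
  refine ⟨1, inferInstance, 12 * (j + 1), hK, 1, f, 12 * (j + 1), by lia, hf, hk, hkK,
    hf.kLift_mem hK hk hkK, lt_of_lt_of_le ?_ h1, lt_of_le_of_lt h2 ?_⟩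
  · rw [EReal.coe_lt_coe_iff]
    have : (0 : ℝ) < 1 / (2 * ((12 * (j + 1) : ℕ) : ℝ) * 2) := by positivity
    linarith
  · rw [EReal.coe_lt_coe_iff]
    have h3 : 1 / ε ≤ j := (le_max_right _ _).trans hj
    rw [div_le_iff₀ hε] at h3
    have h4 : 1 / (2 * ((12 * (j + 1) : ℕ) : ℝ)) < ε := by
      rw [div_lt_iff₀ (by positivity)]
      push_cast
      nlinarith
    linarith

end LevelOneHecke

theorem mainTheorem4 :
    -- the two-sided bound for the abscissa of absolute convergence of a lift
    (∀ (F : ℂ → ℂ) (d : ℝ) (k : ℕ), InExtendedSelbergClass F → HasDegree F d → 1 ≤ d → 1 ≤ k →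
      InExtendedSelbergClass (kLift k F) →
        ((1 / 2 + 1 / (2 * (k : ℝ) * d) : ℝ) : EReal) ≤ sigmaA (kLift k F) ∧
          sigmaA (kLift k F) ≤ ((1 / 2 + 1 / (2 * (k : ℝ)) : ℝ) : EReal)) ∧
    -- eigenforms of weight `K` may be lifted inside the class with `k` up to `K`
    (∀ (N : ℕ) [NeZero N] (K : ℤ) (hK : 0 < K) (χ : DirichletCharacter ℂ N)
      (f : CuspFormGamma1 N K), IsEigenform χ f →
        InExtendedSelbergClass (normalizedL hK f) ∧ HasDegree (normalizedL hK f) 2 ∧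
          ∀ k : ℕ, 1 ≤ k → (k : ℤ) ≤ K → InExtendedSelbergClass (kLift k (normalizedL hK f))) ∧
    -- such lifts, with arbitrarily large weight, have abscissa arbitrarily close to `1/2`
    (∀ (ε : ℝ) (M : ℤ), 0 < ε →
      ∃ (N : ℕ) (_ : NeZero N) (K : ℤ) (hK : 0 < K) (χ : DirichletCharacter ℂ N)
        (f : CuspFormGamma1 N K) (k : ℕ), M ≤ K ∧ IsEigenform χ f ∧ 1 ≤ k ∧ (k : ℤ) ≤ K ∧
          InExtendedSelbergClass (kLift k (normalizedL hK f)) ∧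
          ((1 / 2 : ℝ) : EReal) < sigmaA (kLift k (normalizedL hK f)) ∧
          sigmaA (kLift k (normalizedL hK f)) < ((1 / 2 + ε : ℝ) : EReal)) := by
  refine ⟨fun F d k hF hd h1 hk _ => sigmaA_kLift_bounds hF hd h1 hk, ?_,
    exists_isEigenform_sigmaA_kLift_lt⟩
  intro N _ K hK χ f hf
  exact ⟨hf.normalizedL_mem hK, hf.hasDegree_normalizedL hK, fun k => hf.kLift_mem hK⟩
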